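/- **Theorem 1.** Let $P$ be a finite set of points in the plane, not all on one line, and let a Delaunay triangulation of $P$ be given: a set of triangles with vertices in $P$ that have pairwise disjoint interiors, cover the convex hull of $P$, and whose circumscribed circles contain no point of $P$ in their interior. Its edges are weighted by Euclidean length. Let $s,t\in P$, $s\neq t$, and choose orthogonal coordinates in which $s$ and $t$ lie on the $x$-axis and $s$ is to the left of $t$. *Chew's algorithm.* Consider the triangles that intersect the segment $[st]$, ordered from left to right; here a vertex other than $s,t$ that lies on $[st]$ is considered to be slightly above $[st]$, so that the relevant triangles are those that contain a point of $[st]$ other than $s,t$ and have a vertex strictly below the line $st$. (If no point of $P$ is strictly below the line $st$, then "above" and "below" are exchanged in this convention.) The message starts at $p_0=s$. When it is at $p_i\neq t$, let $T_i$ be the rightmost of these triangles that has $p_i$ as a vertex, $C_i$ its circumscribed circle, $w_i$ the leftmost point of $C_i$, and $r_i$ the rightmost intersection of $C_i$ with $[st]$. If $p_i$ belongs to the closed arc of $C_i$ that goes clockwise from $w_i$ to $r_i$ (in particular if $p_i=w_i$), then $p_{i+1}$ is the first vertex of $T_i$ after $p_i$ that is reached when walking clockwise along $C_i$; otherwise $p_{i+1}$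 is the first vertex of $T_i$ that is reached when walking counterclockwise along $C_i$. The algorithm stops when it reaches $t$. *Claim.* The vertex $p_{i+1}$ is always well defined, and it is determined, by one rule that does not depend on $P$, by the coordinates of $s$, $t$, $p_i$ and of the neighbours of $p_i$ in the triangulation alone. That is, Chew's algorithm is a deterministic $1$-local routing algorithm, and the message header need only contain the coordinates of $s$ and $t$. For all $P$, all Delaunay triangulations of $P$ and all $s,t\in P$, the algorithm terminates and produces a path from $s$ to $t$ along edges of the triangulation whose length is at most $$\left(1.185043874+\frac{3\pi}{2}\right)|st| \qquad (\text{the constant is} \approx 5.8974),$$ that is, the algorithm has routing ratio at most $1.185043874+3\pi/2$. Consequently the length of this path is also at most $1.185043874+3\pi/2$ times the length of a shortest path from $s$ to $t$ in the triangulation, that is, the competitive ratio of the algorithm has the same upper bound. -/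

import Mathlib

noncomputable section

namespace ChewRouting

/-! The Euclidean plane is `ℂ`, with its usual distance. -/

/-- `c` and `ρ` are the center and the radius of a circle through all vertices in `T`. -/
def IsCircumcircle (T : Finset ℂ) (c : ℂ) (ρ : ℝ) : Prop :=
  ∀ v ∈ T, dist v c = ρ

/-- `𝒯` is (the set of triangles of) a Delaunay triangulation of the finite point set `P`:
its members are vertex sets of nondegenerate triangles with vertices in `P`, the interior of whose
circumscribed circle contains no point of `P`; these triangles have disjoint interiors
and they cover the convex hull of `P`. -/
structure IsDelaunayTriangulation (P : Finset ℂ) (𝒯 : Finset (Finset ℂ)) : Prop where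
  subset : ∀ T ∈ 𝒯, T ⊆ P
  card_eq : ∀ T ∈ 𝒯, T.card = 3
  not_collinear : ∀ T ∈ 𝒯, ¬ Collinear ℝ (T : Set ℂ)
  empty_circle : ∀ T ∈ 𝒯, ∀ c ρ, IsCircumcircle T c ρ → ∀ q ∈ P, ρ ≤ dist q c
  disjoint_interiors : ∀ T ∈ 𝒯, ∀ T' ∈ 𝒯, T ≠ T' →
    Disjoint (interior (convexHull ℝ (T : Set ℂ))) (interior (convexHull ℝ (T' : Set ℂ)))
  covers : (⋃ T ∈ 𝒯, convexHull ℝ (T : Set ℂ)) = convexHull ℝ (P : Set ℂ)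

/-- The geometric graph formed by the edges of the triangles in `𝒯`. -/
def edgeGraph (𝒯 : Finset (Finset ℂ)) : SimpleGraph ℂ where
  Adj u v := u ≠ v ∧ ∃ T ∈ 𝒯, u ∈ T ∧ v ∈ T
  symm := ⟨fun _ _ h => ⟨h.1.symm, h.2.imp fun _ hT => ⟨hT.1, hT.2.2, hT.2.1⟩⟩⟩
  loopless := ⟨fun _ h => h.1 rfl⟩

/-- The coordinates `x + y * I` of a point in the orthogonal coordinate system in which
`s = (0, 0)`, `t = (1, 0)` (an orientation preserving similarity of the plane when `s ≠ t`). -/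
def coord (s t p : ℂ) : ℂ := (p - s) / (t - s)

/-! ### The triangles that intersect the segment -/

open Classical in
/-- A vertex (other than `s` and `t`) on the segment `[st]` is considered to be slightly above it,
that is, the line `st` passes slightly below it (value `-1`).  If no point of `P` is below
the line `st`, so that there are no triangles below it, such a vertex is considered to be slightly
below `st`, so that the line passes slightly above it (value `1`). -/
def side (P : Finset ℂ) (s t : ℂ) : ℝ :=
  if ∀ v ∈ P, 0 ≤ (coord s t v).im then 1 else -1

/-- The triangle `T` intersects `[st]`, in the sense just described: it contains a point of `[st]`
other than `s` and `t`, and it extends to the side of that segment on which the line passes by the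
vertices on the segment. If no vertex but `s` and `t` lies on `[st]` and `[st]` is not an edge, then
these are the triangles whose interior meets `[st]`. -/
def Intersects (P : Finset ℂ) (s t : ℂ) (T : Finset ℂ) : Prop :=
  (convexHull ℝ (T : Set ℂ) ∩ openSegment ℝ s t).Nonempty ∧
    ∃ v ∈ T, 0 < side P s t * (coord s t v).im

/-- `T` does not lie to the left of `T'` along the line parallel to `st` at (small) distance `ε`
on the side on which the line passes by the vertices on `[st]`: the rightmost point of `T'` on this
line is not to the right of the rightmost point of `T`. -/
def ReachesAsFar (P : Finset ℂ) (s t : ℂ) (T T' : Finset ℂ) (ε : ℝ) : Prop :=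
  ∀ a ∈ convexHull ℝ (T' : Set ℂ), (coord s t a).im = side P s t * ε →
    ∃ b ∈ convexHull ℝ (T : Set ℂ), (coord s t b).im = side P s t * ε ∧
      (coord s t a).re ≤ (coord s t b).re

/-- `T` is the rightmost triangle that has `p` as a vertex, among the triangles
that intersect `[st]`. -/
def IsRightmost (P : Finset ℂ) (𝒯 : Finset (Finset ℂ)) (s t p : ℂ) (T : Finset ℂ) : Prop :=
  T ∈ 𝒯 ∧ Intersects P s t T ∧ p ∈ T ∧
    ∀ T' ∈ 𝒯, Intersects P s t T' → p ∈ T' →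
      ∀ᶠ ε in nhdsWithin (0 : ℝ) (Set.Ioi 0), ReachesAsFar P s t T T' ε

/-! ### The forwarding decision -/

/-- The angle, in `[0, 2π)`, of the clockwise walk from `u` to `v` along a circle centered at `c`. -/
def cwAngle (c u v : ℂ) : ℝ :=
  toIcoMod Real.two_pi_pos 0 (Complex.arg ((u - c) / (v - c)))

/-- The angle, in `[0, 2π)`, of the counterclockwise walk from `u` to `v` along a circle
centered at `c`. -/
def ccwAngle (c u v : ℂ) : ℝ := cwAngle c v u

/-- Among the vertices in `T` other than `p`, `q` is the one that is first reached from `p` by a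
walk along a circle centered at `c`, where `angle` measures walks in the given direction. (All
points are given by their coordinates.) -/
def IsFirstReached (angle : ℂ → ℂ → ℂ → ℝ) (s t : ℂ) (T : Finset ℂ) (c p q : ℂ) : Prop :=
  q ∈ T ∧ q ≠ p ∧ ∀ v ∈ T, v ≠ p →
    angle c (coord s t p) (coord s t q) ≤ angle c (coord s t p) (coord s t v)

/-- One step of Chew's algorithm: at `p`, on the way from `s` to `t`, the message is forwarded
to `q`.  Here `T` is the rightmost triangle at `p`, `c` and `ρ` are the center and the radius of its
circumscribed circle (in coordinates), `w = c - ρ` is the leftmost point of that circle and `r` is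
its rightmost intersection with `[st]`. The upper arc is the clockwise walk from `w` to `r`, the
lower arc is the counterclockwise walk from `w` to `r`. -/
def ChewStep (P : Finset ℂ) (𝒯 : Finset (Finset ℂ)) (s t p q : ℂ) : Prop :=
  ∃ T : Finset ℂ, IsRightmost P 𝒯 s t p T ∧
  ∃ (c : ℂ) (ρ r : ℝ), (∀ v ∈ T, dist (coord s t v) c = ρ) ∧
    IsGreatest {x : ℝ | 0 ≤ x ∧ x ≤ 1 ∧ dist (x : ℂ) c = ρ} r ∧
    ((cwAngle c (c - ρ) (coord s t p) ≤ cwAngle c (c - ρ) r ∧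
        IsFirstReached cwAngle s t T c p q) ∨
      (¬ cwAngle c (c - ρ) (coord s t p) ≤ cwAngle c (c - ρ) r ∧
        ccwAngle c (c - ρ) (coord s t p) ≤ ccwAngle c (c - ρ) r ∧
        IsFirstReached ccwAngle s t T c p q))

/-! ### Online routing algorithms -/

/-- A deterministic 1-local routing algorithm whose message header consists of the coordinates
of the source `s` and of the destination `t`: the next vertex `A s t p N` is a function of `s`, `t`,
the current vertex `p` and the set `N` of the neighbours of `p`. -/
abbrev LocalRoutingAlgorithm := ℂ → ℂ → ℂ → Set ℂ → ℂ

/-- The vertices visited by the algorithm `A` on the graph `G` on the way from `s` to `t`. -/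
def route (A : LocalRoutingAlgorithm) (G : SimpleGraph ℂ) (s t : ℂ) : ℕ → ℂ
  | 0 => s
  | i + 1 => A s t (route A G s t i) (G.neighborSet (route A G s t i))

/-- The length of the first `k` steps of the route. -/
def routeLength (A : LocalRoutingAlgorithm) (G : SimpleGraph ℂ) (s t : ℂ) (k : ℕ) : ℝ :=
  ∑ i ∈ Finset.range k, dist (route A G s t i) (route A G s t (i + 1))

/-- On `G`, the algorithm `A` produces a path from `s` to `t` by following `k` edges
(and stops when it first reaches `t`). -/
def RoutesIn (A : LocalRoutingAlgorithm) (G : SimpleGraph ℂ) (s t : ℂ) (k : ℕ) : Prop :=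
  route A G s t k = t ∧
    ∀ i < k, route A G s t i ≠ t ∧ G.Adj (route A G s t i) (route A G s t (i + 1))

/-- The Euclidean length of a walk in a geometric graph. -/
def walkLength {G : SimpleGraph ℂ} {u v : ℂ} : G.Walk u v → ℝ
  | .nil => 0
  | .cons (v := w) _ W => dist u w + walkLength W

/-- On every Delaunay triangulation, `A` produces a path from every vertex `s` to every vertex `t`
whose length is at most `κ` times the Euclidean distance from `s` to `t`. -/
def HasRoutingRatio (A : LocalRoutingAlgorithm) (κ : ℝ) : Prop :=
  ∀ (P : Finset ℂ) (𝒯 : Finset (Finset ℂ)), IsDelaunayTriangulation P 𝒯 →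
    ∀ s ∈ P, ∀ t ∈ P, ∃ k, RoutesIn A (edgeGraph 𝒯) s t k ∧
      routeLength A (edgeGraph 𝒯) s t k ≤ κ * dist s t

/-- On every Delaunay triangulation, `A` produces a path from every vertex `s` to every vertex `t`
whose length is at most `κ` times the length of every (hence of the shortest) path
from `s` to `t` in the triangulation. -/
def HasCompetitiveRatio (A : LocalRoutingAlgorithm) (κ : ℝ) : Prop :=
  ∀ (P : Finset ℂ) (𝒯 : Finset (Finset ℂ)), IsDelaunayTriangulation P 𝒯 →
    ∀ s ∈ P, ∀ t ∈ P, ∃ k, RoutesIn A (edgeGraph 𝒯) s t k ∧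
      ∀ W : (edgeGraph 𝒯).Walk s t, routeLength A (edgeGraph 𝒯) s t k ≤ κ * walkLength W

/-- `A` is Chew's algorithm on Delaunay triangulations: on every Delaunay triangulation and for all
vertices `s` and `t`, as long as `t` is not reached, the next vertex on the route is the one and
only vertex determined by Chew's forwarding decision. -/
def IsChewAlgorithm (A : LocalRoutingAlgorithm) : Prop :=
  ∀ (P : Finset ℂ) (𝒯 : Finset (Finset ℂ)), IsDelaunayTriangulation P 𝒯 →
    ∀ s ∈ P, ∀ t ∈ P, ∀ i, (∀ j ≤ i, route A (edgeGraph 𝒯) s t j ≠ t) →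
      ∀ q, ChewStep P 𝒯 s t (route A (edgeGraph 𝒯) s t i) q ↔
        q = route A (edgeGraph 𝒯) s t (i + 1)

end ChewRouting

end

/-! Normalise so that `s = 0`, `t = 1`, and consider the chords `[l, r]` that the empty
circumcircles of the successive rightmost triangles cut out of the real axis. These chords lie in
`[0, 1]` and both of their ends move to the right (`chord_le_of_leftOf`). A potential `pot a h`
bounds what the route may still spend before it reaches the current right end `r`, when it stands at
horizontal distance `a` to the left of `r` and at height `h` from the axis. For `h > a` it is the
length of the clockwise arc from the position to `r` on the circle through the position that touches
the axis at `r`. For `h ≤ a` it is the cost `a - h` of climbing vertically to the diagonal, followed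
by the arc from there, of length `3π/2 · a`.

Three estimates carry the bound. When the circle moves to the right, the potential grows at rate at
most `slope = 1 + 3π/2` (`pot_le_add`). A step that stays on one side of the axis is paid for by the
drop of the potential (`step_same_side`). A step across the axis may exceed this drop, by at most
`crossCost` times the progress of `r` since the previous crossing (`step_crossing`). That progress
can be measured because successive crossings go in opposite directions: the circle of the previous
crossing has its center on the side left behind, or on the axis, and its emptiness at the new vertex
forces its right end `ρ` well to the left of `r` (`crossing_progress`).

Hence `len + pot ≤ slope * r + crossCost * ρ` is invariant (`RouteBound.step`). As `ρ ≤ r ≤ 1` and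
the potential is nonnegative, the route never costs more than `slope + crossCost`. Steps are bounded
below by the least distance in `P`, so the route terminates.

The combinatorial part shows that the axis leaves the rightmost triangle at `p` through the edge
opposite to `p`, except for a last triangle with vertex `1` (`Rightmost.exit_edge`). Locality holds
because the neighbours of `p` determine the triangles at `p` (`mem_of_neighborSet_eq`). -/

noncomputable section

namespace ChewRouting

open Real Filter Topology

/-! ### The potential -/

/-- The slope of the linear part of the potential. -/
def slope : ℝ := 1 + 3 * π / 2

/-- The supremum of the lengths of the routes, on one side of the line, from a point that lies `a` to the
left of and at height `h` above the rightmost intersection of the current circle with the line. -/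
def pot (a h : ℝ) : ℝ :=
  if h ≤ a then slope * a - h else (h + a ^ 2 / h) * (π / 2 + arctan (a / h))

lemma slope_bounds : (5.7123 : ℝ) < slope ∧ slope < 5.7124 := by
  unfold slope
  have h1 := pi_gt_d6
  have h2 := pi_lt_d6
  constructor <;> linarith

lemma angle_pos (x : ℝ) : 0 < π / 2 + arctan x := by
  have := neg_pi_div_two_lt_arctan x
  linarith

/-- This is `sin θ ≤ θ` for `θ = π / 2 + arctan x`, whose sine is `cos (arctan x)`. -/
lemma inv_sqrt_le_angle (x : ℝ) : 1 / √(1 + x ^ 2) ≤ π / 2 + arctan x := by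
  have h := sin_le (angle_pos x).le
  have h2 : sin (π / 2 + arctan x) = cos (arctan x) := by
    rw [add_comm, sin_add_pi_div_two]
  rw [h2, cos_arctan] at h
  exact h

/-- The potential in the steep region, for height one. -/
def steep (x : ℝ) : ℝ := (1 + x ^ 2) * (π / 2 + arctan x)

lemma steep_one : steep 1 = slope - 1 := by
  unfold steep slope
  rw [arctan_one]
  ring

lemma hasDerivAt_steep (x : ℝ) :
    HasDerivAt steep (2 * x * (π / 2 + arctan x) + 1) x := by
  have h1 : HasDerivAt (fun x : ℝ => 1 + x ^ 2) (2 * x) x := by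
    simpa using (hasDerivAt_pow 2 x).const_add 1
  have h2 : HasDerivAt (fun x : ℝ => π / 2 + arctan x) (1 / (1 + x ^ 2)) x :=
    (hasDerivAt_arctan x).const_add _
  have h3 := h1.mul h2
  have e : (2 * x) * (π / 2 + arctan x) + (1 + x ^ 2) * (1 / (1 + x ^ 2))
      = 2 * x * (π / 2 + arctan x) + 1 := by
    have : (1 + x ^ 2) ≠ 0 := by positivity
    field_simp
  rw [e] at h3
  exact h3

/-- The derivative `2 * x * (π / 2 + arctan x) + 1` is at most its value at `x = 1`, which is
exactly `slope`. -/
lemma steep_sub_le {x y : ℝ} (hxy : x ≤ y) (hy : y ≤ 1) :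
    steep y - steep x ≤ slope * (y - x) := by
  have hanti : AntitoneOn (fun x => steep x - slope * x) (Set.Iic 1) := by
    apply antitoneOn_of_deriv_nonpos (convex_Iic 1)
    · exact fun x _ => ((hasDerivAt_steep x).sub
        ((hasDerivAt_id x).const_mul slope)).continuousAt.continuousWithinAt
    · exact fun x _ => ((hasDerivAt_steep x).sub
        ((hasDerivAt_id x).const_mul slope)).differentiableAt.differentiableWithinAt
    · intro x hx
      have hx1 : x < 1 := by simpa using hx
      have hd := (hasDerivAt_steep x).sub ((hasDerivAt_id x).const_mul slope)
      have : deriv (fun x => steep x - slope * x) x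
          = 2 * x * (π / 2 + arctan x) + 1 - slope * 1 := hd.deriv
      rw [this]
      unfold slope
      have hA := angle_pos x
      have hA2 : π / 2 + arctan x ≤ 3 * π / 4 := by
        have := arctan_strictMono.monotone hx1.le
        rw [arctan_one] at this
        linarith
      have hpi := pi_pos
      rcases le_total x 0 with h | h
      · nlinarith
      · nlinarith
  have := hanti (Set.mem_Iic.2 (hxy.trans hy)) (Set.mem_Iic.2 hy) hxy
  simp only at this
  linarith

lemma pot_of_le {a h : ℝ} (hh : h ≤ a) : pot a h = slope * a - h := if_pos hh

lemma pot_of_lt {a h : ℝ} (hh : a < h) :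
    pot a h = (h + a ^ 2 / h) * (π / 2 + arctan (a / h)) := if_neg (not_le.2 hh)

/-- The potential is homogeneous of degree one, and its two branches agree on the diagonal `a = h`.
-/
lemma pot_eq_steep {a h : ℝ} (h0 : 0 < h) (hh : a ≤ h) : pot a h = h * steep (a / h) := by
  rcases hh.lt_or_eq with h1 | rfl
  · rw [pot_of_lt h1, steep]
    field_simp
  · rw [pot_of_le le_rfl, div_self h0.ne', steep_one]
    ring

lemma pot_zero : pot 0 0 = 0 := by simp [pot]

/-- The potential grows at most at the rate `slope` when the circle moves to the right. -/
lemma pot_le_add {a a' h : ℝ} (h0 : 0 ≤ h) (ha : h = 0 → 0 ≤ a) (haa : a ≤ a') :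
    pot a' h ≤ pot a h + slope * (a' - a) := by
  rcases le_or_gt h a with h1 | h1
  · rw [pot_of_le h1, pot_of_le (h1.trans haa)]
    linarith
  have hpos : 0 < h := by
    rcases h0.lt_or_eq with h2 | h2
    · exact h2
    · have := ha h2.symm
      linarith
  rw [pot_eq_steep hpos h1.le]
  rcases le_or_gt h a' with h2 | h2
  · have h3 := steep_sub_le ((div_le_one hpos).2 h1.le) le_rfl
    rw [steep_one] at h3
    rw [pot_of_le h2]
    have h4 := mul_le_mul_of_nonneg_left h3 hpos.le
    have h5 : h * (slope * (1 - a / h)) = slope * (h - a) := by field_simp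
    rw [h5] at h4
    linarith
  · rw [pot_eq_steep hpos h2.le]
    have h3 := steep_sub_le (div_le_div_of_nonneg_right haa hpos.le) ((div_le_one hpos).2 h2.le)
    have h4 := mul_le_mul_of_nonneg_left h3 hpos.le
    have h5 : h * (slope * (a' / h - a / h)) = slope * (a' - a) := by field_simp
    rw [h5] at h4
    linarith

/-- The growth bound, applied from `a` up to the diagonal. Crossing steps use it to start from the
linear expression wherever the current vertex lies. -/
lemma linear_le_pot {a h : ℝ} (h0 : 0 ≤ h) (ha : h = 0 → 0 ≤ a) : slope * a - h ≤ pot a h := by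
  rcases le_or_gt h a with h1 | h1
  · rw [pot_of_le h1]
  · have := pot_le_add h0 ha h1.le
    rw [pot_of_le le_rfl] at this
    linarith

lemma sqrt_le_abs_add_abs (x y : ℝ) : √(x ^ 2 + y ^ 2) ≤ |x| + |y| := by
  apply Real.sqrt_le_iff.2
  refine ⟨by positivity, ?_⟩
  have h := mul_nonneg (abs_nonneg x) (abs_nonneg y)
  nlinarith [sq_abs x, sq_abs y]

/-- This pays for a step that ends at `r` itself. -/
lemma norm_le_pot {a h : ℝ} (h0 : 0 ≤ h) (ha : h = 0 → 0 ≤ a) : √(a ^ 2 + h ^ 2) ≤ pot a h := by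
  rcases le_or_gt h a with h1 | h1
  · rw [pot_of_le h1]
    have := slope_bounds.1
    have h2 := sqrt_le_abs_add_abs a h
    rw [abs_of_nonneg h0, abs_of_nonneg (h0.trans h1)] at h2
    nlinarith
  · have hpos : 0 < h := by
      rcases h0.lt_or_eq with h2 | h2
      · exact h2
      · have := ha h2.symm
        linarith
    rw [pot_eq_steep hpos h1.le, steep]
    have h2 := inv_sqrt_le_angle (a / h)
    have h3 : 0 < 1 + (a / h) ^ 2 := by positivity
    have h4 : √(a ^ 2 + h ^ 2) = h * √(1 + (a / h) ^ 2) := by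
      rw [← Real.sqrt_sq hpos.le, ← Real.sqrt_mul (sq_nonneg h), Real.sqrt_sq hpos.le]
      congr 1
      field_simp
      ring
    rw [h4]
    apply mul_le_mul_of_nonneg_left _ hpos.le
    calc √(1 + (a / h) ^ 2) = (1 + (a / h) ^ 2) * (1 / √(1 + (a / h) ^ 2)) := by
          rw [mul_one_div, Real.div_sqrt]
      _ ≤ _ := mul_le_mul_of_nonneg_left h2 h3.le

lemma pot_nonneg {a h : ℝ} (h0 : 0 ≤ h) (ha : h = 0 → 0 ≤ a) : 0 ≤ pot a h :=
  (Real.sqrt_nonneg _).trans (norm_le_pot h0 ha)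

/-! ### Steps that stay on one side of the axis (origin at `r`, `a` pointing to the left) -/

/-- A step along a circle through the origin, in the region where the potential is
an arc length of a circle that touches the line. -/
lemma step_steep {L c a h a' h' : ℝ} (hL : 0 ≤ L) (h0 : 0 < h) (h0' : 0 < h')
    (hp : a ^ 2 + h ^ 2 = L * a + 2 * c * h) (hq : a' ^ 2 + h' ^ 2 = L * a' + 2 * c * h')
    (hah : a ≤ h) (hah' : a' ≤ h') (hord : a' * h ≤ a * h') :
    √((a - a') ^ 2 + (h - h') ^ 2) + pot a' h' ≤ pot a h := by
  set x := a / h with hx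
  set x' := a' / h' with hx'
  have ea : a = x * h := by rw [hx]; field_simp
  have ea' : a' = x' * h' := by rw [hx']; field_simp
  have hxx : x' ≤ x := by
    rw [hx, hx', div_le_div_iff₀ h0' h0]
    linarith
  have eh : h * (1 + x ^ 2) = L * x + 2 * c := by
    apply mul_left_cancel₀ h0.ne'
    rw [ea] at hp
    linarith
  have eh' : h' * (1 + x' ^ 2) = L * x' + 2 * c := by
    apply mul_left_cancel₀ h0'.ne'
    rw [ea'] at hq
    linarith
  -- On the circle the potential is a function of `x = a / h` alone, the cotangent of the angle at
  -- which the point is seen from `r`. `D` is the diameter of the circle.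
  have hpos' : 0 < L * x' + 2 * c := by rw [← eh']; positivity
  set D := √(L ^ 2 + (2 * c) ^ 2) with hD
  have hD2 : D ^ 2 = L ^ 2 + (2 * c) ^ 2 := Real.sq_sqrt (by positivity)
  have hD0 : 0 ≤ D := Real.sqrt_nonneg _
  rw [pot_eq_steep h0 hah, pot_eq_steep h0' hah', ← hx, ← hx']
  have k1 : h * steep x = (L * x + 2 * c) * (π / 2 + arctan x) := by
    rw [steep, ← mul_assoc, eh]
  have k2 : h' * steep x' = (L * x' + 2 * c) * (π / 2 + arctan x') := by
    rw [steep, ← mul_assoc, eh']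
  rw [k1, k2]
  -- By the inscribed angle theorem an arc has length `D` times the difference of the arctangents.
  -- So this monotonicity says that the potential drops by at least the length of the arc.
  have hmono : MonotoneOn (fun x => (L * x + 2 * c - D) * (π / 2 + arctan x)) (Set.Ici x') := by
    have hd : ∀ y : ℝ, HasDerivAt (fun x => (L * x + 2 * c - D) * (π / 2 + arctan x))
        (L * (π / 2 + arctan y) + (L * y + 2 * c - D) * (1 / (1 + y ^ 2))) y := by
      intro y
      have h1 : HasDerivAt (fun x : ℝ => L * x + 2 * c - D) L y := by
        simpa using (((hasDerivAt_id y).const_mul L).add_const (2 * c)).sub_const D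
      exact h1.mul ((hasDerivAt_arctan y).const_add _)
    apply monotoneOn_of_deriv_nonneg (convex_Ici x')
    · exact fun y _ => (hd y).continuousAt.continuousWithinAt
    · exact fun y _ => (hd y).differentiableAt.differentiableWithinAt
    · intro y hy
      have hy1 : x' < y := by simpa using hy
      rw [(hd y).deriv]
      have hη : 0 < L * y + 2 * c := by nlinarith
      set η := L * y + 2 * c with hηd
      set s := √(1 + y ^ 2) with hs
      have hs2 : s ^ 2 = 1 + y ^ 2 := Real.sq_sqrt (by positivity)
      have hs0 : 0 < s := Real.sqrt_pos.2 (by positivity)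
      have hsy : -y ≤ s := by
        apply Real.le_sqrt_of_sq_le
        nlinarith
      -- The difference of the squares of the two sides is `2 * L * η * (s + y)`.
      have hDs : D ≤ L * s + η := by
        apply abs_le_of_sq_le_sq' _ (by positivity) |>.2
        have : 2 * c = η - L * y := by rw [hηd]; ring
        rw [hD2, this]
        nlinarith [mul_nonneg (mul_nonneg hL hη.le) (by linarith : 0 ≤ s + y)]
      have hA := inv_sqrt_le_angle y
      rw [← hs] at hA
      have h1 : L * (1 / s) ≤ L * (π / 2 + arctan y) := mul_le_mul_of_nonneg_left hA hL
      have h2 : (-(L * s)) * (1 / s ^ 2) ≤ (η - D) * (1 / s ^ 2) :=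
        mul_le_mul_of_nonneg_right (by linarith) (by positivity)
      have h3 : (-(L * s)) * (1 / s ^ 2) = -(L * (1 / s)) := by field_simp
      rw [← hs2]
      linarith
  have hm := hmono (Set.mem_Ici.2 le_rfl) (Set.mem_Ici.2 hxx) hxx
  simp only at hm
  -- The chord equals `D` times the sine of the inscribed angle, and so is at most the arc.
  have hsin : √((a - a') ^ 2 + (h - h') ^ 2) ≤ D * (arctan x - arctan x') := by
    have hnn : 0 ≤ arctan x - arctan x' := sub_nonneg.2 (arctan_strictMono.monotone hxx)
    have h1 : sin (arctan x - arctan x') ≤ arctan x - arctan x' := sin_le hnn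
    set s := √(1 + x ^ 2) with hs
    set s' := √(1 + x' ^ 2) with hs'
    have hs0 : 0 < s := Real.sqrt_pos.2 (by positivity)
    have hs0' : 0 < s' := Real.sqrt_pos.2 (by positivity)
    have hs2 : s ^ 2 = 1 + x ^ 2 := Real.sq_sqrt (by positivity)
    have hs2' : s' ^ 2 = 1 + x' ^ 2 := Real.sq_sqrt (by positivity)
    have h2 : sin (arctan x - arctan x') = (x - x') / (s * s') := by
      rw [sin_sub, sin_arctan, cos_arctan, sin_arctan, cos_arctan, ← hs, ← hs']
      field_simp
    have hq1 : h = (L * x + 2 * c) / s ^ 2 := by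
      rw [hs2, ← eh]; field_simp
    have hq2 : h' = (L * x' + 2 * c) / s' ^ 2 := by
      rw [hs2', ← eh']; field_simp
    have h3 : (a - a') ^ 2 + (h - h') ^ 2 = (D * ((x - x') / (s * s'))) ^ 2 := by
      rw [ea, ea', mul_pow, div_pow, mul_pow, hs2, hs2', hD2, hq1, hq2, hs2, hs2']
      have e1 : (1 + x ^ 2) ≠ 0 := by positivity
      have e2 : (1 + x' ^ 2) ≠ 0 := by positivity
      field_simp
      ring
    rw [h3, Real.sqrt_sq (mul_nonneg hD0 (div_nonneg (sub_nonneg.2 hxx) (by positivity))), ← h2]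
    exact mul_le_mul_of_nonneg_left h1 hD0
  linarith

/-- A step along a circle through the origin, in the region where the potential is linear. -/
lemma step_linear {L c a h a' h' : ℝ} (h0 : 0 ≤ h) (h0' : 0 ≤ h')
    (hp : a ^ 2 + h ^ 2 = L * a + 2 * c * h) (hq : a' ^ 2 + h' ^ 2 = L * a' + 2 * c * h')
    (hah : h ≤ a) (hah' : h' ≤ a') (hord : a' * h ≤ a * h')
    (hup : ¬ (h < c ∧ L / 2 < a)) (ha : 0 < a) (ha' : 0 < a') :
    √((a - a') ^ 2 + (h - h') ^ 2) + pot a' h' ≤ pot a h := by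
  rw [pot_of_le hah, pot_of_le hah']
  have hs := slope_bounds.1
  have h1 := sqrt_le_abs_add_abs (a - a') (h - h')
  -- In a descent the order of the points as seen from `r` gives `h - h' ≤ a - a'`; the `ℓ¹` length
  -- and the rise of `-h` then cost at most `3 * (a - a')`, less than `slope * (a - a')`. In an
  -- ascent the linear potential pays for the vertical part, and it remains to see that the step
  -- does not go to the left.
  rcases lt_or_ge h' h with h2 | h2
  · rw [abs_of_pos (sub_pos.2 h2)] at h1
    have hb : h - h' ≤ a - a' := by
      rcases h0'.eq_or_lt with h3 | h3
      · exfalso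
        rw [← h3] at hord h2
        nlinarith
      · by_contra hc
        push Not at hc
        nlinarith
    rw [abs_of_nonneg (by linarith)] at h1
    nlinarith
  -- This is where `hup` enters: a clockwise walk moves to the left only on the lower left quarter
  -- of the circle.
  · have hb : a' ≤ a := by
      by_contra hc
      push Not at hc
      have e1 : (a - a') * (a + a' - L) = (h' - h) * (h + h' - 2 * c) := by nlinarith
      rcases lt_or_ge h c with h3 | h3
      · have h4 : a ≤ L / 2 := by
          by_contra h5
          exact hup ⟨h3, not_le.1 h5⟩
        nlinarith [mul_nonneg h0 (sub_pos.2 h3).le]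
      · have h6 : (a' - a) * h' ≤ a' * (h' - h) := by nlinarith
        have h7 : 0 ≤ h + h' - 2 * c := by linarith
        have h8 := mul_le_mul_of_nonneg_right h6 h7
        have h9 : (a' - a) * h' * (h + h' - 2 * c) ≤ a' * ((a - a') * (a + a' - L)) := by
          rw [e1]; linarith
        have h10 : (a' - a) * (h' * (h + h' - 2 * c) + a' * (a + a' - L)) ≤ 0 := by linarith
        have h11 : h' * (h + h' - 2 * c) + a' * (a + a' - L) = h * h' + a * a' := by linarith
        rw [h11] at h10
        have : 0 < (a' - a) * (h * h' + a * a') := by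
          apply mul_pos (by linarith)
          have := mul_pos ha ha'
          have := mul_nonneg h0 h0'
          linarith
        linarith
    rw [abs_of_nonneg (by linarith), abs_of_nonpos (by linarith)] at h1
    nlinarith

lemma sqrt_triangle (a b a' b' a'' b'' : ℝ) :
    √((a - a'') ^ 2 + (b - b'') ^ 2) ≤
      √((a - a') ^ 2 + (b - b') ^ 2) + √((a' - a'') ^ 2 + (b' - b'') ^ 2) := by
  have h := dist_triangle (⟨a, b⟩ : ℂ) ⟨a', b'⟩ ⟨a'', b''⟩
  simpa [Complex.dist_eq_re_im] using h

/-- The steep part of a walk along a circle through the origin. -/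
lemma step_diagonal {L c a' h' : ℝ} (hL : 0 ≤ L) (h0' : 0 < h')
    (hq : a' ^ 2 + h' ^ 2 = L * a' + 2 * c * h') (hah' : a' < h') :
    0 < L / 2 + c ∧ √((L / 2 + c - a') ^ 2 + (L / 2 + c - h') ^ 2) + pot a' h' ≤
      slope * (L / 2 + c) - (L / 2 + c) := by
  have hτ : 0 < L / 2 + c := by
    have hq0 : 0 < a' ^ 2 + h' ^ 2 := by positivity
    by_contra hc
    push Not at hc
    rcases le_or_gt 0 c with h1 | h1
    · have h2 : L = 0 := by linarith
      have h3 : c = 0 := by linarith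
      rw [h2, h3] at hq
      linarith
    · rcases le_or_gt a' 0 with h2 | h2
      · nlinarith [mul_nonneg hL (neg_nonneg.2 h2), mul_pos (neg_pos.2 h1) h0']
      · nlinarith
  refine ⟨hτ, ?_⟩
  -- The circle meets the diagonal `a = h` in the origin and in the point with both coordinates `L /
  -- 2 + c`.
  have := step_steep (c := c) hL hτ h0' (by ring) hq le_rfl hah'.le (by nlinarith)
  rwa [pot_of_le (le_refl (L / 2 + c))] at this

/-- A step along the upper arc of a circle does not exceed the decrease of the potential. -/
lemma step_same_side {L c a h a' h' : ℝ} (hL : 0 ≤ L) (h0 : 0 ≤ h) (h0' : 0 ≤ h')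
    (hp : a ^ 2 + h ^ 2 = L * a + 2 * c * h) (hq : a' ^ 2 + h' ^ 2 = L * a' + 2 * c * h')
    (hord : a' * h ≤ a * h') (hup : ¬ (h < c ∧ L / 2 < a)) (hne : ¬ (a = 0 ∧ h = 0)) :
    √((a - a') ^ 2 + (h - h') ^ 2) + pot a' h' ≤ pot a h := by
  have hax : ∀ {x : ℝ}, x ^ 2 = L * x → 0 ≤ x := by
    intro x hx
    by_contra hc
    push Not at hc
    nlinarith
  have hpa : h = 0 → 0 ≤ a := by
    intro hh
    rw [hh] at hp
    exact hax (by linarith)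
  have hqa : h' = 0 → 0 ≤ a' := by
    intro hh
    rw [hh] at hq
    exact hax (by linarith)
  by_cases hq0 : a' = 0 ∧ h' = 0
  · rw [hq0.1, hq0.2, pot_zero, sub_zero, sub_zero, add_zero]
    exact norm_le_pot h0 hpa
  rcases lt_or_ge a' h' with h1 | h1
  · have h2 : 0 < h' := by
      rcases h0'.eq_or_lt with h3 | h3
      · have := hqa h3.symm
        linarith
      · exact h3
    rcases lt_or_ge a h with h3 | h3
    · have h4 : 0 < h := by
        rcases h0.eq_or_lt with h5 | h5
        · have := hpa h5.symm
          linarith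
        · exact h5
      exact step_steep hL h4 h2 hp hq h3.le h1.le hord
    · have ha : 0 < a := by
        rcases (h0.trans h3).eq_or_lt with h5 | h5
        · exact absurd ⟨h5.symm, by linarith⟩ hne
        · exact h5
      -- A step from the linear into the steep region is split where the circle crosses the
      -- diagonal.
      obtain ⟨hτ, hd⟩ := step_diagonal hL h2 hq h1
      have hl := step_linear (a' := L / 2 + c) (h' := L / 2 + c) h0 hτ.le hp (by ring) h3 le_rfl
        (by nlinarith) hup ha hτ
      rw [pot_of_le (le_refl (L / 2 + c))] at hl
      have := sqrt_triangle a h (L / 2 + c) (L / 2 + c) a' h'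
      linarith
  · have ha' : 0 < a' := by
      rcases (h0'.trans h1).eq_or_lt with h5 | h5
      · exact absurd ⟨h5.symm, by linarith⟩ hq0
      · exact h5
    have h3 : h ≤ a := by
      rcases h0'.eq_or_lt with h4 | h4
      · rw [← h4] at hord
        have : h = 0 := by nlinarith
        rw [this]
        exact hpa this
      · by_contra hc
        push Not at hc
        have := mul_le_mul_of_nonneg_right h1 h0
        nlinarith
    have ha : 0 < a := by
      rcases (h0.trans h3).eq_or_lt with h5 | h5
      · exact absurd ⟨h5.symm, by linarith⟩ hne
      · exact h5
    exact step_linear h0 h0' hp hq h3 h1 hord hup ha ha'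

/-! ### Steps that cross the axis -/

/-- The additional cost, per unit of length, of the steps that cross the line. -/
def crossCost : ℝ := 0.185043874

/-- The numerical inequality behind the constant. Here `b` is the horizontal extent of a crossing
step in units of the initial distance to the axis. The left side is the excess of the step, `slope *
b ^ 2` is paid by moving to the right, and `crossCost * (1 - b ^ 2)` by the progress since the last
crossing. -/
lemma crossing_polynomial {b : ℝ} (hb : 0 ≤ b) (hb1 : b ≤ 1) :
    2 * b + b ^ 3 / 2 ≤ slope * b ^ 2 + crossCost * (1 - b ^ 2) := by
  have hs := slope_bounds.1
  unfold crossCost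
  have h1 : (5.7123 : ℝ) * b ^ 2 ≤ slope * b ^ 2 := by
    apply mul_le_mul_of_nonneg_right hs.le (sq_nonneg b)
  have h2 : 2 * b + b ^ 3 / 2 ≤ 5.7123 * b ^ 2 + 0.185043874 * (1 - b ^ 2) := by
    -- The cube is expanded about `0.1825`, a point close to where the inequality is tightest.
    have : b ^ 3 ≤ b * (b * 0.1825 + (b - 0.1825) ^ 2 + (b - 0.1825) * 0.1825) := by
      nlinarith
    nlinarith [sq_nonneg (b - 0.1825), mul_nonneg hb (sq_nonneg (b - 0.1825)),
      mul_nonneg (sub_nonneg.2 hb1) (sq_nonneg (b - 0.1825))]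
  linarith

/-- The case `H = y` is the previous inequality for `b / y`, multiplied by `y ^ 2 / b`. A larger
total height `H` lowers the left side and raises the right side. -/
lemma crossing_polynomial_scaled {b y H : ℝ} (hb : 0 < b) (hby : b ≤ y) (hyH : y ≤ H) :
    2 * y + b ^ 2 / (2 * H) ≤ slope * b + crossCost * ((H ^ 2 - b ^ 2) / b * (2 * y / (y + H))) := by
  have hy : 0 < y := hb.trans_le hby
  have hH : 0 < H := hy.trans_le hyH
  have hc : 0 < crossCost := by unfold crossCost; norm_num
  have h1 := crossing_polynomial (b := b / y) (by positivity) ((div_le_one hy).2 hby)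
  have h2 : 2 * y + b ^ 2 / (2 * y) ≤ slope * b + crossCost * ((y ^ 2 - b ^ 2) / b) := by
    have h3 := mul_le_mul_of_nonneg_left h1 (by positivity : 0 ≤ y ^ 2 / b)
    have e1 : y ^ 2 / b * (2 * (b / y) + (b / y) ^ 3 / 2) = 2 * y + b ^ 2 / (2 * y) := by
      field_simp
    have e2 : y ^ 2 / b * (slope * (b / y) ^ 2 + crossCost * (1 - (b / y) ^ 2))
        = slope * b + crossCost * ((y ^ 2 - b ^ 2) / b) := by
      field_simp
    rwa [e1, e2] at h3
  have h4 : b ^ 2 / (2 * H) ≤ b ^ 2 / (2 * y) :=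
    div_le_div_of_nonneg_left (by positivity) (by positivity) (by linarith)
  have h5 : (y ^ 2 - b ^ 2) / b ≤ (H ^ 2 - b ^ 2) / b * (2 * y / (y + H)) := by
    rw [div_mul_div_comm, div_le_div_iff₀ hb (by positivity)]
    have : 0 ≤ (H - y) * (y * H + b ^ 2) := by
      apply mul_nonneg (by linarith); positivity
    nlinarith [mul_nonneg hb.le this, mul_nonneg (mul_nonneg hb.le (sub_nonneg.2 hyH))
      (mul_pos hy hH).le, mul_nonneg (mul_nonneg hb.le (sub_nonneg.2 hyH))
      (sq_nonneg y)]
  have h6 := mul_le_mul_of_nonneg_left h5 hc.le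
  linarith

/-- A step along a circle that crosses the line. The step goes from `(0, -y)` to `(b, h)`, and the
circle meets the line at `l` and `r` and has its center at depth `k`. -/
lemma step_crossing {l r k y b h ρ : ℝ} (hy : 0 ≤ y) (hk : y ≤ k) (he : 0 ≤ l + r) (hlr : l ≤ r)
    (hp : l * r = 2 * k * y - y ^ 2) (h0 : 0 ≤ h) (hq : (b - l) * (r - b) = h ^ 2 + 2 * k * h)
    (hρ : ρ ≤ r) (hS : 2 * k * (r - b) ≤ (2 * k + h) * (r - ρ)) :
    y + √(b ^ 2 + (y + h) ^ 2) + pot (r - b) h ≤ slope * r + crossCost * (r - ρ) := by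
  have hs := slope_bounds.1
  have hc : 0 < crossCost := by unfold crossCost; norm_num
  have hk0 : 0 ≤ k := hy.trans hk
  have hr0 : 0 ≤ r := by linarith
  have hl0 : 0 ≤ l := by
    by_contra hc
    push Not at hc
    nlinarith [mul_nonneg hy (by linarith : 0 ≤ 2 * k - y)]
  have hprod : 0 ≤ (b - l) * (r - b) := by rw [hq]; positivity
  have hbl : l ≤ b := by
    by_contra hc
    push Not at hc
    nlinarith
  have hbr : b ≤ r := by
    by_contra hc
    push Not at hc
    nlinarith
  have hb0 : 0 ≤ b := hl0.trans hbl
  have hcr : 0 ≤ crossCost * (r - ρ) := mul_nonneg hc.le (by linarith)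
  -- If the step ends in the steep region, it is split where the circle meets the diagonal. The
  -- piece up to there costs at most `3 * (r - τ)`, even without a contribution of `crossCost`.
  rcases lt_or_ge (r - b) h with h1 | h1
  · obtain ⟨hτ, hd⟩ := step_diagonal (L := r - l) (c := -k) (a' := r - b) (h' := h)
      (by linarith) (by linarith) (by nlinarith) h1
    set τ := (r - l) / 2 + -k with hτd
    have ht := sqrt_triangle 0 (-y) (r - τ) τ b h
    have e1 : (0 - b) ^ 2 + (-y - h) ^ 2 = b ^ 2 + (y + h) ^ 2 := by ring
    have e2 : (r - τ - b) ^ 2 + (τ - h) ^ 2 = (τ - (r - b)) ^ 2 + (τ - h) ^ 2 := by ring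
    rw [e1, e2] at ht
    have h2 := sqrt_le_abs_add_abs (0 - (r - τ)) (-y - τ)
    have h3 : y ≤ r - τ := by linarith
    rw [abs_of_nonpos (by linarith), abs_of_nonpos (by linarith)] at h2
    nlinarith
  rw [pot_of_le h1]
  -- Since `4.7123 < slope - 1`, the `ℓ¹` length suffices for flat steps. For the remaining ones `b
  -- < y`, and a finer estimate of the length is needed.
  rcases le_or_gt (2 * y) (4.7123 * b) with h2 | h2
  · have h3 := sqrt_le_abs_add_abs b (y + h)
    rw [abs_of_nonneg hb0, abs_of_nonneg (by linarith)] at h3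
    nlinarith
  have hypos : 0 < y := by linarith
  have hbpos : 0 < b := by
    rcases hb0.eq_or_lt with h3 | h3
    · exfalso
      have h4 : l = 0 := by linarith
      rw [h4] at hp
      nlinarith
    · exact h3
  have hHpos : 0 < y + h := by linarith
  have hsum : b * (l + r) = b ^ 2 + h ^ 2 + 2 * k * (h + y) - y ^ 2 := by nlinarith
  -- The sum of the two circle equations, with `l ≤ b` and `y ≤ k`, gives `(y + h) ^ 2 ≤ b * r`:
  -- after a steep crossing the right end is still far away.
  have hrb : ((y + h) ^ 2 - b ^ 2) / b ≤ r - b := by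
    rw [div_le_iff₀ hbpos]
    have h3 : 0 ≤ (k - y) * (h + y) := mul_nonneg (by linarith) (by linarith)
    have h4 : b * l ≤ b * b := mul_le_mul_of_nonneg_left hbl hb0
    linarith
  have hrb0 : 0 ≤ r - b := by linarith
  -- The fraction `2 * k / (2 * k + h)` increases with `k`, so `k` may be replaced by `y`.
  have hfrac : 2 * y / (y + (y + h)) * (r - b) ≤ r - ρ := by
    rw [div_mul_eq_mul_div, div_le_iff₀ (by linarith)]
    have hk2 : 0 < 2 * k + h := by linarith
    have h4 : y * (2 * k * (r - b)) ≤ y * ((2 * k + h) * (r - ρ)) :=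
      mul_le_mul_of_nonneg_left hS hy
    have h5 : 0 ≤ h * (k - y) * (r - ρ) :=
      mul_nonneg (mul_nonneg h0 (by linarith)) (by linarith)
    have hkpos : 0 < k := by linarith
    have h6 : k * (2 * y * (r - b)) ≤ k * ((r - ρ) * (y + (y + h))) := by linarith
    exact le_of_mul_le_mul_left h6 hkpos
  have h7 := crossing_polynomial_scaled hbpos (by linarith : b ≤ y) (by linarith : y ≤ y + h)
  have h8 : ((y + h) ^ 2 - b ^ 2) / b * (2 * y / (y + (y + h))) ≤ r - ρ := by
    refine le_trans ?_ hfrac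
    rw [mul_comm]
    exact mul_le_mul_of_nonneg_left hrb (by positivity)
  have h9 := mul_le_mul_of_nonneg_left h8 hc.le
  have h10 : √(b ^ 2 + (y + h) ^ 2) ≤ (y + h) + b ^ 2 / (2 * (y + h)) := by
    apply Real.sqrt_le_iff.2
    refine ⟨by positivity, ?_⟩
    have : ((y + h) + b ^ 2 / (2 * (y + h))) ^ 2
        = b ^ 2 + (y + h) ^ 2 + (b ^ 2 / (2 * (y + h))) ^ 2 := by
      field_simp
      ring
    rw [this]
    nlinarith [sq_nonneg (b ^ 2 / (2 * (y + h)))]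
  linarith

/-! ### Circles, chords of the axis and the two arcs -/

/-- The cross product of two vectors in the plane. -/
def cross (a b : ℂ) : ℝ := a.re * b.im - a.im * b.re

/-- The power of a point with respect to the circle that meets the real axis at `l` and `r` and
whose center has height `k`. -/
def power (l r k : ℝ) (z : ℂ) : ℝ := (z.re - l) * (z.re - r) + z.im ^ 2 - 2 * k * z.im

lemma cross_conj (a b : ℂ) :
    cross (starRingEnd ℂ a) (starRingEnd ℂ b) = -cross a b := by
  simp [cross]; ring

lemma power_conj (l r k : ℝ) (z : ℂ) : power l r (-k) (starRingEnd ℂ z) = power l r k z := by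
  simp [power]

lemma mem_Icc_of_mul_nonpos {l r x : ℝ} (hlr : l ≤ r) (h : (x - l) * (x - r) ≤ 0) :
    l ≤ x ∧ x ≤ r := by
  constructor <;> by_contra hc <;> push Not at hc <;> nlinarith

lemma power_ofReal (l r k x : ℝ) : power l r k x = (x - l) * (x - r) := by simp [power]

/-- The order of two upper points on a circle can be seen from any point on the chord. -/
lemma cross_nonpos_of_chord {l r k X : ℝ} {p u : ℂ} (hp : power l r k p = 0)
    (hu : power l r k u = 0) (hu0 : 0 ≤ u.im) (hlX : l ≤ X) (hXr : X ≤ r)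
    (h : cross (u - p) (X - p) < 0) : cross (u - p) (r - p) ≤ 0 := by
  by_contra hc
  push Not at hc
  simp only [cross, Complex.sub_re, Complex.sub_im, Complex.ofReal_re, Complex.ofReal_im] at h hc
  have hd : 0 < (r - X) * (p.im - u.im) := by nlinarith
  have hXr' : X < r := by
    rcases hXr.lt_or_eq with h1 | h1
    · exact h1
    · rw [h1] at hd; simp at hd
  have him : 0 < p.im - u.im := by
    by_contra h1
    push Not at h1
    nlinarith
  -- Otherwise the line from `p` through `u` meets the axis at a point `Y` strictly between `X` and
  -- `r`, hence inside the circle. But `Y` lies at or beyond `u` on this line (`1 ≤ s`), where the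
  -- power of a point is nonnegative.
  set s := p.im / (p.im - u.im) with hs
  have hs1 : 1 ≤ s := by rw [hs, le_div_iff₀ him]; linarith
  have hsim : s * (p.im - u.im) = p.im := by rw [hs]; field_simp
  set Y := p.re + s * (u.re - p.re) with hY
  have hYe : (Y - X) * (p.im - u.im) = (p.re - X) * (p.im - u.im) + p.im * (u.re - p.re) := by
    rw [hY]
    linear_combination (u.re - p.re) * hsim
  have hYe' : (Y - r) * (p.im - u.im) = (p.re - r) * (p.im - u.im) + p.im * (u.re - p.re) := by
    rw [hY]
    linear_combination (u.re - p.re) * hsim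
  have hXY : X < Y := by
    by_contra h1
    push Not at h1
    nlinarith
  have hYr : Y < r := by
    by_contra h1
    push Not at h1
    nlinarith
  have hneg : (Y - l) * (Y - r) < 0 := mul_neg_of_pos_of_neg (by linarith) (by linarith)
  have hval : (Y - l) * (Y - r) = s * (s - 1) * ((u.re - p.re) ^ 2 + (u.im - p.im) ^ 2) := by
    unfold power at hp hu
    have e : p.im + s * (u.im - p.im) = 0 := by linarith
    have e2 : (Y - l) * (Y - r) = (Y - l) * (Y - r) + (p.im + s * (u.im - p.im)) ^ 2
        - 2 * k * (p.im + s * (u.im - p.im)) := by rw [e]; ring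
    rw [e2, hY]
    linear_combination (1 - s) * hp + s * hu
  have : 0 ≤ s * (s - 1) * ((u.re - p.re) ^ 2 + (u.im - p.im) ^ 2) := by
    apply mul_nonneg (mul_nonneg (by linarith) (by linarith)) (by positivity)
  linarith

lemma dist_eq_sqrt (p q : ℂ) : dist p q = √((p.re - q.re) ^ 2 + (p.im - q.im) ^ 2) :=
  Complex.dist_eq_re_im p q

lemma step_above {l r k : ℝ} {p q : ℂ} (hlr : l ≤ r) (hp : power l r k p = 0)
    (hq : power l r k q = 0) (hp0 : 0 ≤ p.im) (hq0 : 0 ≤ q.im)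
    (hord : cross (q - p) (r - p) ≤ 0) (hup : ¬ (p.im < k ∧ p.re < (l + r) / 2))
    (hne : p ≠ r) :
    dist p q + pot (r - q.re) q.im ≤ pot (r - p.re) p.im := by
  unfold power at hp hq
  simp only [cross, Complex.sub_re, Complex.sub_im, Complex.ofReal_re, Complex.ofReal_im] at hord
  have h := step_same_side (L := r - l) (c := k) (a := r - p.re) (h := p.im) (a' := r - q.re)
    (h' := q.im) (by linarith) hp0 hq0 (by linarith) (by linarith) (by linarith)
    (fun h => hup ⟨h.1, by linarith [h.2]⟩)
    (fun h => hne (Complex.ext (by simp; linarith [h.1]) (by simp [h.2])))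
  rw [dist_eq_sqrt]
  have e : (p.re - q.re) ^ 2 = (r - p.re - (r - q.re)) ^ 2 := by ring
  rw [e]
  exact h

/-- The condition that a previous crossing imposes on the next one. -/
lemma crossing_progress {l r l' ρ b h k : ℝ} (hlb : l ≤ b) (hbr : b ≤ r) (hk : 0 ≤ k) (h0 : 0 ≤ h)
    (hq : (b - l) * (r - b) = h ^ 2 + 2 * k * h) (hl : l' ≤ l)
    (hq' : (b - l') * (ρ - b) ≤ h ^ 2) (hdeg : b = l → ρ ≤ b) :
    2 * k * (r - b) ≤ (2 * k + h) * (r - ρ) := by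
  rcases le_or_gt ρ b with h1 | h1
  · have h2 : 2 * k * (r - b) ≤ 2 * k * (r - ρ) :=
      mul_le_mul_of_nonneg_left (by linarith) (by linarith)
    have h3 : 0 ≤ h * (r - ρ) := mul_nonneg h0 (by linarith)
    linarith
  · have h2 : 0 < b - l := by
      rcases hlb.lt_or_eq with h3 | h3
      · linarith
      · have := hdeg h3.symm
        linarith
    have h3 : (b - l) * (ρ - b) ≤ h ^ 2 :=
      (mul_le_mul_of_nonneg_right (by linarith) (by linarith)).trans hq'
    -- This subtracts the emptiness of the old circle from the equation of the new one; the terms `h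
    -- ^ 2` cancel.
    have h4 : 2 * k * h ≤ (b - l) * (r - ρ) := by nlinarith
    have h5 : (2 * k + h) * (2 * k * h) ≤ (2 * k + h) * ((b - l) * (r - ρ)) :=
      mul_le_mul_of_nonneg_left h4 (by linarith)
    have h6 : (b - l) * (2 * k * (r - b)) ≤ (b - l) * ((2 * k + h) * (r - ρ)) := by
      calc (b - l) * (2 * k * (r - b)) = 2 * k * (h ^ 2 + 2 * k * h) := by rw [← hq]; ring
        _ ≤ _ := by linarith
    exact le_of_mul_le_mul_left h6 h2

/-- A step from above the line to below the line. Here `ρ` is the right end of the chord of a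
previous circle that does not contain `q` in its interior. -/
lemma step_down {l r k l' ρ : ℝ} {p q : ℂ} (hlr : l ≤ r) (hp : power l r k p = 0)
    (hq : power l r k q = 0) (hp0 : 0 ≤ p.im) (hpk : p.im ≤ k) (hpe : p.re ≤ (l + r) / 2)
    (hq0 : q.im ≤ 0) (hl : l' ≤ l) (hρ : ρ ≤ r)
    (hrec : (q.re - l') * (ρ - q.re) ≤ q.im ^ 2) (hdeg : q.re = l → ρ ≤ q.re) :
    dist p q + pot (r - q.re) (-q.im) ≤
      slope * (r - p.re) - p.im + crossCost * (r - ρ) := by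
  unfold power at hp hq
  have hk0 : 0 ≤ k := hp0.trans hpk
  obtain ⟨hlb, hbr⟩ : l ≤ q.re ∧ q.re ≤ r := by
    apply mem_Icc_of_mul_nonpos hlr
    nlinarith [mul_nonneg hk0 (neg_nonneg.2 hq0), sq_nonneg q.im]
  have hS := crossing_progress (h := -q.im) hlb hbr hk0 (by linarith) (by linarith) hl
    (by rwa [neg_sq]) hdeg
  have h := step_crossing (l := l - p.re) (r := r - p.re) (k := k) (y := p.im) (b := q.re - p.re)
    (h := -q.im) (ρ := ρ - p.re) hp0 hpk (by linarith) (by linarith) (by linarith)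
    (by linarith) (by linarith) (by linarith) (by linarith)
  rw [dist_eq_sqrt]
  have e1 : (p.re - q.re) ^ 2 + (p.im - q.im) ^ 2 = (q.re - p.re) ^ 2 + (p.im + -q.im) ^ 2 := by
    ring
  have e2 : r - q.re = r - p.re - (q.re - p.re) := by ring
  rw [e1, e2]
  have e3 : r - p.re - (ρ - p.re) = r - ρ := by ring
  rw [e3] at h
  linarith

/-- A vertex above the axis on the clockwise arc from the leftmost point to `r` is not in the open
lower left quarter of the circle. This supplies the hypothesis `hup` of the steps on one side. -/
lemma not_left_of_cross_nonpos {l r k ρ : ℝ} {p : ℂ} (hlr : l ≤ r) (hp : power l r k p = 0)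
    (hp0 : 0 ≤ p.im) (hρ0 : 0 < ρ) (hρ : ρ ^ 2 = ((r - l) / 2) ^ 2 + k ^ 2)
    (h : cross (p - ((⟨(l + r) / 2, k⟩ : ℂ) - ρ)) (r - ((⟨(l + r) / 2, k⟩ : ℂ) - ρ)) ≤ 0) :
    ¬ (p.im < k ∧ p.re < (l + r) / 2) := by
  rintro ⟨h1, h2⟩
  simp only [cross, Complex.sub_re, Complex.sub_im, Complex.ofReal_re, Complex.ofReal_im] at h
  unfold power at hp
  set S := (r - l) / 2 with hS
  set x := p.re - (l + r) / 2 with hx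
  have hS0 : 0 ≤ S := by rw [hS]; linarith
  have hx0 : x < 0 := by rw [hx]; linarith
  have hc : x ^ 2 + (p.im - k) ^ 2 = ρ ^ 2 := by rw [hρ, hx, hS]; nlinarith
  have hh : (k - p.im) * (S + ρ) ≤ k * (x + ρ) := by rw [hx, hS]; nlinarith
  have hk : 0 < k := by linarith
  have hxρ : 0 < ρ - x := by linarith
  have e1 : k * (x + ρ) * (ρ - x) = k * (k - p.im) ^ 2 := by nlinarith
  have h3 := mul_le_mul_of_nonneg_right hh hxρ.le
  rw [e1] at h3
  have h4 : (S + ρ) * (ρ - x) ≤ k * (k - p.im) := by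
    apply le_of_mul_le_mul_left _ (sub_pos.2 h1)
    linarith
  have h5 : (S + ρ) * (ρ - x) ≤ (S + ρ) * (ρ - S) := by nlinarith
  have h6 := le_of_mul_le_mul_left h5 (by linarith)
  linarith

/-- Conversely, a vertex above the axis that is to be forwarded counterclockwise lies in the closed
lower left quarter, the position from which a crossing starts. -/
lemma left_of_cross_nonneg {l r k ρ : ℝ} {p : ℂ} (hlr : l ≤ r) (hp : power l r k p = 0)
    (hp0 : 0 ≤ p.im) (hρ0 : 0 < ρ) (hρ : ρ ^ 2 = ((r - l) / 2) ^ 2 + k ^ 2) (hne : p ≠ r)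
    (h : 0 ≤ cross (p - ((⟨(l + r) / 2, k⟩ : ℂ) - ρ)) (r - ((⟨(l + r) / 2, k⟩ : ℂ) - ρ))) :
    p.im ≤ k ∧ p.re ≤ (l + r) / 2 := by
  simp only [cross, Complex.sub_re, Complex.sub_im, Complex.ofReal_re, Complex.ofReal_im] at h
  unfold power at hp
  set S := (r - l) / 2 with hS
  set x := p.re - (l + r) / 2 with hx
  have hS0 : 0 ≤ S := by rw [hS]; linarith
  have hc : x ^ 2 + (p.im - k) ^ 2 = ρ ^ 2 := by rw [hρ, hx, hS]; nlinarith
  have hh : k * (x + ρ) ≤ (k - p.im) * (S + ρ) := by rw [hx, hS]; nlinarith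
  have hxρ : -ρ ≤ x := (abs_le_of_sq_le_sq' (by linarith [sq_nonneg (p.im - k)]) hρ0.le).1
  have hne' : ¬ (x = S ∧ p.im = 0) := by
    rintro ⟨h1, h2⟩
    exact hne (Complex.ext (by simp; linarith) (by simp [h2]))
  have hxS : x ^ 2 = S ^ 2 + 2 * k * p.im - p.im ^ 2 := by nlinarith
  have key : p.im ≤ k := by
    rcases le_or_gt 0 k with hk | hk
    · have : 0 ≤ (k - p.im) * (S + ρ) := le_trans (mul_nonneg hk (by linarith)) hh
      by_contra hcon
      push Not at hcon
      nlinarith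
    · exfalso
      have h1 : x ≤ S := by
        refine (abs_le_of_sq_le_sq' ?_ hS0).2
        nlinarith [mul_nonneg (neg_nonneg.2 hk.le) hp0]
      have h2 : k * (S + ρ) ≤ k * (x + ρ) := mul_le_mul_of_nonpos_left (by linarith) hk.le
      have h3 : p.im = 0 := by nlinarith
      rw [h3] at hh
      have h4 : x = S := by nlinarith
      exact hne' ⟨h4, h3⟩
  refine ⟨key, ?_⟩
  have hk : 0 ≤ k := hp0.trans key
  by_contra hcon
  push Not at hcon
  have hx0 : 0 < x := by rw [hx]; linarith
  have h1 : S ≤ x := by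
    refine (abs_le_of_sq_le_sq' ?_ hx0.le).2
    nlinarith [mul_nonneg hp0 (sub_nonneg.2 key), mul_nonneg hp0 hk]
  have h2 : k * (S + ρ) ≤ k * (x + ρ) := mul_le_mul_of_nonneg_left (by linarith) hk
  have h3 : p.im = 0 := by nlinarith
  rw [h3] at hxS
  have h4 : x = S := by nlinarith
  exact hne' ⟨h4, h3⟩

/-! ### Triangles -/

lemma cross_self (a : ℂ) : cross a a = 0 := by simp [cross]; ring

lemma cross_swap (a b : ℂ) : cross a b = -cross b a := by simp [cross]; ring

lemma collinear_of_cross_eq_zero {a b d : ℂ} (h : cross (b - a) (d - a) = 0) :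
    Collinear ℝ {a, b, d} := by
  by_cases hab : b = a
  · rw [hab, Set.insert_eq_of_mem (by simp)]
    exact collinear_pair ℝ a d
  rw [collinear_iff_of_mem (p₀ := a) (by simp)]
  have hn : 0 < (b - a).re ^ 2 + (b - a).im ^ 2 := by
    have h1 : 0 < Complex.normSq (b - a) := Complex.normSq_pos.2 (sub_ne_zero.2 hab)
    rw [Complex.normSq_apply] at h1
    nlinarith
  refine ⟨b - a, fun p hp => ?_⟩
  rcases hp with rfl | rfl | rfl
  · exact ⟨0, by simp⟩
  · exact ⟨1, by simp⟩
  · refine ⟨((b - a).re * (p - a).re + (b - a).im * (p - a).im)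
      / ((b - a).re ^ 2 + (b - a).im ^ 2), ?_⟩
    unfold cross at h
    rw [vadd_eq_add, ← sub_eq_iff_eq_add]
    apply Complex.ext
    · rw [Complex.smul_re, smul_eq_mul, div_mul_eq_mul_div, eq_div_iff hn.ne']
      linear_combination (-(b - a).im) * h
    · rw [Complex.smul_im, smul_eq_mul, div_mul_eq_mul_div, eq_div_iff hn.ne']
      linear_combination ((b - a).re) * h

/-- A triangle of a triangulation, with its vertices. -/
lemma triangle_vertices {P : Finset ℂ} {𝒯 : Finset (Finset ℂ)} (hD : IsDelaunayTriangulation P 𝒯)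
    {T : Finset ℂ} (hT : T ∈ 𝒯) :
    ∃ a b d : ℂ, T = {a, b, d} ∧ cross (b - a) (d - a) ≠ 0 := by
  obtain ⟨a, b, d, -, -, -, rfl⟩ := Finset.card_eq_three.1 (hD.card_eq T hT)
  refine ⟨a, b, d, rfl, fun h => hD.not_collinear _ hT ?_⟩
  have := collinear_of_cross_eq_zero h
  simpa using this

/-- A triangle of a triangulation, with a given vertex first. -/
lemma triangle_vertices_of_mem {P : Finset ℂ} {𝒯 : Finset (Finset ℂ)}
    (hD : IsDelaunayTriangulation P 𝒯) {T : Finset ℂ} (hT : T ∈ 𝒯) {p : ℂ} (hp : p ∈ T) :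
    ∃ u v : ℂ, T = {p, u, v} ∧ 0 < cross (u - p) (v - p) := by
  obtain ⟨a, b, d, rfl, h⟩ := triangle_vertices hD hT
  have key : ∃ u v : ℂ, ({a, b, d} : Finset ℂ) = {p, u, v} ∧ cross (u - p) (v - p) ≠ 0 := by
    simp only [Finset.mem_insert, Finset.mem_singleton] at hp
    rcases hp with rfl | rfl | rfl
    · exact ⟨b, d, rfl, h⟩
    · refine ⟨a, d, by ext; simp; tauto, fun h' => h ?_⟩
      simp only [cross, Complex.sub_re, Complex.sub_im] at h' ⊢
      linarith
    · refine ⟨a, b, by ext; simp; tauto, fun h' => h ?_⟩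
      simp only [cross, Complex.sub_re, Complex.sub_im] at h' ⊢
      linarith
  obtain ⟨u, v, h1, h2⟩ := key
  rcases h2.lt_or_gt with h3 | h3
  · refine ⟨v, u, by rw [h1]; ext; simp; tauto, ?_⟩
    rw [cross_swap]; linarith
  · exact ⟨u, v, h1, h3⟩

lemma exists_circumcircle {P : Finset ℂ} {𝒯 : Finset (Finset ℂ)}
    (hD : IsDelaunayTriangulation P 𝒯) {T : Finset ℂ} (hT : T ∈ 𝒯) :
    ∃ c ρ, IsCircumcircle T c ρ := by
  obtain ⟨a, b, d, rfl, h⟩ := triangle_vertices hD hT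
  set N1 := (b - a).re ^ 2 + (b - a).im ^ 2 with h1
  set N2 := (d - a).re ^ 2 + (d - a).im ^ 2 with h2
  set D := 2 * cross (b - a) (d - a) with hDd
  have hD0 : D ≠ 0 := mul_ne_zero two_ne_zero h
  -- Cramer's rule for the two perpendicular bisectors through the center, relative to `a`.
  set x := (N1 * (d - a).im - N2 * (b - a).im) / D with hx
  set y := ((b - a).re * N2 - (d - a).re * N1) / D with hy
  have ex : x * D = N1 * (d - a).im - N2 * (b - a).im := by rw [hx]; field_simp
  have ey : y * D = (b - a).re * N2 - (d - a).re * N1 := by rw [hy]; field_simp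
  have eb : 2 * (x * (b - a).re + y * (b - a).im) = N1 := by
    apply mul_right_cancel₀ hD0
    rw [hDd, cross] at ex ey ⊢
    linear_combination 2 * (b - a).re * ex + 2 * (b - a).im * ey
  have ed : 2 * (x * (d - a).re + y * (d - a).im) = N2 := by
    apply mul_right_cancel₀ hD0
    rw [hDd, cross] at ex ey ⊢
    linear_combination 2 * (d - a).re * ex + 2 * (d - a).im * ey
  have hdist : ∀ z : ℂ, 2 * (x * (z - a).re + y * (z - a).im) = (z - a).re ^ 2 + (z - a).im ^ 2 →
      dist z (a + ⟨x, y⟩) = √(x ^ 2 + y ^ 2) := by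
    intro z hz
    rw [dist_eq_sqrt]
    congr 1
    simp only [Complex.sub_re, Complex.sub_im, Complex.add_re, Complex.add_im] at hz ⊢
    linarith
  refine ⟨a + ⟨x, y⟩, √(x ^ 2 + y ^ 2), fun v hv => ?_⟩
  simp only [Finset.mem_insert, Finset.mem_singleton] at hv
  rcases hv with rfl | rfl | rfl
  · exact hdist _ (by simp)
  · exact hdist _ (eb.trans h1)
  · exact hdist _ (ed.trans h2)

/-! ### Convex hulls -/

lemma affine_combination (w : ℂ → ℝ) (T : Finset ℂ) (hw : ∑ y ∈ T, w y = 1) (α β γ : ℝ) :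
    ∑ y ∈ T, w y * (α * y.re + β * y.im + γ) =
      α * (∑ y ∈ T, w y • y).re + β * (∑ y ∈ T, w y • y).im + γ := by
  simp only [Complex.re_sum, Complex.im_sum, Complex.smul_re, Complex.smul_im, smul_eq_mul,
    Finset.mul_sum]
  have hγ : γ = ∑ y ∈ T, γ * w y := by rw [← Finset.mul_sum, hw, mul_one]
  conv_rhs => rw [hγ]
  rw [← Finset.sum_add_distrib, ← Finset.sum_add_distrib]
  exact Finset.sum_congr rfl fun y _ => by ring

lemma affine_nonpos_of_mem_hull {T : Finset ℂ} {α β γ : ℝ}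
    (h : ∀ v ∈ T, α * v.re + β * v.im + γ ≤ 0) {z : ℂ} (hz : z ∈ convexHull ℝ (T : Set ℂ)) :
    α * z.re + β * z.im + γ ≤ 0 := by
  obtain ⟨w, h0, h1, rfl⟩ := Finset.mem_convexHull'.1 hz
  rw [← affine_combination w T h1]
  exact Finset.sum_nonpos fun y hy => mul_nonpos_of_nonneg_of_nonpos (h0 y hy) (h y hy)

lemma affine_nonneg_of_mem_hull {T : Finset ℂ} {α β γ : ℝ}
    (h : ∀ v ∈ T, 0 ≤ α * v.re + β * v.im + γ) {z : ℂ} (hz : z ∈ convexHull ℝ (T : Set ℂ)) :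
    0 ≤ α * z.re + β * z.im + γ := by
  have := affine_nonpos_of_mem_hull (T := T) (α := -α) (β := -β) (γ := -γ)
    (fun v hv => by linarith [h v hv]) hz
  linarith

/-- The parallel axis identity: at a weighted mean, the equation of a circle takes its weighted mean
value minus the variance of the points. -/
lemma quadratic_combination (w : ℂ → ℝ) (T : Finset ℂ) (hw : ∑ y ∈ T, w y = 1) (α β γ : ℝ)
    {z : ℂ} (hz : ∑ y ∈ T, w y • y = z) :
    z.re ^ 2 + z.im ^ 2 + α * z.re + β * z.im + γ =
      ∑ y ∈ T, w y * (y.re ^ 2 + y.im ^ 2 + α * y.re + β * y.im + γ)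
      - ∑ y ∈ T, w y * ((y.re - z.re) ^ 2 + (y.im - z.im) ^ 2) := by
  have h := affine_combination w T hw (α + 2 * z.re) (β + 2 * z.im) (γ - z.re ^ 2 - z.im ^ 2)
  rw [hz] at h
  have e : z.re ^ 2 + z.im ^ 2 + α * z.re + β * z.im + γ =
    (α + 2 * z.re) * z.re + (β + 2 * z.im) * z.im + (γ - z.re ^ 2 - z.im ^ 2) := by ring
  rw [e, ← h, ← Finset.sum_sub_distrib]
  exact Finset.sum_congr rfl fun y _ => by ring

/-- The power of `q` is nonnegative because the circle is empty, and it equals minus the variance of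
the vertices about `q`. So all the weight is at `q`. -/
lemma vertex_of_mem_hull {P : Finset ℂ} {𝒯 : Finset (Finset ℂ)}
    (hD : IsDelaunayTriangulation P 𝒯) {T : Finset ℂ} (hT : T ∈ 𝒯) {q : ℂ} (hq : q ∈ P)
    (hqT : q ∈ convexHull ℝ (T : Set ℂ)) : q ∈ T := by
  obtain ⟨c, ρ, hc⟩ := exists_circumcircle hD hT
  have hρ : 0 ≤ ρ := by
    obtain ⟨a, b, d, rfl, -⟩ := triangle_vertices hD hT
    rw [← hc a (by simp)]
    exact dist_nonneg
  have hqc := hD.empty_circle T hT c ρ hc q hq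
  obtain ⟨w, h0, h1, h2⟩ := Finset.mem_convexHull'.1 hqT
  have hF : ∀ z : ℂ, dist z c ^ 2 - ρ ^ 2 = z.re ^ 2 + z.im ^ 2 + (-2 * c.re) * z.re
      + (-2 * c.im) * z.im + (c.re ^ 2 + c.im ^ 2 - ρ ^ 2) := by
    intro z
    rw [dist_eq_sqrt, Real.sq_sqrt (by positivity)]
    ring
  have h3 := quadratic_combination w T h1 (-2 * c.re) (-2 * c.im) (c.re ^ 2 + c.im ^ 2 - ρ ^ 2) h2
  rw [← hF] at h3
  have h4 : ∑ y ∈ T, w y * (y.re ^ 2 + y.im ^ 2 + (-2 * c.re) * y.re + (-2 * c.im) * y.im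
      + (c.re ^ 2 + c.im ^ 2 - ρ ^ 2)) = 0 :=
    Finset.sum_eq_zero fun y hy => by rw [← hF, hc y hy]; ring
  have h5 : 0 ≤ dist q c ^ 2 - ρ ^ 2 := by nlinarith
  have hnn : ∀ y ∈ T, 0 ≤ w y * ((y.re - q.re) ^ 2 + (y.im - q.im) ^ 2) := fun y hy =>
    mul_nonneg (h0 y hy) (by positivity)
  have h6 : ∑ y ∈ T, w y * ((y.re - q.re) ^ 2 + (y.im - q.im) ^ 2) = 0 :=
    le_antisymm (by linarith) (Finset.sum_nonneg hnn)
  have h7 : ∃ y ∈ T, w y ≠ 0 := by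
    by_contra hcon
    push Not at hcon
    rw [Finset.sum_eq_zero hcon] at h1
    exact zero_ne_one h1
  obtain ⟨y, hy, hwy⟩ := h7
  have h8 := (Finset.sum_eq_zero_iff_of_nonneg hnn).1 h6 y hy
  have h9 : (y.re - q.re) ^ 2 + (y.im - q.im) ^ 2 = 0 := (mul_eq_zero.1 h8).resolve_left hwy
  have h10 : y = q := by
    apply Complex.ext <;> nlinarith [sq_nonneg (y.re - q.re), sq_nonneg (y.im - q.im)]
  rwa [← h10]

/-! ### Separation of triangles -/

lemma affineSpan_triangle_eq_top {T : Finset ℂ} (hc : T.card = 3)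
    (hT : ¬ Collinear ℝ (T : Set ℂ)) : affineSpan ℝ (T : Set ℂ) = ⊤ := by
  obtain ⟨a, b, d, -, -, -, rfl⟩ := Finset.card_eq_three.1 hc
  have h1 : AffineIndependent ℝ ![a, b, d] := by
    rw [affineIndependent_iff_not_collinear_set]
    simpa using hT
  have h2 := h1.affineSpan_eq_top_iff_card_eq_finrank_add_one.2 (by simp)
  have h3 : Set.range ![a, b, d] = (({a, b, d} : Finset ℂ) : Set ℂ) := by
    ext z; simp [Matrix.range_cons]; tauto
  rwa [h3] at h2

/-- Two triangles of a triangulation are separated by a line. -/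
lemma exists_separation {P : Finset ℂ} {𝒯 : Finset (Finset ℂ)} (hD : IsDelaunayTriangulation P 𝒯)
    {T T' : Finset ℂ} (hT : T ∈ 𝒯) (hT' : T' ∈ 𝒯) (hne : T ≠ T') :
    ∃ α β γ : ℝ, ¬ (α = 0 ∧ β = 0) ∧
      (∀ z ∈ convexHull ℝ (T : Set ℂ), α * z.re + β * z.im + γ ≤ 0) ∧
      ∀ z ∈ convexHull ℝ (T' : Set ℂ), 0 ≤ α * z.re + β * z.im + γ := by
  have hint : ∀ S ∈ 𝒯, (interior (convexHull ℝ (S : Set ℂ))).Nonempty := fun S hS =>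
    interior_convexHull_nonempty_iff_affineSpan_eq_top.2
      (affineSpan_triangle_eq_top (hD.card_eq S hS) (hD.not_collinear S hS))
  -- A nondegenerate triangle lies in the closure of its interior, so a line that separates the
  -- interiors also separates the triangles weakly.
  have hcl : ∀ S ∈ 𝒯, convexHull ℝ (S : Set ℂ) ⊆ closure (interior (convexHull ℝ (S : Set ℂ))) :=
    fun S hS => by
      rw [(convex_convexHull ℝ _).closure_interior_eq_closure_of_nonempty_interior (hint S hS)]
      exact subset_closure
  obtain ⟨f, u, h1, h2⟩ := geometric_hahn_banach_open
    (convex_convexHull ℝ (T : Set ℂ)).interior isOpen_interior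
    (convex_convexHull ℝ (T' : Set ℂ)).interior (hD.disjoint_interiors T hT T' hT' hne)
  have hf : ∀ z : ℂ, f z = f 1 * z.re + f Complex.I * z.im := by
    intro z
    have hz : z = z.re • (1 : ℂ) + z.im • Complex.I := by
      apply Complex.ext <;> simp
    conv_lhs => rw [hz]
    rw [map_add, map_smul, map_smul, smul_eq_mul, smul_eq_mul]
    ring
  refine ⟨f 1, f Complex.I, -u, ?_, ?_, ?_⟩
  · rintro ⟨e1, e2⟩
    obtain ⟨a, ha⟩ := hint T hT
    obtain ⟨b, hb⟩ := hint T' hT'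
    have h3 := h1 a ha
    have h4 := h2 b hb
    rw [hf, e1, e2] at h3 h4
    linarith
  · intro z hz
    have hsub : closure (interior (convexHull ℝ (T : Set ℂ))) ⊆ {z | f z ≤ u} :=
      closure_minimal (fun a ha => (h1 a ha).le) (isClosed_le f.continuous continuous_const)
    have := hsub (hcl T hT hz)
    rw [Set.mem_ofPred_eq, hf] at this
    linarith
  · intro z hz
    have hsub : closure (interior (convexHull ℝ (T' : Set ℂ))) ⊆ {z | u ≤ f z} :=
      closure_minimal (fun a ha => h2 a ha) (isClosed_le continuous_const f.continuous)
    have := hsub (hcl T' hT' hz)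
    rw [Set.mem_ofPred_eq, hf] at this
    linarith

/-- If points of the convex hull of `P` tend to a point, then this point lies in a triangle that
contains points arbitrarily far in the sequence. -/
lemma exists_frequently_mem {P : Finset ℂ} {𝒯 : Finset (Finset ℂ)}
    (hD : IsDelaunayTriangulation P 𝒯) {ι : Type*} {l : Filter ι} [l.NeBot] {f : ι → ℂ}
    (hf : ∀ᶠ i in l, f i ∈ convexHull ℝ (P : Set ℂ)) {z : ℂ} (hz : Tendsto f l (𝓝 z)) :
    ∃ T ∈ 𝒯, z ∈ convexHull ℝ (T : Set ℂ) ∧ ∃ᶠ i in l, f i ∈ convexHull ℝ (T : Set ℂ) := by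
  have h1 : ∃ᶠ i in l, ∃ T : 𝒯, f i ∈ convexHull ℝ (T.1 : Set ℂ) := by
    apply Eventually.frequently
    filter_upwards [hf] with i hi
    rw [← hD.covers] at hi
    simp only [Set.mem_iUnion] at hi
    obtain ⟨T, hT, h⟩ := hi
    exact ⟨⟨T, hT⟩, h⟩
  obtain ⟨⟨T, hT⟩, h2⟩ := frequently_exists.1 h1
  refine ⟨T, hT, ?_, h2⟩
  exact (T.finite_toSet.isClosed_convexHull (𝕜 := ℝ)).mem_of_frequently_of_tendsto h2 hz

/-! ### The normalised setting -/

/-- A Delaunay triangulation in coordinates in which `s = 0`, `t = 1`, and some point lies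
below the real axis. -/
structure Frame (P : Finset ℂ) (𝒯 : Finset (Finset ℂ)) : Prop where
  delaunay : IsDelaunayTriangulation P 𝒯
  zero_mem : (0 : ℂ) ∈ P
  one_mem : (1 : ℂ) ∈ P
  below : ∃ v ∈ P, v.im < 0

/-- The triangle `T` contains a point between `0` and `1` and extends below the real axis. -/
def Meets (T : Finset ℂ) : Prop :=
  (∃ x : ℝ, 0 < x ∧ x < 1 ∧ (x : ℂ) ∈ convexHull ℝ (T : Set ℂ)) ∧ ∃ v ∈ T, v.im < 0

/-- Slightly below the real axis, `T` reaches as far to the right as `T'`. -/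
def Reaches (T T' : Finset ℂ) : Prop :=
  ∀ᶠ ε in 𝓝[>] (0 : ℝ), ∀ a ∈ convexHull ℝ (T' : Set ℂ), a.im = -ε →
    ∃ b ∈ convexHull ℝ (T : Set ℂ), b.im = -ε ∧ a.re ≤ b.re

/-- `T` is the rightmost triangle at `p`. -/
def Rightmost (𝒯 : Finset (Finset ℂ)) (p : ℂ) (T : Finset ℂ) : Prop :=
  T ∈ 𝒯 ∧ Meets T ∧ p ∈ T ∧ ∀ T' ∈ 𝒯, Meets T' → p ∈ T' → Reaches T T'

/-- `T` and `T'` are separated by a line, and `T` lies to the left. -/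
def LeftOf (T T' : Finset ℂ) : Prop :=
  ∃ α β γ : ℝ, 0 < α ∧ (∀ z ∈ convexHull ℝ (T : Set ℂ), α * z.re + β * z.im + γ ≤ 0) ∧
    ∀ z ∈ convexHull ℝ (T' : Set ℂ), 0 ≤ α * z.re + β * z.im + γ

lemma vertex_mem_hull {T : Finset ℂ} {v : ℂ} (hv : v ∈ T) : v ∈ convexHull ℝ (T : Set ℂ) :=
  subset_convexHull ℝ _ (Finset.mem_coe.2 hv)

lemma segment_point_mem_hull {T : Finset ℂ} {a b : ℂ} (ha : a ∈ convexHull ℝ (T : Set ℂ))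
    (hb : b ∈ convexHull ℝ (T : Set ℂ)) {s : ℝ} (h0 : 0 ≤ s) (h1 : s ≤ 1) :
    a + s * (b - a) ∈ convexHull ℝ (T : Set ℂ) := by
  have := (convex_convexHull ℝ (T : Set ℂ)) ha hb (sub_nonneg.2 h1) h0 (by ring)
  convert this using 1
  simp only [Complex.real_smul, Complex.ofReal_sub, Complex.ofReal_one]
  ring

/-! ### Slices below the real axis -/

lemma exists_slice_of_apex {T : Finset ℂ} {o a b : ℂ} (ho : o ∈ convexHull ℝ (T : Set ℂ))
    (ha : a ∈ convexHull ℝ (T : Set ℂ)) (hb : b ∈ convexHull ℝ (T : Set ℂ))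
    (hc : cross (a - o) (b - o) ≠ 0) {y s s' : ℝ} (hs0 : 0 < s) (hs1 : s ≤ 1) (hs0' : 0 < s')
    (hs1' : s' ≤ 1) (hs : o.im + s * (a.im - o.im) = y) (hs' : o.im + s' * (b.im - o.im) = y) :
    ∃ z ∈ convexHull ℝ (T : Set ℂ), ∃ z' ∈ convexHull ℝ (T : Set ℂ),
      z.im = y ∧ z'.im = y ∧ z.re < z'.re := by
  have hz := segment_point_mem_hull ho ha hs0.le hs1
  have hz' := segment_point_mem_hull ho hb hs0'.le hs1'
  have him : (o + s * (a - o)).im = y := by simpa using hs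
  have him' : (o + s' * (b - o)).im = y := by simpa using hs'
  rcases lt_trichotomy (o + s * (a - o)).re (o + s' * (b - o)).re with h | h | h
  · exact ⟨_, hz, _, hz', him, him', h⟩
  · exfalso
    have h1 : s * (a.re - o.re) = s' * (b.re - o.re) := by simpa using h
    have h2 : s * (a.im - o.im) = s' * (b.im - o.im) := by linarith
    have h3 : s * s' * cross (a - o) (b - o) = 0 := by
      simp only [cross, Complex.sub_re, Complex.sub_im]
      linear_combination s' * (b.im - o.im) * h1 - s' * (b.re - o.re) * h2
    exact hc ((mul_eq_zero.1 h3).resolve_left (mul_pos hs0 hs0').ne')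
  · exact ⟨_, hz', _, hz, him', him, h⟩

lemma ratio_bounds {A B : ℝ} (hA : 0 < A) (hAB : A ≤ B) :
    0 < A / B ∧ A / B ≤ 1 ∧ A / B * B = A := by
  have hB : 0 < B := hA.trans_le hAB
  exact ⟨by positivity, (div_le_one hB).2 hAB, by field_simp⟩

/-- Slices of positive width at all small depths make the triangles along the axis comparable from
left to right, even if they touch the axis only in a point. -/
lemma exists_slice {P : Finset ℂ} {𝒯 : Finset (Finset ℂ)} (hD : IsDelaunayTriangulation P 𝒯)
    {T : Finset ℂ} (hT : T ∈ 𝒯) (hM : Meets T) :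
    ∀ᶠ ε in 𝓝[>] (0 : ℝ), ∃ z ∈ convexHull ℝ (T : Set ℂ), ∃ z' ∈ convexHull ℝ (T : Set ℂ),
      z.im = -ε ∧ z'.im = -ε ∧ z.re < z'.re := by
  obtain ⟨⟨x, -, -, hx⟩, v, hv, hv0⟩ := hM
  -- The points `x`, `v`, `w` span a nondegenerate subtriangle. If `w` is not below the axis, it is
  -- sliced as seen from `v`, otherwise as seen from `x`.
  obtain ⟨w, hw, hc⟩ : ∃ w ∈ T, cross (v - x) (w - x) ≠ 0 := by
    by_contra hcon
    push Not at hcon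
    obtain ⟨a, b, d, rfl, habd⟩ := triangle_vertices hD hT
    have h1 := hcon a (by simp)
    have h2 := hcon b (by simp)
    have h3 := hcon d (by simp)
    simp only [cross, Complex.sub_re, Complex.sub_im, Complex.ofReal_re, Complex.ofReal_im]
      at h1 h2 h3 habd
    apply habd
    apply mul_left_cancel₀ hv0.ne
    linear_combination (-(d.im - a.im)) * (h2 - h1) + (b.im - a.im) * (h3 - h1)
  have hvT := vertex_mem_hull hv
  have hwT := vertex_mem_hull hw
  rcases le_or_gt 0 w.im with h0 | h0
  · have hev : ∀ᶠ ε in 𝓝[>] (0 : ℝ), ε ∈ Set.Ioo 0 (-v.im) :=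
      Ioo_mem_nhdsGT (by linarith)
    filter_upwards [hev] with ε hε
    obtain ⟨p1, p2, p3⟩ := ratio_bounds (A := -ε - v.im) (B := 0 - v.im)
      (by linarith [hε.2]) (by linarith [hε.1])
    obtain ⟨q1, q2, q3⟩ := ratio_bounds (A := -ε - v.im) (B := w.im - v.im)
      (by linarith [hε.2]) (by linarith [hε.1])
    refine exists_slice_of_apex hvT hx hwT ?_ p1 p2 q1 q2 (by simp at p3 ⊢; linarith)
      (by linarith)
    intro h
    apply hc
    simp only [cross, Complex.sub_re, Complex.sub_im] at h ⊢
    linarith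
  · have hev : ∀ᶠ ε in 𝓝[>] (0 : ℝ), ε ∈ Set.Ioo 0 (-v.im) :=
      Ioo_mem_nhdsGT (by linarith)
    have hev' : ∀ᶠ ε in 𝓝[>] (0 : ℝ), ε ∈ Set.Ioo 0 (-w.im) :=
      Ioo_mem_nhdsGT (by linarith)
    filter_upwards [hev, hev'] with ε hε hε'
    obtain ⟨p1, p2, p3⟩ := ratio_bounds (A := ε) (B := -v.im) hε.1 hε.2.le
    obtain ⟨q1, q2, q3⟩ := ratio_bounds (A := ε) (B := -w.im) hε'.1 hε'.2.le
    exact exists_slice_of_apex hx hvT hwT hc p1 p2 q1 q2 (by simp; linarith) (by simp; linarith)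

/-! ### The order of the triangles along the real axis -/

lemma LeftOf.reaches {P : Finset ℂ} {𝒯 : Finset (Finset ℂ)} (hD : IsDelaunayTriangulation P 𝒯)
    {T T' : Finset ℂ} (hT' : T' ∈ 𝒯) (hM' : Meets T') (h : LeftOf T T') : Reaches T' T := by
  obtain ⟨α, β, γ, hα, h1, h2⟩ := h
  filter_upwards [exists_slice hD hT' hM'] with ε hε a ha hae
  obtain ⟨z, hz, -, -, hze, -, -⟩ := hε
  refine ⟨z, hz, hze, ?_⟩
  have h3 := h1 a ha
  have h4 := h2 z hz
  rw [hae] at h3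
  rw [hze] at h4
  by_contra hcon
  push Not at hcon
  nlinarith

/-- The slice of `T'` has positive width, so its right end lies strictly to the right of the
separating line. -/
lemma LeftOf.not_reaches {P : Finset ℂ} {𝒯 : Finset (Finset ℂ)} (hD : IsDelaunayTriangulation P 𝒯)
    {T T' : Finset ℂ} (hT' : T' ∈ 𝒯) (hM' : Meets T') (h : LeftOf T T') : ¬ Reaches T T' := by
  obtain ⟨α, β, γ, hα, h1, h2⟩ := h
  intro hR
  obtain ⟨ε, hε, hR⟩ := ((exists_slice hD hT' hM').and hR).exists
  obtain ⟨z, hz, z', hz', hze, hze', hlt⟩ := hε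
  obtain ⟨b, hb, hbe, hle⟩ := hR z' hz' hze'
  have h3 := h1 b hb
  have h4 := h2 z hz
  rw [hbe] at h3
  rw [hze] at h4
  nlinarith

/-- The separating line cannot be horizontal: both triangles have points at every small depth `ε`,
which would force `γ = β * ε` for all of them. -/
lemma leftOf_total {P : Finset ℂ} {𝒯 : Finset (Finset ℂ)} (hD : IsDelaunayTriangulation P 𝒯)
    {T T' : Finset ℂ} (hT : T ∈ 𝒯) (hT' : T' ∈ 𝒯) (hM : Meets T) (hM' : Meets T') (hne : T ≠ T') :
    LeftOf T T' ∨ LeftOf T' T := by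
  obtain ⟨α, β, γ, hnz, h1, h2⟩ := exists_separation hD hT hT' hne
  rcases lt_trichotomy α 0 with hα | hα | hα
  · right
    refine ⟨-α, -β, -γ, by linarith, fun z hz => ?_, fun z hz => ?_⟩
    · linarith [h2 z hz]
    · linarith [h1 z hz]
  · exfalso
    have hzero : ∀ᶠ ε in 𝓝[>] (0 : ℝ), γ = β * ε := by
      filter_upwards [exists_slice hD hT hM, exists_slice hD hT' hM'] with ε hε hε'
      obtain ⟨z, hz, -, -, hze, -, -⟩ := hε
      obtain ⟨z', hz', -, -, hze', -, -⟩ := hε'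
      have h3 := h1 z hz
      have h4 := h2 z' hz'
      rw [hze, hα] at h3
      rw [hze', hα] at h4
      linarith
    obtain ⟨δ, hδ, hsub⟩ := (mem_nhdsGT_iff_exists_Ioo_subset).1 hzero
    have hδ0 : (0 : ℝ) < δ := hδ
    have e1 : γ = β * (δ / 2) := hsub ⟨by linarith, by linarith⟩
    have e2 : γ = β * (δ / 3) := hsub ⟨by linarith, by linarith⟩
    have : β = 0 := by
      apply mul_right_cancel₀ hδ0.ne'
      linarith
    exact hnz ⟨hα, this⟩
  · exact Or.inl ⟨α, β, γ, hα, h1, h2⟩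

lemma Reaches.refl (T : Finset ℂ) : Reaches T T :=
  Eventually.of_forall fun _ a ha hae => ⟨a, ha, hae, le_rfl⟩

lemma Reaches.trans {T T' T'' : Finset ℂ} (h : Reaches T T') (h' : Reaches T' T'') :
    Reaches T T'' := by
  filter_upwards [h, h'] with ε h1 h2 a ha hae
  obtain ⟨b, hb, hbe, hab⟩ := h2 a ha hae
  obtain ⟨d, hd, hde, hbd⟩ := h1 b hb hbe
  exact ⟨d, hd, hde, hab.trans hbd⟩

lemma exists_greatest_of_total {ι : Type*} (R : ι → ι → Prop) (hrefl : ∀ a, R a a)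
    (htrans : ∀ a b c, R a b → R b c → R a c) (S : Finset ι) (hS : S.Nonempty)
    (htot : ∀ a ∈ S, ∀ b ∈ S, R a b ∨ R b a) : ∃ a ∈ S, ∀ b ∈ S, R a b := by
  classical
  induction hS using Finset.Nonempty.cons_induction with
  | singleton a => exact ⟨a, by simp, by simpa using hrefl a⟩
  | cons a S ha _ ih =>
    obtain ⟨m, hm, hmax⟩ := ih fun x hx y hy =>
      htot x (Finset.mem_cons_of_mem hx) y (Finset.mem_cons_of_mem hy)
    rcases htot a (Finset.mem_cons_self a S) m (Finset.mem_cons_of_mem hm) with h | h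
    · refine ⟨a, Finset.mem_cons_self a S, fun b hb => ?_⟩
      rcases Finset.mem_cons.1 hb with rfl | hb
      · exact hrefl _
      · exact htrans _ _ _ h (hmax b hb)
    · refine ⟨m, Finset.mem_cons_of_mem hm, fun b hb => ?_⟩
      rcases Finset.mem_cons.1 hb with rfl | hb
      · exact h
      · exact hmax b hb

lemma exists_rightmost {P : Finset ℂ} {𝒯 : Finset (Finset ℂ)} (hD : IsDelaunayTriangulation P 𝒯)
    {T : Finset ℂ} {p : ℂ} (hT : T ∈ 𝒯) (hM : Meets T) (hp : p ∈ T) :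
    ∃ T', Rightmost 𝒯 p T' := by
  classical
  obtain ⟨m, hm, hmax⟩ := exists_greatest_of_total Reaches Reaches.refl
    (fun _ _ _ => Reaches.trans) (𝒯.filter fun S => Meets S ∧ p ∈ S)
    ⟨T, Finset.mem_filter.2 ⟨hT, hM, hp⟩⟩ (fun a ha b hb => by
      obtain ⟨ha, hMa, -⟩ := Finset.mem_filter.1 ha
      obtain ⟨hb, hMb, -⟩ := Finset.mem_filter.1 hb
      by_cases hab : a = b
      · rw [hab]; exact Or.inl (Reaches.refl b)
      · rcases leftOf_total hD ha hb hMa hMb hab with h | h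
        · exact Or.inr (h.reaches hD hb hMb)
        · exact Or.inl (h.reaches hD ha hMa))
  obtain ⟨h1, h2, h3⟩ := Finset.mem_filter.1 hm
  exact ⟨m, h1, h2, h3, fun S hS hMS hpS => hmax S (Finset.mem_filter.2 ⟨hS, hMS, hpS⟩)⟩

lemma Rightmost.eq_or_leftOf {P : Finset ℂ} {𝒯 : Finset (Finset ℂ)}
    (hD : IsDelaunayTriangulation P 𝒯) {T T' : Finset ℂ} {p : ℂ} (h : Rightmost 𝒯 p T)
    (hT' : T' ∈ 𝒯) (hM' : Meets T') (hp : p ∈ T') : T' = T ∨ LeftOf T' T := by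
  by_cases hne : T' = T
  · exact Or.inl hne
  · rcases leftOf_total hD hT' h.1 hM' h.2.1 hne with h1 | h1
    · exact Or.inr h1
    · exact absurd (h.2.2.2 T' hT' hM' hp) (h1.not_reaches hD hT' hM')

lemma Rightmost.unique {P : Finset ℂ} {𝒯 : Finset (Finset ℂ)}
    (hD : IsDelaunayTriangulation P 𝒯) {T T' : Finset ℂ} {p : ℂ} (h : Rightmost 𝒯 p T)
    (h' : Rightmost 𝒯 p T') : T' = T := by
  rcases h.eq_or_leftOf hD h'.1 h'.2.1 h'.2.2.1 with h1 | h1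
  · exact h1
  · exact absurd (h'.2.2.2 T h.1 h.2.1 h.2.2.1) (h1.not_reaches hD h.1 h.2.1)

/-! ### Chords of circumscribed circles and their monotonicity -/

/-- The circumscribed circle of `T` is empty and its center has height `k`; it meets the segment
from `0` to `1` at `l` and `r`. -/
structure IsChord (P T : Finset ℂ) (l r k : ℝ) : Prop where
  vertex : ∀ v ∈ T, power l r k v = 0
  empty : ∀ q ∈ P, 0 ≤ power l r k q
  left_nonneg : 0 ≤ l
  le : l ≤ r
  right_le : r ≤ 1

lemma quadratic_nonpos_of_mem_hull {T : Finset ℂ} {α β γ : ℝ}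
    (h : ∀ v ∈ T, v.re ^ 2 + v.im ^ 2 + α * v.re + β * v.im + γ = 0) {z : ℂ}
    (hz : z ∈ convexHull ℝ (T : Set ℂ)) :
    z.re ^ 2 + z.im ^ 2 + α * z.re + β * z.im + γ ≤ 0 := by
  obtain ⟨w, h0, h1, h2⟩ := Finset.mem_convexHull'.1 hz
  rw [quadratic_combination w T h1 α β γ h2, Finset.sum_eq_zero fun y hy => by rw [h y hy, mul_zero],
    zero_sub, neg_nonpos]
  exact Finset.sum_nonneg fun y hy => mul_nonneg (h0 y hy) (by positivity)

lemma IsChord.power_nonpos {P T : Finset ℂ} {l r k : ℝ} (h : IsChord P T l r k) {z : ℂ}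
    (hz : z ∈ convexHull ℝ (T : Set ℂ)) : power l r k z ≤ 0 := by
  have h1 := quadratic_nonpos_of_mem_hull (T := T) (α := -(l + r)) (β := -2 * k) (γ := l * r)
    (fun v hv => by
      have := h.vertex v hv
      unfold power at this
      linarith) hz
  unfold power
  linarith

lemma IsChord.real_mem {P T : Finset ℂ} {l r k : ℝ} (h : IsChord P T l r k) {x : ℝ}
    (hx : (x : ℂ) ∈ convexHull ℝ (T : Set ℂ)) : l ≤ x ∧ x ≤ r := by
  have h1 := h.power_nonpos hx
  rw [power_ofReal] at h1
  exact mem_Icc_of_mul_nonpos h.le h1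

/-- The closed disc contains a point between `0` and `1`, but neither `0` nor `1` in its interior.
So its whole chord lies in `[0, 1]`, and the last intersection with the segment is its right end. -/
lemma exists_chord {P : Finset ℂ} {𝒯 : Finset (Finset ℂ)} (F : Frame P 𝒯) {T : Finset ℂ}
    (hT : T ∈ 𝒯) (hM : Meets T) {c : ℂ} {ρ : ℝ} (hc : IsCircumcircle T c ρ) :
    ∃ l r, IsChord P T l r c.im ∧ c = ⟨(l + r) / 2, c.im⟩ ∧ 0 < ρ ∧
      ρ ^ 2 = ((r - l) / 2) ^ 2 + c.im ^ 2 ∧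
      IsGreatest {x : ℝ | 0 ≤ x ∧ x ≤ 1 ∧ dist (x : ℂ) c = ρ} r := by
  obtain ⟨⟨x, hx0, hx1, hx⟩, v, hv, hv0⟩ := hM
  have hρ : 0 ≤ ρ := by rw [← hc v hv]; exact dist_nonneg
  have hD : ∀ z : ℂ, dist z c ^ 2 = (z.re - c.re) ^ 2 + (z.im - c.im) ^ 2 := by
    intro z
    rw [dist_eq_sqrt, Real.sq_sqrt (by positivity)]
  have hemp : ∀ q ∈ P, 0 ≤ dist q c ^ 2 - ρ ^ 2 := by
    intro q hq
    have := F.delaunay.empty_circle T hT c ρ hc q hq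
    nlinarith
  have hxin : (x - c.re) ^ 2 + c.im ^ 2 - ρ ^ 2 ≤ 0 := by
    have h1 := quadratic_nonpos_of_mem_hull (T := T) (α := -2 * c.re) (β := -2 * c.im)
      (γ := c.re ^ 2 + c.im ^ 2 - ρ ^ 2) (fun v hv => by
        have h2 := hD v
        rw [hc v hv] at h2
        linarith) hx
    simp only [Complex.ofReal_re, Complex.ofReal_im] at h1
    linarith
  set S := √(ρ ^ 2 - c.im ^ 2) with hS
  have hS2 : S ^ 2 = ρ ^ 2 - c.im ^ 2 :=
    Real.sq_sqrt (by nlinarith [sq_nonneg (x - c.re)])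
  have hS0 : 0 ≤ S := Real.sqrt_nonneg _
  have hpow : ∀ z : ℂ, power (c.re - S) (c.re + S) c.im z = dist z c ^ 2 - ρ ^ 2 := by
    intro z
    rw [hD, power]
    linear_combination -hS2
  have hxb : -S ≤ x - c.re ∧ x - c.re ≤ S := abs_le_of_sq_le_sq' (by linarith) hS0
  have h0 := hemp 0 F.zero_mem
  have h1 := hemp 1 F.one_mem
  rw [← hpow] at h0 h1
  simp only [power, Complex.zero_re, Complex.zero_im, Complex.one_re, Complex.one_im] at h0 h1
  have hl0 : 0 ≤ c.re - S := by
    by_contra hcon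
    push Not at hcon
    nlinarith [hxb.2]
  have hr1 : c.re + S ≤ 1 := by
    by_contra hcon
    push Not at hcon
    nlinarith [hxb.1]
  have hρ0 : 0 < ρ := by
    rcases hρ.eq_or_lt with h2 | h2
    · exfalso
      rw [← h2] at hS2 hc
      have h3 := hc v hv
      rw [dist_eq_zero] at h3
      rw [h3] at hv0
      nlinarith [sq_nonneg S]
    · exact h2
  have hle : c.re - S ≤ c.re + S := by linarith
  refine ⟨c.re - S, c.re + S, ⟨fun v hv => ?_, fun q hq => ?_, hl0, hle, hr1⟩, ?_, hρ0, ?_, ?_⟩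
  · rw [hpow, hc v hv, sub_self]
  · rw [hpow]; exact hemp q hq
  · apply Complex.ext <;> simp
  · rw [show (c.re + S - (c.re - S)) / 2 = S by ring, hS2]; ring
  · have hdist : ∀ y : ℝ, dist (y : ℂ) c = ρ ↔ (y - (c.re - S)) * (y - (c.re + S)) = 0 := by
      intro y
      rw [← power_ofReal (c.re - S) (c.re + S) c.im y, hpow, sub_eq_zero]
      exact ⟨fun h => by rw [h], fun h => (sq_eq_sq₀ dist_nonneg hρ).1 h⟩
    constructor
    · exact ⟨by linarith, hr1, (hdist _).2 (by ring)⟩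
    · rintro y ⟨-, -, hy⟩
      rw [hdist] at hy
      exact (mem_Icc_of_mul_nonpos hle hy.le).2

/-- The chords move to the right. -/
lemma chord_le_of_leftOf {P : Finset ℂ} {𝒯 : Finset (Finset ℂ)} (hD : IsDelaunayTriangulation P 𝒯)
    {T T' : Finset ℂ} (h : T = T' ∨ LeftOf T T') (hT : T ∈ 𝒯) (hT' : T' ∈ 𝒯) (hM : Meets T)
    (hM' : Meets T') {l r k l' r' k' : ℝ} (hC : IsChord P T l r k) (hC' : IsChord P T' l' r' k') :
    l ≤ l' ∧ r ≤ r' := by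
  -- The difference of the powers is affine and vanishes on the radical axis. Since both circles are
  -- empty, it is nonpositive on `T` and nonnegative on `T'`.
  have hg : ∀ z : ℂ, power l r k z - power l' r' k' z =
      (l' + r' - l - r) * z.re + (2 * k' - 2 * k) * z.im + (l * r - l' * r') := by
    intro z; unfold power; ring
  have hg1 : ∀ z ∈ convexHull ℝ (T : Set ℂ),
      (l' + r' - l - r) * z.re + (2 * k' - 2 * k) * z.im + (l * r - l' * r') ≤ 0 := by
    intro z hz
    refine affine_nonpos_of_mem_hull (fun v hv => ?_) hz
    rw [← hg, hC.vertex v hv]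
    linarith [hC'.empty v (hD.subset T hT hv)]
  have hg2 : ∀ z ∈ convexHull ℝ (T' : Set ℂ),
      0 ≤ (l' + r' - l - r) * z.re + (2 * k' - 2 * k) * z.im + (l * r - l' * r') := by
    intro z hz
    refine affine_nonneg_of_mem_hull (fun v hv => ?_) hz
    rw [← hg, hC'.vertex v hv]
    linarith [hC.empty v (hD.subset T' hT' hv)]
  -- Two points of `T` and `T'` at the same depth, in strict order from left to right, show that the
  -- affine function does not decrease along the axis.
  have hgx : 0 ≤ l' + r' - l - r := by
    rcases h with rfl | ⟨α, β, γ, hα, h1, h2⟩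
    · obtain ⟨ε, z, hz, y, hy, hze, hye, hlt⟩ := (exists_slice hD hT hM).exists
      have h5 := hg1 z hz
      have h6 := hg2 y hy
      rw [hye] at h6
      rw [hze] at h5
      by_contra hcon
      push Not at hcon
      nlinarith
    obtain ⟨ε, hε, hε'⟩ := ((exists_slice hD hT hM).and (exists_slice hD hT' hM')).exists
    obtain ⟨z, hz, y, hy, hze, hye, hlt⟩ := hε
    obtain ⟨z', hz', -, -, hze', -, -⟩ := hε'
    have h3 := h1 y hy
    have h4 := h2 z' hz'
    have h5 := hg1 z hz
    have h6 := hg2 z' hz'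
    rw [hye] at h3
    rw [hze'] at h4 h6
    rw [hze] at h5
    have h7 : y.re ≤ z'.re := by
      by_contra hcon
      push Not at hcon
      nlinarith
    by_contra hcon
    push Not at hcon
    nlinarith
  obtain ⟨⟨x, -, -, hx⟩, -⟩ := hM
  obtain ⟨⟨x', -, -, hx'⟩, -⟩ := hM'
  have hxb := hC.real_mem hx
  have hxb' := hC'.real_mem hx'
  have h1 := hg1 x hx
  have h2 := hg2 x' hx'
  simp only [Complex.ofReal_re, Complex.ofReal_im, mul_zero, add_zero] at h1 h2
  -- If `l'` lies to the left of `x`, monotonicity makes the first power nonpositive at `l'`, so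
  -- `l'` lies in the chord of `T`. The right ends are compared in the same way.
  constructor
  · rcases le_or_gt x l' with h3 | h3
    · linarith
    · have h4 := hg l'
      rw [power_ofReal, power_ofReal] at h4
      simp only [Complex.ofReal_re, Complex.ofReal_im, mul_zero, add_zero] at h4
      refine (mem_Icc_of_mul_nonpos hC.le (x := l') ?_).1
      nlinarith
  · rcases le_or_gt r x' with h3 | h3
    · linarith
    · have h4 := hg r
      rw [power_ofReal, power_ofReal] at h4
      simp only [Complex.ofReal_re, Complex.ofReal_im, mul_zero, add_zero] at h4
      refine (mem_Icc_of_mul_nonpos hC'.le (x := r) ?_).2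
      nlinarith

/-! ### The edge through which the axis leaves a triangle -/

lemma Meets.exists_nonneg {T : Finset ℂ} (hM : Meets T) : ∃ v ∈ T, 0 ≤ v.im := by
  by_contra hcon
  push Not at hcon
  obtain ⟨⟨x, -, -, hx⟩, -⟩ := hM
  have h1 : convexHull ℝ (T : Set ℂ) ⊆ {z | z.im < 0} :=
    convexHull_min (fun v hv => hcon v hv) (convex_halfSpace_im_lt 0)
  have := h1 hx
  simp at this

/-- One of the edges that join the two sides of the axis has the triangle on its left. An upper end
on the axis counts as above it, in accordance with the convention for vertices on the segment. -/
lemma exists_exit_edge {P : Finset ℂ} {𝒯 : Finset (Finset ℂ)}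
    (hD : IsDelaunayTriangulation P 𝒯) {T : Finset ℂ} (hT : T ∈ 𝒯) (hM : Meets T) :
    ∃ u v z : ℂ, T = {z, u, v} ∧ 0 ≤ u.im ∧ v.im < 0 ∧ 0 < cross (u - v) (z - v) := by
  obtain ⟨v, hv, hv0⟩ := hM.2
  obtain ⟨a, b, rfl, h⟩ := triangle_vertices_of_mem hD hT hv
  rcases le_or_gt 0 a.im with ha | ha
  · exact ⟨a, v, b, by ext; simp; tauto, ha, hv0, h⟩
  · have hb : 0 ≤ b.im := by
      obtain ⟨w, hw, hw0⟩ := hM.exists_nonneg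
      simp only [Finset.mem_insert, Finset.mem_singleton] at hw
      rcases hw with rfl | rfl | rfl
      · linarith
      · linarith
      · exact hw0
    refine ⟨b, a, v, by ext; simp; tauto, hb, ha, ?_⟩
    simp only [cross, Complex.sub_re, Complex.sub_im] at h ⊢
    linarith

lemma exists_axis_crossing {u v : ℂ} (hu : 0 ≤ u.im) (hv : v.im < 0) :
    ∃ s x : ℝ, 0 < s ∧ s ≤ 1 ∧ (x : ℂ) = v + s * (u - v) := by
  obtain ⟨h1, h2, h3⟩ := ratio_bounds (A := -v.im) (B := u.im - v.im) (by linarith) (by linarith)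
  generalize -v.im / (u.im - v.im) = s at h1 h2 h3
  refine ⟨s, v.re + s * (u.re - v.re), h1, h2, ?_⟩
  apply Complex.ext
  · simp
  · simp only [Complex.ofReal_im, Complex.add_im, Complex.mul_im, Complex.ofReal_re,
      Complex.sub_im, zero_mul, add_zero]
    linarith

lemma cross_nonneg_of_mem_hull {u v z y : ℂ} (h : 0 < cross (u - v) (z - v))
    (hy : y ∈ convexHull ℝ (({z, u, v} : Finset ℂ) : Set ℂ)) : 0 ≤ cross (u - v) (y - v) := by
  have h1 := affine_nonneg_of_mem_hull (T := {z, u, v}) (α := -(u - v).im) (β := (u - v).re)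
    (γ := (u - v).im * v.re - (u - v).re * v.im) (fun w hw => by
      simp only [Finset.mem_insert, Finset.mem_singleton] at hw
      rcases hw with rfl | rfl | rfl
      · simp only [cross, Complex.sub_re, Complex.sub_im] at h ⊢
        linarith
      · simp only [Complex.sub_re, Complex.sub_im]
        linarith
      · linarith) hy
  simp only [cross, Complex.sub_re, Complex.sub_im] at h1 ⊢
  linarith

/-- Points between `0` and `1` and slightly below the axis lie in the convex hull. -/
lemma Frame.eventually_mem_hull {P : Finset ℂ} {𝒯 : Finset (Finset ℂ)} (F : Frame P 𝒯) {x : ℝ}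
    (hx0 : 0 < x) (hx1 : x < 1) : ∃ δ > 0, ∀ z : ℂ, dist z x < δ → z.im ≤ 0 →
      z ∈ convexHull ℝ (P : Set ℂ) := by
  obtain ⟨B, hB, hB0⟩ := F.below
  set m := -B.im with hm
  have hm0 : 0 < m := by linarith
  -- These are the barycentric coordinates of `z` at `1` and `0` in the triangle `B, 1, 0`. They are
  -- positive at `x`, hence nearby; the coordinate `-z.im / m` at `B` is nonnegative below the axis.
  have hcont : Tendsto (fun z : ℂ => (z.re + z.im / m * B.re, 1 + z.im / m - z.re - z.im / m * B.re))
      (𝓝 (x : ℂ)) (𝓝 (x, 1 - x)) := by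
    have : Continuous (fun z : ℂ =>
        (z.re + z.im / m * B.re, 1 + z.im / m - z.re - z.im / m * B.re)) := by
      fun_prop
    have h := this.tendsto (x : ℂ)
    simpa using h
  have hop : Set.Ioi (0 : ℝ) ×ˢ Set.Ioi (0 : ℝ) ∈ 𝓝 (x, 1 - x) :=
    (isOpen_Ioi.prod isOpen_Ioi).mem_nhds ⟨hx0, by simp; linarith⟩
  obtain ⟨δ, hδ, hball⟩ := Metric.eventually_nhds_iff.1 (hcont.eventually hop)
  refine ⟨δ, hδ, fun z hz hz0 => ?_⟩
  obtain ⟨h1, h2⟩ := hball hz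
  simp only [Set.mem_Ioi] at h1 h2
  have hs0 : 0 ≤ -(z.im / m) := by
    rw [neg_nonneg]; exact div_nonpos_of_nonpos_of_nonneg hz0 hm0.le
  set b := -(z.im / m) with hb
  set a := z.re + z.im / m * B.re with ha
  have hmem : ∑ i : Fin 3, (![b, a, 1 - b - a] : Fin 3 → ℝ) i • (![B, 1, 0] : Fin 3 → ℂ) i ∈
      convexHull ℝ (P : Set ℂ) := by
    apply (convex_convexHull ℝ (P : Set ℂ)).sum_mem
    · intro i _
      fin_cases i <;> simp <;> linarith
    · simp [Fin.sum_univ_three]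
    · intro i _
      apply subset_convexHull
      fin_cases i
      · exact hB
      · exact F.one_mem
      · exact F.zero_mem
  have he : z = ∑ i : Fin 3, (![b, a, 1 - b - a] : Fin 3 → ℝ) i • (![B, 1, 0] : Fin 3 → ℂ) i := by
    simp only [Fin.sum_univ_three]
    apply Complex.ext
    · simp [ha, hb]
    · have hzm : z.im = b * B.im := by
        have := hB0.ne
        rw [hb, hm]; field_simp
      simp [hzm]
  rw [he]
  exact hmem

lemma eq_mul_of_cross_eq_zero {a b : ℂ} (ha : a ≠ 0) (h : cross a b = 0) :
    ∃ t : ℝ, b = t * a := by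
  have hn : 0 < a.re ^ 2 + a.im ^ 2 := by
    have h1 := Complex.normSq_pos.2 ha
    rw [Complex.normSq_apply] at h1
    linarith
  unfold cross at h
  refine ⟨(a.re * b.re + a.im * b.im) / (a.re ^ 2 + a.im ^ 2), ?_⟩
  apply Complex.ext
  · rw [Complex.re_ofReal_mul, div_mul_eq_mul_div, eq_div_iff hn.ne']
    linear_combination (-a.im) * h
  · rw [Complex.im_ofReal_mul, div_mul_eq_mul_div, eq_div_iff hn.ne']
    linear_combination a.re * h

lemma cross_line (a : ℂ) (t : ℝ) : cross a (t * a) = 0 := by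
  simp [cross]; ring

lemma power_line {l r k : ℝ} {u v : ℂ} (hu : power l r k u = 0) (hv : power l r k v = 0) (t : ℝ) :
    power l r k (v + t * (u - v)) = t * (t - 1) * ((u - v).re ^ 2 + (u - v).im ^ 2) := by
  unfold power at hu hv ⊢
  simp only [Complex.add_re, Complex.add_im, Complex.re_ofReal_mul, Complex.im_ofReal_mul,
    Complex.sub_re, Complex.sub_im]
  linear_combination t * hu + (1 - t) * hv

/-- If two triangles touch along a point in the interior of an edge, then they share this edge. -/
lemma edge_subset_of_mem {P : Finset ℂ} {𝒯 : Finset (Finset ℂ)} (hD : IsDelaunayTriangulation P 𝒯)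
    {T T' : Finset ℂ} (hT : T ∈ 𝒯) (hT' : T' ∈ 𝒯) (hne : T ≠ T') {l r k : ℝ}
    (hC : IsChord P T l r k) {u v : ℂ} (hu : u ∈ T) (hv : v ∈ T) (huv : u ≠ v) {s : ℝ}
    (hs0 : 0 < s) (hs1 : s < 1)
    (hm : v + s * (u - v) ∈ convexHull ℝ (T' : Set ℂ)) : u ∈ T' ∧ v ∈ T' := by
  obtain ⟨α, β, γ, hnz, h1, h2⟩ := exists_separation hD hT hT' hne
  have hn : u - v ≠ 0 := sub_ne_zero.2 huv
  have hN : 0 < (u - v).re ^ 2 + (u - v).im ^ 2 := by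
    have h1 := Complex.normSq_pos.2 hn
    rw [Complex.normSq_apply] at h1
    linarith
  have gu := h1 u (vertex_mem_hull hu)
  have gv := h1 v (vertex_mem_hull hv)
  have gm := h2 _ hm
  simp only [Complex.add_re, Complex.add_im, Complex.re_ofReal_mul, Complex.im_ofReal_mul,
    Complex.sub_re, Complex.sub_im] at gm
  -- The separating line passes through an inner point of the edge, so it contains the edge, and
  -- also every vertex of `T'` that contributes to this point.
  have gu0 : α * u.re + β * u.im + γ = 0 := by nlinarith
  have gv0 : α * v.re + β * v.im + γ = 0 := by nlinarith
  obtain ⟨w, w0, w1, w2⟩ := Finset.mem_convexHull'.1 hm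
  have hg0 : ∀ y ∈ T', w y * (α * y.re + β * y.im + γ) = 0 := by
    have hsum := affine_combination w T' w1 α β γ
    rw [w2] at hsum
    simp only [Complex.add_re, Complex.add_im, Complex.re_ofReal_mul, Complex.im_ofReal_mul,
      Complex.sub_re, Complex.sub_im] at hsum
    refine (Finset.sum_eq_zero_iff_of_nonneg fun y hy =>
      mul_nonneg (w0 y hy) (h2 y (vertex_mem_hull hy))).1 ?_
    rw [hsum]
    linear_combination s * gu0 + (1 - s) * gv0
  -- Inner points of the edge are inside the empty circle of `T`, so no vertex lies there. As the
  -- weighted mean of the parameters is `s`, between `0` and `1`, there is a vertex of `T'` at or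
  -- beyond each end.
  have hline : ∀ y ∈ T', w y ≠ 0 → ∃ t : ℝ, y = v + t * (u - v) ∧ (t ≤ 0 ∨ 1 ≤ t) := by
    intro y hy hwy
    have gy := (mul_eq_zero.1 (hg0 y hy)).resolve_left hwy
    have e1 : α * (u.re - v.re) + β * (u.im - v.im) = 0 := by linarith
    have e2 : α * (y.re - v.re) + β * (y.im - v.im) = 0 := by linarith
    have hcr : cross (u - v) (y - v) = 0 := by
      simp only [cross, Complex.sub_re, Complex.sub_im]
      by_cases hα : α = 0
      · have hβ : β ≠ 0 := fun h => hnz ⟨hα, h⟩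
        apply mul_left_cancel₀ hβ
        linear_combination (u.re - v.re) * e2 - (y.re - v.re) * e1
      · apply mul_left_cancel₀ hα
        linear_combination (y.im - v.im) * e1 - (u.im - v.im) * e2
    obtain ⟨t, ht⟩ := eq_mul_of_cross_eq_zero hn hcr
    have hyt : y = v + t * (u - v) := by rw [← ht]; ring
    refine ⟨t, hyt, ?_⟩
    have hp := hC.empty y (hD.subset T' hT' hy)
    rw [hyt, power_line (hC.vertex u hu) (hC.vertex v hv)] at hp
    by_contra hcon
    push Not at hcon
    nlinarith [mul_pos hcon.1 (sub_pos.2 hcon.2)]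
  have hE : ∀ t : ℝ, (u - v).re * (v + t * (u - v)).re + (u - v).im * (v + t * (u - v)).im
      + (-((u - v).re * v.re) - (u - v).im * v.im) = t * ((u - v).re ^ 2 + (u - v).im ^ 2) := by
    intro t
    simp only [Complex.add_re, Complex.add_im, Complex.re_ofReal_mul, Complex.im_ofReal_mul]
    ring
  have hsum := affine_combination w T' w1 (u - v).re (u - v).im
    (-((u - v).re * v.re) - (u - v).im * v.im)
  rw [w2, hE] at hsum
  obtain ⟨y, hy, t, hyt, ht⟩ : ∃ y ∈ T', ∃ t : ℝ, y = v + t * (u - v) ∧ 1 ≤ t := by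
    by_contra hcon
    push Not at hcon
    have : ∑ y ∈ T', w y * ((u - v).re * y.re + (u - v).im * y.im
        + (-((u - v).re * v.re) - (u - v).im * v.im)) ≤ 0 := by
      apply Finset.sum_nonpos
      intro y hy
      by_cases hwy : w y = 0
      · rw [hwy, zero_mul]
      · obtain ⟨t, hyt, ht⟩ := hline y hy hwy
        have ht0 : t ≤ 0 := ht.resolve_right (not_le.2 (hcon y hy t hyt))
        rw [hyt, hE]
        exact mul_nonpos_of_nonneg_of_nonpos (hyt ▸ w0 y hy)
          (mul_nonpos_of_nonpos_of_nonneg ht0 hN.le)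
    rw [hsum] at this
    nlinarith
  obtain ⟨y', hy', t', hyt', ht'⟩ : ∃ y ∈ T', ∃ t : ℝ, y = v + t * (u - v) ∧ t ≤ 0 := by
    by_contra hcon
    push Not at hcon
    have : ∑ y ∈ T', w y * ((u - v).re ^ 2 + (u - v).im ^ 2) ≤
        ∑ y ∈ T', w y * ((u - v).re * y.re + (u - v).im * y.im
        + (-((u - v).re * v.re) - (u - v).im * v.im)) := by
      apply Finset.sum_le_sum
      intro y hy
      by_cases hwy : w y = 0
      · rw [hwy, zero_mul, zero_mul]
      · obtain ⟨t, hyt, ht⟩ := hline y hy hwy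
        have ht1 : 1 ≤ t := ht.resolve_left (not_le.2 (hcon y hy t hyt))
        apply mul_le_mul_of_nonneg_left _ (w0 y hy)
        rw [hyt, hE]
        nlinarith
    rw [hsum, ← Finset.sum_mul, w1] at this
    nlinarith
  have hon : ∀ τ : ℝ, t' ≤ τ → τ ≤ t → v + τ * (u - v) ∈ convexHull ℝ (T' : Set ℂ) := by
    intro τ h3 h4
    have hlt : 0 < t - t' := by linarith
    have h5 := segment_point_mem_hull (s := (τ - t') / (t - t')) (vertex_mem_hull hy')
      (vertex_mem_hull hy) (div_nonneg (by linarith) hlt.le) ((div_le_one hlt).2 (by linarith))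
    convert h5 using 1
    rw [hyt, hyt']
    have h6 : (τ - t') / (t - t') * (t - t') = τ - t' := by field_simp
    generalize (τ - t') / (t - t') = q at h6 ⊢
    have h7 : (q : ℂ) * (t - t') = τ - t' := by exact_mod_cast h6
    linear_combination -(u - v) * h7
  constructor
  · apply vertex_of_mem_hull hD hT' (hD.subset T hT hu)
    convert hon 1 (by linarith) ht using 1
    push_cast; ring
  · apply vertex_of_mem_hull hD hT' (hD.subset T hT hv)
    convert hon 0 ht' (by linarith) using 1
    push_cast; ring

/-- The rightmost triangle at `p` lies to the left of its edge opposite to `p`, unless the axis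
leaves it at `1`. -/
lemma Rightmost.exit_edge {P : Finset ℂ} {𝒯 : Finset (Finset ℂ)} (F : Frame P 𝒯) {T : Finset ℂ}
    {p : ℂ} (h : Rightmost 𝒯 p T) (hp1 : p ≠ 1) :
    ∃ u v z : ℂ, T = {z, u, v} ∧ 0 ≤ u.im ∧ v.im < 0 ∧ 0 < cross (u - v) (z - v) ∧
      (z = p ∨ (p = v ∧ u = 1)) := by
  have hD := F.delaunay
  obtain ⟨u, v, z, hTe, hu0, hv0, hc⟩ := exists_exit_edge hD h.1 h.2.1
  refine ⟨u, v, z, hTe, hu0, hv0, hc, ?_⟩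
  by_contra hcon
  push Not at hcon
  obtain ⟨hzp, hcon⟩ := hcon
  have hp : p = u ∨ p = v := by
    have := h.2.2.1
    rw [hTe] at this
    simp only [Finset.mem_insert, Finset.mem_singleton] at this
    rcases this with h1 | h1 | h1
    · exact absurd h1.symm hzp
    · exact Or.inl h1
    · exact Or.inr h1
  have hu1 : u ≠ 1 := by
    rcases hp with h1 | h1
    · rwa [← h1]
    · exact hcon h1
  have huT : u ∈ T := by rw [hTe]; simp
  have hvT : v ∈ T := by rw [hTe]; simp
  obtain ⟨s, x, hs0, hs1, hx⟩ := exists_axis_crossing hu0 hv0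
  have hxT : (x : ℂ) ∈ convexHull ℝ (T : Set ℂ) := by
    rw [hx]
    exact segment_point_mem_hull (vertex_mem_hull hvT) (vertex_mem_hull huT) hs0.le hs1
  obtain ⟨c, ρ, hcirc⟩ := exists_circumcircle hD h.1
  obtain ⟨l, r, hC, -⟩ := exists_chord F h.1 h.2.1 hcirc
  have hcx : cross (u - v) (x - v) = 0 := by
    rw [hx, add_sub_cancel_left]; exact cross_line _ _
  have hx1 : x < 1 := by
    rcases ((hC.real_mem hxT).2.trans hC.right_le).lt_or_eq with h1 | h1
    · exact h1
    · exfalso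
      rw [h1, Complex.ofReal_one] at hxT hcx
      have h2 := vertex_of_mem_hull hD h.1 F.one_mem hxT
      rw [hTe] at h2
      simp only [Finset.mem_insert, Finset.mem_singleton] at h2
      rcases h2 with h2 | h2 | h2
      · rw [h2] at hcx; linarith
      · exact hu1 h2.symm
      · rw [← h2] at hv0; simp at hv0
  have hx0 : 0 < x := by
    obtain ⟨⟨x0, h1, -, h2⟩, -⟩ := h.2.1
    rw [hTe] at h2
    have h3 := cross_nonneg_of_mem_hull hc h2
    simp only [cross, Complex.sub_re, Complex.sub_im, Complex.ofReal_re, Complex.ofReal_im]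
      at hcx h3
    have h4 : x0 ≤ x := by
      by_contra hcon
      push Not at hcon
      nlinarith
    linarith
  -- If `p` were an end of the exit edge, the triangle on the other side of this edge would also
  -- contain `p` and extend further right. It is found by approaching from the right a point `m` of
  -- the edge slightly below the axis.
  obtain ⟨δ, hδ, hball⟩ := F.eventually_mem_hull hx0 hx1
  have hd0 : 0 < dist v (x : ℂ) := by
    apply dist_pos.2
    intro h1
    rw [h1] at hv0
    simp at hv0
  obtain ⟨τ, hτ0, hτ1, hτδ⟩ : ∃ τ : ℝ, 0 < τ ∧ τ < 1 ∧ τ * dist v (x : ℂ) < δ / 2 := by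
    refine ⟨min (1 / 2) (δ / (4 * dist v (x : ℂ))), by positivity, ?_, ?_⟩
    · exact (min_le_left _ _).trans_lt (by norm_num)
    · calc min (1 / 2) (δ / (4 * dist v (x : ℂ))) * dist v (x : ℂ)
          ≤ δ / (4 * dist v (x : ℂ)) * dist v (x : ℂ) :=
            mul_le_mul_of_nonneg_right (min_le_right _ _) hd0.le
        _ = δ / 4 := by field_simp
        _ < δ / 2 := by linarith
  set s' := s * (1 - τ) with hs'
  have hs0' : 0 < s' := mul_pos hs0 (by linarith)
  have hs1' : s' < 1 := by nlinarith
  set m := v + s' * (u - v) with hm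
  have hmx : m = x + τ * (v - x) := by
    rw [hm, hx, hs']; push_cast; ring
  have hmT : m ∈ convexHull ℝ (T : Set ℂ) :=
    segment_point_mem_hull (vertex_mem_hull hvT) (vertex_mem_hull huT) hs0'.le hs1'.le
  have hmim : m.im ≤ 0 := by
    rw [hmx]
    simp only [Complex.add_im, Complex.ofReal_im, Complex.im_ofReal_mul, Complex.sub_im]
    nlinarith
  have hmd : dist m (x : ℂ) < δ / 2 := by
    rw [hmx, dist_eq_norm, add_sub_cancel_left, norm_mul, Complex.norm_real, ← dist_eq_norm,
      Real.norm_of_nonneg hτ0.le]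
    exact hτδ
  have hev : ∀ᶠ η : ℝ in 𝓝[>] (0 : ℝ), m + (η : ℂ) ∈ convexHull ℝ (P : Set ℂ) := by
    have : ∀ᶠ η : ℝ in 𝓝[>] (0 : ℝ), η ∈ Set.Ioo 0 (δ / 2) := Ioo_mem_nhdsGT (by linarith)
    filter_upwards [this] with η hη
    apply hball
    · have h1 : dist (m + (η : ℂ)) m = η := by
        rw [dist_eq_norm, add_sub_cancel_left, Complex.norm_real, Real.norm_of_nonneg hη.1.le]
      have h2 := dist_triangle (m + (η : ℂ)) m x
      linarith [hη.2]
    · simpa using hmim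
  have htend : Tendsto (fun η : ℝ => m + (η : ℂ)) (𝓝[>] 0) (𝓝 m) := by
    have hcont : Continuous (fun η : ℝ => m + (η : ℂ)) := by fun_prop
    have := hcont.tendsto 0
    simp only [Complex.ofReal_zero, add_zero] at this
    exact this.mono_left nhdsWithin_le_nhds
  obtain ⟨T', hT', hmT', hfreq⟩ := exists_frequently_mem hD hev htend
  obtain ⟨η, hηT', hη0⟩ := (hfreq.and_eventually self_mem_nhdsWithin).exists
  have hη0' : (0 : ℝ) < η := hη0
  have hne : T ≠ T' := by
    intro heq
    rw [← heq, hTe] at hηT'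
    have h1 := cross_nonneg_of_mem_hull hc hηT'
    have h2 : cross (u - v) (m - v) = 0 := by
      rw [hm, add_sub_cancel_left]; exact cross_line _ _
    simp only [cross, Complex.sub_re, Complex.sub_im, Complex.add_re, Complex.add_im,
      Complex.ofReal_re, Complex.ofReal_im] at h1 h2
    nlinarith
  have huv : u ≠ v := by
    intro h1
    rw [h1] at hu0
    linarith
  obtain ⟨hu', hv'⟩ := edge_subset_of_mem hD h.1 hT' hne hC huT hvT huv hs0' hs1' hmT'
  have hM' : Meets T' := by
    refine ⟨⟨x, hx0, hx1, ?_⟩, v, hv', hv0⟩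
    rw [hx]
    exact segment_point_mem_hull (vertex_mem_hull hv') (vertex_mem_hull hu') hs0.le hs1
  have hpT' : p ∈ T' := by
    rcases hp with h1 | h1
    · rwa [h1]
    · rwa [h1]
  rcases h.eq_or_leftOf hD hT' hM' hpT' with h1 | ⟨α, β, γ, hα, h1, h2⟩
  · exact hne h1.symm
  · have h3 := h1 _ hηT'
    have h4 := h2 m hmT
    simp only [Complex.add_re, Complex.add_im, Complex.ofReal_re, Complex.ofReal_im] at h3
    nlinarith

/-- Every point of the segment lies in a triangle that extends below it. By finiteness one such
triangle contains points of the segment arbitrarily close to `0`, hence `0` itself. -/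
lemma Frame.exists_meets_zero {P : Finset ℂ} {𝒯 : Finset (Finset ℂ)} (F : Frame P 𝒯) :
    ∃ T ∈ 𝒯, Meets T ∧ (0 : ℂ) ∈ T := by
  have hD := F.delaunay
  have h1 : ∀ x : ℝ, 0 < x → x < 1 →
      ∃ T ∈ 𝒯, (x : ℂ) ∈ convexHull ℝ (T : Set ℂ) ∧ ∃ v ∈ T, v.im < 0 := by
    intro x hx0 hx1
    obtain ⟨δ, hδ, hball⟩ := F.eventually_mem_hull hx0 hx1
    have hev : ∀ᶠ ε : ℝ in 𝓝[>] (0 : ℝ), (x : ℂ) - ε * Complex.I ∈ convexHull ℝ (P : Set ℂ) := by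
      have : ∀ᶠ η : ℝ in 𝓝[>] (0 : ℝ), η ∈ Set.Ioo 0 δ := Ioo_mem_nhdsGT hδ
      filter_upwards [this] with ε hε
      apply hball
      · rw [dist_eq_norm]
        simp only [sub_sub_cancel_left, norm_neg, norm_mul, Complex.norm_real, Complex.norm_I,
          mul_one]
        rw [Real.norm_of_nonneg hε.1.le]
        exact hε.2
      · simpa using hε.1.le
    have htend : Tendsto (fun ε : ℝ => (x : ℂ) - ε * Complex.I) (𝓝[>] 0) (𝓝 (x : ℂ)) := by
      have hcont : Continuous (fun ε : ℝ => (x : ℂ) - ε * Complex.I) := by fun_prop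
      have := hcont.tendsto 0
      simp only [Complex.ofReal_zero, zero_mul, sub_zero] at this
      exact this.mono_left nhdsWithin_le_nhds
    obtain ⟨T, hT, hxT, hfreq⟩ := exists_frequently_mem hD hev htend
    obtain ⟨ε, hεT, hε0⟩ := (hfreq.and_eventually self_mem_nhdsWithin).exists
    have hε0' : (0 : ℝ) < ε := hε0
    refine ⟨T, hT, hxT, ?_⟩
    by_contra hcon
    push Not at hcon
    have h2 := affine_nonneg_of_mem_hull (α := 0) (β := 1) (γ := 0)
      (fun v hv => by linarith [hcon v hv]) hεT
    simp at h2
    linarith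
  have h2 : ∃ᶠ x : ℝ in 𝓝[>] (0 : ℝ), ∃ T : 𝒯, (x : ℂ) ∈ convexHull ℝ (T.1 : Set ℂ) ∧
      (∃ v ∈ T.1, v.im < 0) ∧ 0 < x ∧ x < 1 := by
    apply Eventually.frequently
    have : ∀ᶠ η : ℝ in 𝓝[>] (0 : ℝ), η ∈ Set.Ioo 0 1 := Ioo_mem_nhdsGT one_pos
    filter_upwards [this] with x hx
    obtain ⟨T, hT, h3, h4⟩ := h1 x hx.1 hx.2
    exact ⟨⟨T, hT⟩, h3, h4, hx⟩
  obtain ⟨⟨T, hT⟩, h3⟩ := frequently_exists.1 h2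
  refine ⟨T, hT, ?_, ?_⟩
  · obtain ⟨x, h4, h5, h6, h7⟩ := h3.exists
    exact ⟨⟨x, h6, h7, h4⟩, h5⟩
  · apply vertex_of_mem_hull hD hT F.zero_mem
    have htend : Tendsto (fun x : ℝ => (x : ℂ)) (𝓝[>] 0) (𝓝 0) := by
      have := Complex.continuous_ofReal.tendsto 0
      rw [Complex.ofReal_zero] at this
      exact this.mono_left nhdsWithin_le_nhds
    exact (T.finite_toSet.isClosed_convexHull (𝕜 := ℝ)).mem_of_frequently_of_tendsto
      (h3.mono fun x hx => hx.1) htend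

/-! ### The invariant of the route -/

/-- A step of Chew's algorithm, where a message at the leftmost point of the circle may be
forwarded in both directions. -/
def WeakStep (𝒯 : Finset (Finset ℂ)) (p q : ℂ) : Prop :=
  ∃ T, Rightmost 𝒯 p T ∧ ∃ (c : ℂ) (ρ r : ℝ), IsCircumcircle T c ρ ∧
    IsGreatest {x : ℝ | 0 ≤ x ∧ x ≤ 1 ∧ dist (x : ℂ) c = ρ} r ∧ q ∈ T ∧ q ≠ p ∧
    ((cross (p - (c - ρ)) (r - (c - ρ)) ≤ 0 ∧ ∀ v ∈ T, v ≠ p → cross (q - p) (v - p) ≤ 0) ∨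
      (0 ≤ cross (p - (c - ρ)) (r - (c - ρ)) ∧ ∀ v ∈ T, v ≠ p → 0 ≤ cross (q - p) (v - p)))

/-- The chord of the last circle on which the route crossed the axis ends at `ρ`. -/
def CrossingRecord (P : Finset ℂ) (𝒯 : Finset (Finset ℂ)) (p : ℂ) (l ρ : ℝ) : Prop :=
  ρ ≤ 0 ∨ ∃ T ∈ 𝒯, ∃ l' k', IsChord P T l' ρ k' ∧ l' ≤ l ∧
    (p.im < 0 → 0 ≤ k' ∧ (∃ v ∈ T, v.im < 0) ∧
      ∃ x : ℝ, l' < x ∧ (x : ℂ) ∈ convexHull ℝ (T : Set ℂ)) ∧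
    (0 ≤ p.im → k' ≤ 0)

/-- The bound on the length `len` of a route from `0` to `p`. -/
def RouteBound (P : Finset ℂ) (𝒯 : Finset (Finset ℂ)) (p : ℂ) (len : ℝ) : Prop :=
  ∃ T ∈ 𝒯, Meets T ∧ p ∈ T ∧ ∃ l r k, IsChord P T l r k ∧ ∃ ρ ≤ r, CrossingRecord P 𝒯 p l ρ ∧
    len + pot (r - p.re) |p.im| ≤ slope * r + crossCost * ρ

lemma CrossingRecord.mono {P : Finset ℂ} {𝒯 : Finset (Finset ℂ)} {p : ℂ} {l l' ρ : ℝ}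
    (h : CrossingRecord P 𝒯 p l ρ) (hl : l ≤ l') : CrossingRecord P 𝒯 p l' ρ :=
  h.imp_right fun ⟨T, hT, a, k, h1, h2, h3⟩ => ⟨T, hT, a, k, h1, h2.trans hl, h3⟩

lemma CrossingRecord.congr {P : Finset ℂ} {𝒯 : Finset (Finset ℂ)} {p q : ℂ} {l ρ : ℝ}
    (h : CrossingRecord P 𝒯 p l ρ) (hpq : p.im < 0 ↔ q.im < 0) : CrossingRecord P 𝒯 q l ρ :=
  h.imp_right fun ⟨T, hT, a, k, h1, h2, h3, h4⟩ =>
    ⟨T, hT, a, k, h1, h2, fun hq => h3 (hpq.2 hq),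
      fun hq => h4 (not_lt.1 fun hp => absurd (hpq.1 hp) (not_lt.2 hq))⟩

/-! ### Steps below the axis -/

lemma step_below {l r k : ℝ} {p q : ℂ} (hlr : l ≤ r) (hp : power l r k p = 0)
    (hq : power l r k q = 0) (hp0 : p.im ≤ 0) (hq0 : q.im ≤ 0)
    (hord : 0 ≤ cross (q - p) (r - p)) (hup : ¬ (k < p.im ∧ p.re < (l + r) / 2))
    (hne : p ≠ r) :
    dist p q + pot (r - q.re) (-q.im) ≤ pot (r - p.re) (-p.im) := by
  have h := step_above (k := -k) (p := starRingEnd ℂ p) (q := starRingEnd ℂ q) hlr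
    (by rwa [power_conj]) (by rwa [power_conj]) (by simpa using hp0) (by simpa using hq0)
    (by
      have := cross_conj (q - p) (r - p)
      simp only [map_sub, Complex.conj_ofReal] at this
      rw [this]; linarith)
    (by simpa using hup) (fun h => hne (by
      have := congrArg (starRingEnd ℂ) h
      simpa using this))
  rw [Complex.dist_conj_conj] at h
  simpa using h

lemma step_up {l r k l' ρ : ℝ} {p q : ℂ} (hlr : l ≤ r) (hp : power l r k p = 0)
    (hq : power l r k q = 0) (hp0 : p.im ≤ 0) (hpk : k ≤ p.im) (hpe : p.re ≤ (l + r) / 2)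
    (hq0 : 0 ≤ q.im) (hl : l' ≤ l) (hρ : ρ ≤ r)
    (hrec : (q.re - l') * (ρ - q.re) ≤ q.im ^ 2) (hdeg : q.re = l → ρ ≤ q.re) :
    dist p q + pot (r - q.re) q.im ≤
      slope * (r - p.re) + p.im + crossCost * (r - ρ) := by
  have h := step_down (k := -k) (p := starRingEnd ℂ p) (q := starRingEnd ℂ q) hlr
    (by rwa [power_conj]) (by rwa [power_conj]) (by simpa using hp0) (by simpa using hpk)
    (by simpa using hpe) (by simpa using hq0) hl hρ (by simpa using hrec) (by simpa using hdeg)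
  rw [Complex.dist_conj_conj] at h
  simpa using h

lemma cross_conj_left {l r k ρ : ℝ} {p : ℂ} :
    cross (starRingEnd ℂ p - ((⟨(l + r) / 2, -k⟩ : ℂ) - ρ)) (r - ((⟨(l + r) / 2, -k⟩ : ℂ) - ρ)) =
      -cross (p - ((⟨(l + r) / 2, k⟩ : ℂ) - ρ)) (r - ((⟨(l + r) / 2, k⟩ : ℂ) - ρ)) := by
  simp only [cross, Complex.sub_re, Complex.sub_im, Complex.conj_re, Complex.conj_im,
    Complex.ofReal_re, Complex.ofReal_im]
  ring

lemma not_left_of_cross_nonneg {l r k ρ : ℝ} {p : ℂ} (hlr : l ≤ r) (hp : power l r k p = 0)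
    (hp0 : p.im ≤ 0) (hρ0 : 0 < ρ) (hρ : ρ ^ 2 = ((r - l) / 2) ^ 2 + k ^ 2)
    (h : 0 ≤ cross (p - ((⟨(l + r) / 2, k⟩ : ℂ) - ρ)) (r - ((⟨(l + r) / 2, k⟩ : ℂ) - ρ))) :
    ¬ (k < p.im ∧ p.re < (l + r) / 2) := by
  have := not_left_of_cross_nonpos (k := -k) (p := starRingEnd ℂ p) hlr (by rwa [power_conj])
    (by simpa using hp0) hρ0 (by rw [hρ]; ring) (by rw [cross_conj_left]; linarith)
  simpa using this

lemma left_of_cross_nonpos {l r k ρ : ℝ} {p : ℂ} (hlr : l ≤ r) (hp : power l r k p = 0)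
    (hp0 : p.im ≤ 0) (hρ0 : 0 < ρ) (hρ : ρ ^ 2 = ((r - l) / 2) ^ 2 + k ^ 2) (hne : p ≠ r)
    (h : cross (p - ((⟨(l + r) / 2, k⟩ : ℂ) - ρ)) (r - ((⟨(l + r) / 2, k⟩ : ℂ) - ρ)) ≤ 0) :
    k ≤ p.im ∧ p.re ≤ (l + r) / 2 := by
  have := left_of_cross_nonneg (k := -k) (p := starRingEnd ℂ p) hlr (by rwa [power_conj])
    (by simpa using hp0) hρ0 (by rw [hρ]; ring) (fun h => hne (by
      have := congrArg (starRingEnd ℂ) h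
      simpa using this)) (by rw [cross_conj_left]; linarith)
  simpa using this

/-! ### The bound is preserved -/

/-- The previous crossing went up, on a circle whose center is not above the axis. For `q` below,
the term `2 * k' * q.im` of the power is then nonnegative and can be dropped. Before the first
crossing, `l' = ρ` makes the product nonpositive. -/
lemma crossing_down_record {P : Finset ℂ} {𝒯 : Finset (Finset ℂ)} {T : Finset ℂ} {l r k ρ : ℝ}
    {p q : ℂ} (hC : IsChord P T l r k) (hR : CrossingRecord P 𝒯 p l ρ) (hp0 : 0 ≤ p.im)
    (hqP : q ∈ P) (hq0 : q.im < 0) :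
    ∃ l' ≤ l, (q.re - l') * (ρ - q.re) ≤ q.im ^ 2 := by
  rcases hR with h | ⟨S, hS, l', k', hC', hl, -, h2⟩
  · exact ⟨ρ, h.trans hC.left_nonneg, by nlinarith [sq_nonneg (q.re - ρ), sq_nonneg q.im]⟩
  · refine ⟨l', hl, ?_⟩
    have h3 := hC'.empty q hqP
    have h4 := mul_nonneg_of_nonpos_of_nonpos (h2 hp0) hq0.le
    unfold power at h3
    linarith

/-- The mirror image, with one more degenerate case: a step up may end on the axis, at the left end
`l` of the current chord. -/
lemma crossing_up_record {P : Finset ℂ} {𝒯 : Finset (Finset ℂ)} (hD : IsDelaunayTriangulation P 𝒯)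
    {T : Finset ℂ} {l r k ρ : ℝ} {p q : ℂ} (hC : IsChord P T l r k)
    (hR : CrossingRecord P 𝒯 p l ρ) (hρ : ρ ≤ r) (hk : k < 0) (hp0 : p.im < 0)
    (hqP : q ∈ P) (hqT : q ∈ T) (hq0 : 0 ≤ q.im) :
    (∃ l' ≤ l, (q.re - l') * (ρ - q.re) ≤ q.im ^ 2) ∧ (q.re = l → ρ ≤ q.re) := by
  rcases hR with h | ⟨S, hS, l', k', hC', hl, h1, -⟩
  · exact ⟨⟨ρ, h.trans hC.left_nonneg, by nlinarith [sq_nonneg (q.re - ρ), sq_nonneg q.im]⟩,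
      fun h1 => by linarith [hC.left_nonneg]⟩
  · obtain ⟨hk', ⟨v, hv, hv0⟩, x, hlx, hx⟩ := h1 hp0
    have h3 := hC'.empty q hqP
    have h4 := mul_nonneg hk' hq0
    unfold power at h3
    refine ⟨⟨l', hl, by linarith⟩, fun hql => ?_⟩
    by_contra hcon
    push Not at hcon
    have h5 := hC.vertex q hqT
    unfold power at h5
    rw [hql, sub_self, zero_mul, zero_add] at h5
    -- If `q.re = l < ρ`, then `q` is on the axis and the two chords have the same left end.
    -- Emptiness of the current circle at the vertices of `S` forces `r = ρ` through the point `x >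
    -- l'`, and then fails at the vertex `v` below the axis, since `k < 0 ≤ k'`.
    have hqim : q.im = 0 := by
      rcases hq0.eq_or_lt with h6 | h6
      · exact h6.symm
      · nlinarith [mul_neg_of_neg_of_pos hk h6, mul_pos h6 h6]
    rw [hqim] at h3
    have hll : l' = l := by
      apply le_antisymm hl
      by_contra h6
      push Not at h6
      nlinarith
    have hg : ∀ z ∈ convexHull ℝ (S : Set ℂ),
        (r - ρ) * z.re + (2 * k - 2 * k') * z.im + (l * ρ - l * r) ≤ 0 := by
      intro z hz
      refine affine_nonpos_of_mem_hull (fun w hw => ?_) hz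
      have h6 := hC'.vertex w hw
      have h7 := hC.empty w (hD.subset S hS hw)
      unfold power at h6 h7
      rw [hll] at h6
      linarith
    have h6 := hg x hx
    have h7 := hg v (vertex_mem_hull hv)
    simp only [Complex.ofReal_re, Complex.ofReal_im] at h6
    have hrρ : r = ρ := by
      apply le_antisymm _ hρ
      by_contra h8
      push Not at h8
      nlinarith
    rw [hrρ] at h7
    nlinarith

lemma IsChord.real_vertex_le {P T : Finset ℂ} {l r k : ℝ} (h : IsChord P T l r k) {p : ℂ}
    (hp : p ∈ T) : |p.im| = 0 → 0 ≤ r - p.re := by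
  intro h0
  have h1 := h.vertex p hp
  rw [abs_eq_zero] at h0
  unfold power at h1
  rw [h0] at h1
  have := (mem_Icc_of_mul_nonpos h.le (x := p.re) (by linarith)).2
  linarith

/-- The position of a route relative to its current rightmost triangle. -/
structure StepData (P : Finset ℂ) (𝒯 : Finset (Finset ℂ)) (T : Finset ℂ) (p q : ℂ)
    (l r k len ρ : ℝ) : Prop where
  mem : T ∈ 𝒯
  meets : Meets T
  left_mem : p ∈ T
  right_mem : q ∈ T
  chord : IsChord P T l r k
  ne : p ≠ r
  le : ρ ≤ r
  record : CrossingRecord P 𝒯 p l ρ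
  bound : len + pot (r - p.re) |p.im| ≤ slope * r + crossCost * ρ

section

variable {P : Finset ℂ} {𝒯 : Finset (Finset ℂ)} {T : Finset ℂ} {p q : ℂ} {l r k len ρ R : ℝ}

lemma StepData.above (h : StepData P 𝒯 T p q l r k len ρ) (hp0 : 0 ≤ p.im) (hq0 : 0 ≤ q.im)
    (hR0 : 0 < R) (hR : R ^ 2 = ((r - l) / 2) ^ 2 + k ^ 2)
    (hw : cross (p - ((⟨(l + r) / 2, k⟩ : ℂ) - R)) (r - ((⟨(l + r) / 2, k⟩ : ℂ) - R)) ≤ 0)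
    (hord : cross (q - p) (r - p) ≤ 0) : RouteBound P 𝒯 q (len + dist p q) := by
  have hp := h.chord.vertex p h.left_mem
  have h1 := step_above h.chord.le hp (h.chord.vertex q h.right_mem) hp0 hq0 hord
    (not_left_of_cross_nonpos h.chord.le hp hp0 hR0 hR hw) h.ne
  refine ⟨T, h.mem, h.meets, h.right_mem, l, r, k, h.chord, ρ, h.le, h.record.congr ?_, ?_⟩
  · constructor <;> intro <;> linarith
  · have h2 := h.bound
    rw [abs_of_nonneg hp0] at h2
    rw [abs_of_nonneg hq0]
    linarith

lemma StepData.below (h : StepData P 𝒯 T p q l r k len ρ) (hp0 : p.im < 0)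
    (hq0 : q.im < 0 ∨ q = r) (hR0 : 0 < R) (hR : R ^ 2 = ((r - l) / 2) ^ 2 + k ^ 2)
    (hw : 0 ≤ cross (p - ((⟨(l + r) / 2, k⟩ : ℂ) - R)) (r - ((⟨(l + r) / 2, k⟩ : ℂ) - R)))
    (hord : 0 ≤ cross (q - p) (r - p)) :
    (q.im < 0 → RouteBound P 𝒯 q (len + dist p q)) ∧ len + dist p q ≤ slope * r + crossCost * ρ := by
  have hp := h.chord.vertex p h.left_mem
  have hq1 : q.im ≤ 0 := by
    rcases hq0 with h1 | h1
    · exact h1.le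
    · rw [h1]; simp
  have h1 := step_below h.chord.le hp (h.chord.vertex q h.right_mem) hp0.le hq1 hord
    (not_left_of_cross_nonneg h.chord.le hp hp0.le hR0 hR hw) h.ne
  have h2 := h.bound
  rw [abs_of_neg hp0] at h2
  refine ⟨fun hq2 => ⟨T, h.mem, h.meets, h.right_mem, l, r, k, h.chord, ρ, h.le,
    h.record.congr ?_, ?_⟩, ?_⟩
  · constructor <;> intro <;> linarith
  · rw [abs_of_neg hq2]
    linarith
  · have h3 : 0 ≤ pot (r - q.re) (-q.im) := by
      have := h.chord.real_vertex_le h.right_mem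
      apply pot_nonneg (by linarith)
      intro h4
      apply this
      rw [abs_eq_zero]; linarith
    linarith

lemma StepData.down (hD : IsDelaunayTriangulation P 𝒯) (h : StepData P 𝒯 T p q l r k len ρ)
    (hp0 : 0 ≤ p.im) (hq0 : q.im < 0) (hR0 : 0 < R) (hR : R ^ 2 = ((r - l) / 2) ^ 2 + k ^ 2)
    (hw : 0 ≤ cross (p - ((⟨(l + r) / 2, k⟩ : ℂ) - R)) (r - ((⟨(l + r) / 2, k⟩ : ℂ) - R)))
    (hx : ∃ x : ℝ, l < x ∧ (x : ℂ) ∈ convexHull ℝ (T : Set ℂ)) :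
    RouteBound P 𝒯 q (len + dist p q) := by
  have hp := h.chord.vertex p h.left_mem
  have hq := h.chord.vertex q h.right_mem
  obtain ⟨hpk, hpe⟩ := left_of_cross_nonneg h.chord.le hp hp0 hR0 hR h.ne hw
  obtain ⟨l', hl, hrec⟩ := crossing_down_record h.chord h.record hp0
    (hD.subset T h.mem h.right_mem) hq0
  -- Here the degenerate case is void: with its center not below the axis, the circle has no point
  -- strictly below its end `l`.
  have h1 := step_down h.chord.le hp hq hp0 hpk hpe hq0.le hl h.le hrec (fun hql => by
    exfalso
    unfold power at hq
    rw [hql] at hq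
    nlinarith [mul_nonneg_of_nonpos_of_nonpos (by linarith : -k ≤ 0) hq0.le,
      mul_pos_of_neg_of_neg hq0 hq0])
  refine ⟨T, h.mem, h.meets, h.right_mem, l, r, k, h.chord, r, le_rfl,
    Or.inr ⟨T, h.mem, l, k, h.chord, le_rfl, fun _ => ⟨hp0.trans hpk, h.meets.2, hx⟩,
      fun h2 => by linarith⟩, ?_⟩
  have h2 := h.bound
  have h3 := linear_le_pot (abs_nonneg p.im) (h.chord.real_vertex_le h.left_mem)
  rw [abs_of_nonneg hp0] at h2 h3
  rw [abs_of_neg hq0]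
  linarith

lemma StepData.up (hD : IsDelaunayTriangulation P 𝒯) (h : StepData P 𝒯 T p q l r k len ρ)
    (hp0 : p.im < 0) (hq0 : 0 ≤ q.im) (hR0 : 0 < R) (hR : R ^ 2 = ((r - l) / 2) ^ 2 + k ^ 2)
    (hw : cross (p - ((⟨(l + r) / 2, k⟩ : ℂ) - R)) (r - ((⟨(l + r) / 2, k⟩ : ℂ) - R)) ≤ 0) :
    RouteBound P 𝒯 q (len + dist p q) := by
  have hp := h.chord.vertex p h.left_mem
  have hq := h.chord.vertex q h.right_mem
  obtain ⟨hpk, hpe⟩ := left_of_cross_nonpos h.chord.le hp hp0.le hR0 hR h.ne hw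
  obtain ⟨⟨l', hl, hrec⟩, hdeg⟩ := crossing_up_record hD h.chord h.record h.le
    (hpk.trans_lt hp0) hp0 (hD.subset T h.mem h.right_mem) h.right_mem hq0
  have h1 := step_up h.chord.le hp hq hp0.le hpk hpe hq0 hl h.le hrec hdeg
  refine ⟨T, h.mem, h.meets, h.right_mem, l, r, k, h.chord, r, le_rfl,
    Or.inr ⟨T, h.mem, l, k, h.chord, le_rfl, fun h2 => by linarith,
      fun _ => (hpk.trans_lt hp0).le⟩, ?_⟩
  have h2 := h.bound
  have h3 := linear_le_pot (abs_nonneg p.im) (h.chord.real_vertex_le h.left_mem)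
  rw [abs_of_neg hp0] at h2 h3
  rw [abs_of_nonneg hq0]
  linarith

end

lemma cross_nonneg_of_chord {l r k X : ℝ} {p v : ℂ} (hp : power l r k p = 0)
    (hv : power l r k v = 0) (hv0 : v.im ≤ 0) (hlX : l ≤ X) (hXr : X ≤ r)
    (h : 0 < cross (v - p) (X - p)) : 0 ≤ cross (v - p) (r - p) := by
  have h1 := cross_nonpos_of_chord (k := -k) (p := starRingEnd ℂ p) (u := starRingEnd ℂ v)
    (by rwa [power_conj]) (by rwa [power_conj]) (by simpa using hv0) hlX hXr (by
      have := cross_conj (v - p) (X - p)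
      simp only [map_sub, Complex.conj_ofReal] at this
      linarith)
  have := cross_conj (v - p) (r - p)
  simp only [map_sub, Complex.conj_ofReal] at this
  linarith

/-- Two vertices below the axis and the vertex `1` would span a triangle that meets the axis at `1`
only. The coefficient `β` gives a line through `1` steep enough to have both lower vertices on its
right. -/
lemma exit_edge_nonneg {T : Finset ℂ} {p z : ℂ} (hT : T = {z, 1, p}) (hM : Meets T)
    (hp : p.im < 0) : 0 ≤ z.im := by
  by_contra hz
  push Not at hz
  obtain ⟨⟨x, -, hx1, hx⟩, -⟩ := hM
  have hzz : |1 - z.re| / (-z.im) * z.im = -|1 - z.re| := by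
    have := hz.ne
    field_simp
  have hpp : |1 - p.re| / (-p.im) * p.im = -|1 - p.re| := by
    have := hp.ne
    field_simp
  have hz0 : 0 ≤ |1 - z.re| / (-z.im) := div_nonneg (abs_nonneg _) (by linarith)
  have hp0 : 0 ≤ |1 - p.re| / (-p.im) := div_nonneg (abs_nonneg _) (by linarith)
  have := affine_nonpos_of_mem_hull (T := T) (α := -1)
    (β := |1 - z.re| / (-z.im) + |1 - p.re| / (-p.im)) (γ := 1) (fun w hw => by
      rw [hT] at hw
      simp only [Finset.mem_insert, Finset.mem_singleton] at hw
      rcases hw with rfl | rfl | rfl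
      · nlinarith [le_abs_self (1 - w.re)]
      · simp
      · nlinarith [le_abs_self (1 - w.re)]) hx
  simp only [Complex.ofReal_re, Complex.ofReal_im] at this
  linarith

/-- The exit edge joins the two neighbours of `p` in the triangle, so the clockwise choice is the
upper end `u` and the counterclockwise choice is the lower end `v`. The side of `p` decides whether
the step crosses the axis. -/
lemma StepData.exit_at_edge {P : Finset ℂ} {𝒯 : Finset (Finset ℂ)}
    (hD : IsDelaunayTriangulation P 𝒯) {T : Finset ℂ} {p q u v : ℂ} {l r k len ρ R : ℝ}
    (h : p ≠ r → StepData P 𝒯 T p q l r k len ρ) (hC : IsChord P T l r k) (hT : T = {p, u, v})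
    (hu : 0 ≤ u.im) (hv : v.im < 0) (hc : 0 < cross (u - v) (p - v)) (hR0 : 0 < R)
    (hR : R ^ 2 = ((r - l) / 2) ^ 2 + k ^ 2) (hqT : q ∈ T) (hqp : q ≠ p)
    (hq : (cross (p - ((⟨(l + r) / 2, k⟩ : ℂ) - R)) (r - ((⟨(l + r) / 2, k⟩ : ℂ) - R)) ≤ 0 ∧
        ∀ w ∈ T, w ≠ p → cross (q - p) (w - p) ≤ 0) ∨
      (0 ≤ cross (p - ((⟨(l + r) / 2, k⟩ : ℂ) - R)) (r - ((⟨(l + r) / 2, k⟩ : ℂ) - R)) ∧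
        ∀ w ∈ T, w ≠ p → 0 ≤ cross (q - p) (w - p))) :
    RouteBound P 𝒯 q (len + dist p q) := by
  have hpT : p ∈ T := by simp [hT]
  have huT : u ∈ T := by simp [hT]
  have hvT : v ∈ T := by simp [hT]
  have hup : u ≠ p := by rintro rfl; rw [cross_self] at hc; exact hc.ne' rfl
  have hvp : v ≠ p := by rintro rfl; simp [cross] at hc
  have hc' : 0 < cross (v - p) (u - p) := by
    convert hc using 1
    simp only [cross, Complex.sub_re, Complex.sub_im]
    ring
  obtain ⟨s, X, hs0, hs1, hX⟩ := exists_axis_crossing hu hv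
  have hXT : (X : ℂ) ∈ convexHull ℝ (T : Set ℂ) := by
    rw [hX]; exact segment_point_mem_hull (vertex_mem_hull hvT) (vertex_mem_hull huT) hs0.le hs1
  obtain ⟨hlX, hXr⟩ := hC.real_mem hXT
  have hXre : X = v.re + s * (u.re - v.re) := by simpa using congrArg Complex.re hX
  have hXim : 0 = v.im + s * (u.im - v.im) := by simpa using congrArg Complex.im hX
  -- The exit edge meets the axis at `X ≤ r`, while `p` lies strictly to the left of this edge.
  have hne : p ≠ r := by
    rintro hpr
    rw [hpr] at hc
    simp only [cross, Complex.sub_re, Complex.sub_im, Complex.ofReal_re, Complex.ofReal_im] at hc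
    have h1 : s * ((u.re - v.re) * (0 - v.im) - (u.im - v.im) * (r - v.re)) =
        v.im * (r - X) := by
      linear_combination v.im * hXre + (r - v.re) * hXim
    nlinarith [mul_pos hs0 hc, mul_nonneg (neg_nonneg.2 hv.le) (sub_nonneg.2 hXr)]
  replace h := h hne
  have hlt : 0 ≤ p.im → l < X := by
    intro hp0
    obtain ⟨s', X', hs0', hs1', hX'⟩ := exists_axis_crossing hp0 hv
    have hXT' : (X' : ℂ) ∈ convexHull ℝ (T : Set ℂ) := by
      rw [hX']
      exact segment_point_mem_hull (vertex_mem_hull hvT) (vertex_mem_hull hpT) hs0'.le hs1'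
    have hX're : X' = v.re + s' * (p.re - v.re) := by simpa using congrArg Complex.re hX'
    have hX'im : 0 = v.im + s' * (p.im - v.im) := by simpa using congrArg Complex.im hX'
    refine (hC.real_mem hXT').1.trans_lt ?_
    have h1 : s * s' * cross (u - v) (p - v) = -v.im * (X - X') := by
      simp only [cross, Complex.sub_re, Complex.sub_im]
      rw [hXre, hX're]
      linear_combination -(s * (u.re - v.re)) * hX'im + s' * (p.re - v.re) * hXim
    have h2 := mul_pos (mul_pos hs0 hs0') hc
    rw [h1] at h2
    exact sub_pos.1 (pos_of_mul_pos_right h2 (by linarith))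
  rcases hq with ⟨hw, hq⟩ | ⟨hw, hq⟩
  · obtain rfl : q = u := by
      rw [hT] at hqT
      simp only [Finset.mem_insert, Finset.mem_singleton] at hqT
      rcases hqT with rfl | rfl | rfl
      · exact absurd rfl hqp
      · rfl
      · exact absurd (hq u huT hup) (not_le.2 hc')
    rcases le_or_gt 0 p.im with hp0 | hp0
    · refine h.above hp0 hu hR0 hR hw ?_
      -- For `s = 1` the vertex `q` lies on the axis at `X > l`, hence it is `r`. Otherwise the
      -- order as seen from `X` carries over to `r`.
      rcases hs1.eq_or_lt with rfl | hs1
      · have hu0 : q.im = 0 := by linarith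
        have hur : q.re = X := by linarith
        have h1 := hC.vertex q hqT
        unfold power at h1
        rw [hu0, hur] at h1
        have h2 : X = r := by
          have := hlt hp0
          rcases mul_eq_zero.1 (by linarith : (X - l) * (X - r) = 0) with h3 | h3 <;> linarith
        have h3 : (r : ℂ) = q := by
          apply Complex.ext <;> simp [hu0, hur, h2]
        rw [h3, cross_self]
      · refine cross_nonpos_of_chord (hC.vertex p hpT) (hC.vertex q hqT) hu hlX hXr ?_
        have : cross (q - p) (X - p) = -((1 - s) * cross (v - p) (q - p)) := by
          rw [hX]
          simp [cross]
          ring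
        rw [this]
        have := mul_pos (sub_pos.2 hs1) hc'
        linarith
    · exact h.up hD hp0 hu hR0 hR hw
  · obtain rfl : q = v := by
      rw [hT] at hqT
      simp only [Finset.mem_insert, Finset.mem_singleton] at hqT
      rcases hqT with rfl | rfl | rfl
      · exact absurd rfl hqp
      · have := hq v hvT hvp
        rw [cross_swap] at this
        linarith
      · rfl
    rcases le_or_gt 0 p.im with hp0 | hp0
    · exact h.down hD hp0 hv hR0 hR hw ⟨X, hlt hp0, hXT⟩
    · refine (h.below hp0 (Or.inl hv) hR0 hR hw ?_).1 hv
      refine cross_nonneg_of_chord (hC.vertex p hpT) (hC.vertex q hqT) hv.le hlX hXr ?_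
      have : cross (q - p) (X - p) = s * cross (q - p) (u - p) := by
        rw [hX]
        simp [cross]
        ring
      rw [this]
      exact mul_pos hs0 hc'

/-- In the exceptional triangle `1` is a vertex, so `r = 1`. A clockwise step goes up to `z`; a
counterclockwise step reaches the destination. -/
lemma StepData.exit_at_end {P : Finset ℂ} {𝒯 : Finset (Finset ℂ)}
    (hD : IsDelaunayTriangulation P 𝒯) {T : Finset ℂ} {p q z : ℂ} {l r k len ρ R : ℝ}
    (h : StepData P 𝒯 T p q l r k len ρ) (hT : T = {z, 1, p}) (hp0 : p.im < 0)
    (hc : 0 < cross (1 - p) (z - p)) (hR0 : 0 < R)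
    (hR : R ^ 2 = ((r - l) / 2) ^ 2 + k ^ 2) (hqp : q ≠ p)
    (hq : (cross (p - ((⟨(l + r) / 2, k⟩ : ℂ) - R)) (r - ((⟨(l + r) / 2, k⟩ : ℂ) - R)) ≤ 0 ∧
        ∀ w ∈ T, w ≠ p → cross (q - p) (w - p) ≤ 0) ∨
      (0 ≤ cross (p - ((⟨(l + r) / 2, k⟩ : ℂ) - R)) (r - ((⟨(l + r) / 2, k⟩ : ℂ) - R)) ∧
        ∀ w ∈ T, w ≠ p → 0 ≤ cross (q - p) (w - p))) :
    (q = 1 ∧ len + dist p q ≤ slope + crossCost) ∨ RouteBound P 𝒯 q (len + dist p q) := by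
  have hqT := h.right_mem
  have h1T : (1 : ℂ) ∈ T := by simp [hT]
  have hzT : z ∈ T := by simp [hT]
  have h1p : (1 : ℂ) ≠ p := by rintro rfl; simp at hp0
  have hzp : z ≠ p := by rintro rfl; simp [cross] at hc
  have hr : r = 1 := by
    have h1 := h.chord.vertex 1 h1T
    have h2 := h.chord.le
    have h3 := h.chord.right_le
    simp only [power, Complex.one_re, Complex.one_im] at h1
    rcases mul_eq_zero.1 (by linarith : (1 - l) * (1 - r) = 0) with h4 | h4 <;> linarith
  rw [hT] at hqT
  simp only [Finset.mem_insert, Finset.mem_singleton] at hqT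
  rcases hq with ⟨hw, hq⟩ | ⟨hw, hq⟩
  · rcases hqT with rfl | rfl | rfl
    · exact Or.inr (h.up hD hp0 (exit_edge_nonneg hT h.meets hp0) hR0 hR hw)
    · exact absurd (hq z hzT hzp) (not_le.2 hc)
    · exact absurd rfl hqp
  · rcases hqT with rfl | rfl | rfl
    · have := hq 1 h1T h1p
      rw [cross_swap] at this
      linarith
    · have h1 := (h.below hp0 (Or.inr (by rw [hr]; simp)) hR0 hR hw
        (by rw [hr, Complex.ofReal_one, cross_self])).2
      have h2 : ρ ≤ 1 := by rw [← hr]; exact h.le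
      rw [hr] at h1
      have : (0 : ℝ) < crossCost := by norm_num [crossCost]
      exact Or.inl ⟨rfl, by nlinarith⟩
    · exact absurd rfl hqp

/-- A step of the algorithm preserves the bound on the length of the route. -/
theorem RouteBound.step {P : Finset ℂ} {𝒯 : Finset (Finset ℂ)} (F : Frame P 𝒯) {p q : ℂ} {len : ℝ}
    (hB : RouteBound P 𝒯 p len) (hp1 : p ≠ 1) (hW : WeakStep 𝒯 p q) :
    (q = 1 ∧ len + dist p q ≤ slope + crossCost) ∨ RouteBound P 𝒯 q (len + dist p q) := by
  obtain ⟨T₀, hT₀, hM₀, hpT₀, l₀, r₀, k₀, hC₀, ρ, hρ, hrec, hlen⟩ := hB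
  obtain ⟨T, hT, c, R, r', hcirc, hr', hqT, hqp, hq⟩ := hW
  obtain ⟨l, r, hC, hc, hR0, hR, hr⟩ := exists_chord F hT.1 hT.2.1 hcirc
  obtain rfl := hr.unique hr'
  obtain ⟨cx, k⟩ := c
  obtain rfl : cx = (l + r) / 2 := congrArg Complex.re hc
  simp only at hC hR
  obtain ⟨hl, hrr⟩ := chord_le_of_leftOf F.delaunay (hT.eq_or_leftOf F.delaunay hT₀ hM₀ hpT₀)
    hT₀ hT.1 hM₀ hT.2.1 hC₀ hC
  have hS : p ≠ r → StepData P 𝒯 T p q l r k len ρ := fun hne =>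
    { mem := hT.1
      meets := hT.2.1
      left_mem := hT.2.2.1
      right_mem := hqT
      chord := hC
      ne := hne
      le := hρ.trans hrr
      record := hrec.mono hl
      bound := by
        -- Passing to the rightmost triangle moves the right end from `r₀` to `r`. The growth of the
        -- potential is absorbed by that of `slope * r`.
        have := pot_le_add (a' := r - p.re) (abs_nonneg p.im) (hC₀.real_vertex_le hpT₀)
          (by linarith)
        nlinarith }
  obtain ⟨u, v, z, hTe, hu, hv, hcr, hz⟩ := hT.exit_edge F hp1
  rcases hz with rfl | ⟨rfl, rfl⟩
  · exact Or.inr (StepData.exit_at_edge F.delaunay hS hC hTe hu hv hcr hR0 hR hqT hqp hq)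
  · exact (hS (by rintro rfl; simp at hv)).exit_at_end F.delaunay hTe hv hcr hR0 hR hqp hq

lemma RouteBound.initial {P : Finset ℂ} {𝒯 : Finset (Finset ℂ)} (F : Frame P 𝒯) :
    RouteBound P 𝒯 0 0 := by
  obtain ⟨T, hT, hM, h0⟩ := F.exists_meets_zero
  obtain ⟨c, R, hc⟩ := exists_circumcircle F.delaunay hT
  obtain ⟨l, r, hC, -⟩ := exists_chord F hT hM hc
  have hr := hC.left_nonneg.trans hC.le
  refine ⟨T, hT, hM, h0, l, r, _, hC, 0, hr, Or.inl le_rfl, ?_⟩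
  have : pot r 0 ≤ slope * r := by
    have := pot_le_add (a := 0) (a' := r) (h := 0) le_rfl (fun _ => le_rfl) hr
    rw [pot_zero] at this
    linarith
  simpa using this

lemma RouteBound.le {P : Finset ℂ} {𝒯 : Finset (Finset ℂ)} {p : ℂ} {len : ℝ}
    (hB : RouteBound P 𝒯 p len) : len ≤ slope + crossCost := by
  obtain ⟨T, hT, hM, hpT, l, r, k, hC, ρ, hρ, -, hlen⟩ := hB
  have h1 := pot_nonneg (abs_nonneg p.im) (hC.real_vertex_le hpT)
  have h2 := hC.right_le
  have h3 : (0 : ℝ) < crossCost := by norm_num [crossCost]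
  have h4 := slope_bounds.1
  nlinarith

/-! ### Walks along a circle -/

lemma cwAngle_spec {c u v : ℂ} {ρ : ℝ} (hu : dist u c = ρ) (hv : dist v c = ρ) :
    0 ≤ cwAngle c u v ∧ cwAngle c u v < 2 * π ∧
      v - c = (u - c) * Complex.exp (-(cwAngle c u v) * Complex.I) := by
  have hmem := toIcoMod_mem_Ico Real.two_pi_pos 0 (Complex.arg ((u - c) / (v - c)))
  rw [zero_add] at hmem
  refine ⟨hmem.1, hmem.2, ?_⟩
  rw [dist_eq_norm] at hu hv
  rcases eq_or_ne (v - c) 0 with h0 | h0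
  · rw [h0, norm_zero] at hv
    rw [← hv, norm_eq_zero] at hu
    rw [h0, hu, zero_mul]
  have hnorm : ‖(u - c) / (v - c)‖ = 1 := by
    rw [norm_div, hu, hv]
    exact div_self (by rw [← hv]; exact norm_ne_zero_iff.2 h0)
  have hexp : Complex.exp (cwAngle c u v * Complex.I) = (u - c) / (v - c) := by
    have h1 := Complex.norm_mul_exp_arg_mul_I ((u - c) / (v - c))
    rw [hnorm, Complex.ofReal_one, one_mul] at h1
    rw [← h1]
    have h2 := self_sub_toIcoMod Real.two_pi_pos 0 (Complex.arg ((u - c) / (v - c)))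
    have h3 : cwAngle c u v = Complex.arg ((u - c) / (v - c)) -
        toIcoDiv Real.two_pi_pos 0 (Complex.arg ((u - c) / (v - c))) * (2 * π) := by
      rw [zsmul_eq_mul] at h2
      unfold cwAngle
      linarith
    rw [Complex.exp_eq_exp_iff_exists_int, h3]
    refine ⟨-toIcoDiv Real.two_pi_pos 0 (Complex.arg ((u - c) / (v - c))), ?_⟩
    push_cast
    ring
  rw [neg_mul, Complex.exp_neg, hexp, inv_div, mul_div_assoc']
  have hu0 : u - c ≠ 0 := by
    rw [← norm_ne_zero_iff, hu, ← hv]; exact norm_ne_zero_iff.2 h0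
  field_simp

/-- The chords have lengths `2 * ‖A‖ * sin (β / 2)` and `2 * ‖A‖ * sin (δ / 2)`, up to sign, and the
inscribed angle between them is half the difference of the rotations. The order of two walks can
thus be read from the sign of a cross product. -/
lemma cross_rotations (A : ℂ) (β δ : ℝ) :
    cross (A * Complex.exp (-β * Complex.I) - A) (A * Complex.exp (-δ * Complex.I) - A) =
      (A.re ^ 2 + A.im ^ 2) * (4 * sin (β / 2) * sin (δ / 2) * sin ((β - δ) / 2)) := by
  have hβ : Complex.exp (-β * Complex.I) = ⟨cos β, -sin β⟩ := by
    apply Complex.ext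
    · rw [← Complex.ofReal_neg, Complex.exp_ofReal_mul_I_re, cos_neg]
    · rw [← Complex.ofReal_neg, Complex.exp_ofReal_mul_I_im, sin_neg]
  have hδ : Complex.exp (-δ * Complex.I) = ⟨cos δ, -sin δ⟩ := by
    apply Complex.ext
    · rw [← Complex.ofReal_neg, Complex.exp_ofReal_mul_I_re, cos_neg]
    · rw [← Complex.ofReal_neg, Complex.exp_ofReal_mul_I_im, sin_neg]
  have h1 : sin β = 2 * sin (β / 2) * cos (β / 2) := by rw [← sin_two_mul]; congr 1; ring
  have h2 : cos β = 1 - 2 * sin (β / 2) ^ 2 := by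
    rw [← cos_sq_add_sin_sq (β / 2), show β = 2 * (β / 2) by ring, cos_two_mul]
    ring_nf
    linarith [cos_sq_add_sin_sq (β * (1 / 2))]
  have h3 : sin δ = 2 * sin (δ / 2) * cos (δ / 2) := by rw [← sin_two_mul]; congr 1; ring
  have h4 : cos δ = 1 - 2 * sin (δ / 2) ^ 2 := by
    rw [← cos_sq_add_sin_sq (δ / 2), show δ = 2 * (δ / 2) by ring, cos_two_mul]
    ring_nf
    linarith [cos_sq_add_sin_sq (δ * (1 / 2))]
  rw [hβ, hδ, sub_div, sin_sub]
  simp only [cross, Complex.sub_re, Complex.sub_im, Complex.mul_re, Complex.mul_im, h1, h2, h3, h4]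
  ring

lemma sin_half_pos {θ : ℝ} (h0 : 0 < θ) (h1 : θ < 2 * π) : 0 < sin (θ / 2) :=
  sin_pos_of_pos_of_lt_pi (by linarith) (by linarith)

lemma sin_half_sub_nonpos_iff {β δ : ℝ} (hβ0 : 0 ≤ β) (hβ : β < 2 * π) (hδ0 : 0 ≤ δ)
    (hδ : δ < 2 * π) : sin ((β - δ) / 2) ≤ 0 ↔ β ≤ δ := by
  constructor
  · intro h
    by_contra hcon
    push Not at hcon
    exact absurd h (not_le.2 (sin_half_pos (by linarith) (by linarith)))
  · intro h
    exact sin_nonpos_of_nonpos_of_neg_pi_le (by linarith) (by linarith)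

lemma pos_mul_nonpos_iff {a b : ℝ} (ha : 0 < a) : a * b ≤ 0 ↔ b ≤ 0 := by
  constructor <;> intro h
  · by_contra hcon
    push Not at hcon
    exact absurd h (not_le.2 (mul_pos ha hcon))
  · exact mul_nonpos_of_nonneg_of_nonpos ha.le h

lemma sq_add_sq_pos {z : ℂ} (h : z ≠ 0) : 0 < z.re ^ 2 + z.im ^ 2 := by
  have := Complex.normSq_pos.2 h
  rw [Complex.normSq_apply] at this
  linarith

lemma cwAngle_self {c a : ℂ} {ρ : ℝ} (ha : dist a c = ρ) (hρ : 0 < ρ) : cwAngle c a a = 0 := by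
  have h : a - c ≠ 0 := by
    rw [← norm_ne_zero_iff, ← dist_eq_norm, ha]
    exact hρ.ne'
  unfold cwAngle
  rw [div_self h, Complex.arg_one]
  exact toIcoMod_apply_left _ _

lemma cwAngle_le_iff {c a b d : ℂ} {ρ : ℝ} (ha : dist a c = ρ) (hb : dist b c = ρ)
    (hd : dist d c = ρ) (hρ : 0 < ρ) (hda : d ≠ a) :
    cwAngle c a b ≤ cwAngle c a d ↔ cross (b - a) (d - a) ≤ 0 := by
  obtain ⟨hβ0, hβ, hbe⟩ := cwAngle_spec ha hb
  obtain ⟨hδ0, hδ, hde⟩ := cwAngle_spec ha hd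
  rcases eq_or_ne b a with rfl | hba
  · rw [cwAngle_self ha hρ]
    simp [cross, hδ0]
  have hA : a - c ≠ 0 := by
    rw [← norm_ne_zero_iff, ← dist_eq_norm, ha]
    exact hρ.ne'
  have h1 := cross_rotations (a - c) (cwAngle c a b) (cwAngle c a d)
  rw [← hbe, ← hde, sub_sub_sub_cancel_right, sub_sub_sub_cancel_right] at h1
  have hβ1 : 0 < cwAngle c a b := hβ0.lt_of_ne' fun h => hba (by
    rw [h] at hbe; simpa using hbe)
  have hδ1 : 0 < cwAngle c a d := hδ0.lt_of_ne' fun h => hda (by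
    rw [h] at hde; simpa using hde)
  rw [h1, pos_mul_nonpos_iff (sq_add_sq_pos hA),
    pos_mul_nonpos_iff (mul_pos (mul_pos four_pos (sin_half_pos hβ1 hβ)) (sin_half_pos hδ1 hδ)),
    sin_half_sub_nonpos_iff hβ0 hβ hδ0 hδ]

lemma ccwAngle_le_iff {c a b d : ℂ} {ρ : ℝ} (ha : dist a c = ρ) (hb : dist b c = ρ)
    (hd : dist d c = ρ) (hρ : 0 < ρ) (hda : d ≠ a) :
    ccwAngle c a b ≤ ccwAngle c a d ↔ 0 ≤ cross (b - a) (d - a) := by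
  have key : ∀ x : ℂ, dist x c = ρ → 0 ≤ ccwAngle c a x ∧ ccwAngle c a x < 2 * π ∧
      x - c = (a - c) * Complex.exp (-((-ccwAngle c a x : ℝ) : ℂ) * Complex.I) := by
    intro x hx
    obtain ⟨h0, h1, h2⟩ := cwAngle_spec hx ha
    refine ⟨h0, h1, ?_⟩
    rw [h2, mul_assoc, ← Complex.exp_add]
    simp [ccwAngle]
  obtain ⟨hβ0, hβ, hbe⟩ := key b hb
  obtain ⟨hδ0, hδ, hde⟩ := key d hd
  rcases eq_or_ne b a with rfl | hba
  · have : ccwAngle c b b = 0 := cwAngle_self ha hρ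
    rw [this]
    simp [cross, hδ0]
  have hA : a - c ≠ 0 := by
    rw [← norm_ne_zero_iff, ← dist_eq_norm, ha]
    exact hρ.ne'
  have h1 := cross_rotations (a - c) (-ccwAngle c a b) (-ccwAngle c a d)
  rw [← hbe, ← hde, sub_sub_sub_cancel_right, sub_sub_sub_cancel_right] at h1
  have hβ1 : 0 < ccwAngle c a b := hβ0.lt_of_ne' fun h => hba (by
    rw [h] at hbe; simpa using hbe)
  have hδ1 : 0 < ccwAngle c a d := hδ0.lt_of_ne' fun h => hda (by
    rw [h] at hde; simpa using hde)
  have h2 : cross (b - a) (d - a) = -(((a - c).re ^ 2 + (a - c).im ^ 2) *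
      (4 * sin (ccwAngle c a b / 2) * sin (ccwAngle c a d / 2) *
        sin ((ccwAngle c a b - ccwAngle c a d) / 2))) := by
    rw [h1, neg_div, neg_div, sin_neg, sin_neg,
      show (-ccwAngle c a b - -ccwAngle c a d) / 2 = -((ccwAngle c a b - ccwAngle c a d) / 2) by ring,
      sin_neg]
    ring
  rw [h2, neg_nonneg, pos_mul_nonpos_iff (sq_add_sq_pos hA),
    pos_mul_nonpos_iff (mul_pos (mul_pos four_pos (sin_half_pos hβ1 hβ)) (sin_half_pos hδ1 hδ)),
    sin_half_sub_nonpos_iff hβ0 hβ hδ0 hδ]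

lemma eq_of_cwAngle_eq {c a b d : ℂ} {ρ : ℝ} (ha : dist a c = ρ) (hb : dist b c = ρ)
    (hd : dist d c = ρ) (h : cwAngle c a b = cwAngle c a d) : b = d := by
  have h1 := (cwAngle_spec ha hb).2.2
  have h2 := (cwAngle_spec ha hd).2.2
  rw [h, ← h2] at h1
  exact sub_left_injective h1

lemma eq_of_ccwAngle_eq {c a b d : ℂ} {ρ : ℝ} (ha : dist a c = ρ) (hb : dist b c = ρ)
    (hd : dist d c = ρ) (h : ccwAngle c a b = ccwAngle c a d) : b = d := by
  have h1 := (cwAngle_spec hb ha).2.2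
  have h2 := (cwAngle_spec hd ha).2.2
  unfold ccwAngle at h
  rw [h] at h1
  exact sub_left_injective (mul_right_cancel₀ (Complex.exp_ne_zero _) (h1.symm.trans h2))

/-! ### Similarities -/

lemma IsDelaunayTriangulation.image {P : Finset ℂ} {𝒯 : Finset (Finset ℂ)}
    (hD : IsDelaunayTriangulation P 𝒯) (ψ : ℂ ≃ᵃ[ℝ] ℂ) {κ : ℝ} (hκ : 0 < κ)
    (hψ : ∀ a b, dist (ψ a) (ψ b) = κ * dist a b) :
    IsDelaunayTriangulation (P.image ψ) (𝒯.image (Finset.image ψ)) := by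
  have hull : ∀ T : Finset ℂ, convexHull ℝ ((T.image ψ : Finset ℂ) : Set ℂ) =
      ψ '' convexHull ℝ (T : Set ℂ) := fun T => by
    rw [Finset.coe_image]
    exact (ψ.toAffineMap.image_convexHull _).symm
  have hint : ∀ S : Set ℂ, interior (ψ '' S) = ψ '' interior S := fun S => by
    exact (ψ.toContinuousAffineEquiv.toHomeomorph.image_interior S).symm
  constructor
  · intro _ h
    obtain ⟨T, hT, rfl⟩ := Finset.mem_image.1 h
    exact Finset.image_subset_image (hD.subset T hT)
  · intro _ h
    obtain ⟨T, hT, rfl⟩ := Finset.mem_image.1 h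
    rw [Finset.card_image_of_injective _ ψ.injective]
    exact hD.card_eq T hT
  · intro _ h
    obtain ⟨T, hT, rfl⟩ := Finset.mem_image.1 h
    intro hcol
    apply hD.not_collinear T hT
    rw [collinear_iff_exists_forall_eq_smul_vadd] at hcol ⊢
    obtain ⟨p, v, h⟩ := hcol
    refine ⟨ψ.symm p, ψ.symm.linear v, fun x hx => ?_⟩
    obtain ⟨r, hr⟩ := h (ψ x) (Finset.mem_coe.2 (Finset.mem_image_of_mem ψ (Finset.mem_coe.1 hx)))
    refine ⟨r, ?_⟩
    rw [← map_smul, ← AffineEquiv.map_vadd, ← hr, AffineEquiv.symm_apply_apply]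
  · intro _ h c ρ hc _ hq'
    obtain ⟨T, hT, rfl⟩ := Finset.mem_image.1 h
    obtain ⟨q, hq, rfl⟩ := Finset.mem_image.1 hq'
    obtain ⟨c, rfl⟩ := ψ.surjective c
    have h1 := hD.empty_circle T hT c (ρ / κ) (fun v hv => by
      rw [← hc (ψ v) (Finset.mem_image_of_mem ψ hv), hψ]
      field_simp) q hq
    rw [hψ]
    rw [div_le_iff₀ hκ] at h1
    linarith
  · intro _ h _ h' hne
    obtain ⟨T, hT, rfl⟩ := Finset.mem_image.1 h
    obtain ⟨T', hT', rfl⟩ := Finset.mem_image.1 h'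
    rw [hull, hull, hint, hint, Set.disjoint_image_iff ψ.injective]
    exact hD.disjoint_interiors T hT T' hT' fun h => hne (by rw [h])
  · have h1 : (⋃ T ∈ 𝒯.image (Finset.image ψ), convexHull ℝ (T : Set ℂ)) =
        ⋃ T ∈ 𝒯, ψ '' convexHull ℝ (T : Set ℂ) := by
      rw [Finset.set_biUnion_finset_image]
      simp only [hull]
    rw [h1, hull, ← hD.covers]
    simp only [Set.image_iUnion]

/-- The reflection in the real axis if `σ = 1`, the identity if `σ = -1`. -/
def reflect (σ : ℝ) (z : ℂ) : ℂ := ⟨z.re, -σ * z.im⟩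

section reflect

variable {σ : ℝ}

lemma reflect_reflect (hσ : σ ^ 2 = 1) (z : ℂ) : reflect σ (reflect σ z) = z := by
  apply Complex.ext
  · rfl
  · simp only [reflect]
    linear_combination z.im * hσ

lemma reflect_ofReal (x : ℝ) : reflect σ x = x := by
  apply Complex.ext <;> simp [reflect]

lemma reflect_sub (a b : ℂ) : reflect σ (a - b) = reflect σ a - reflect σ b := by
  apply Complex.ext <;> simp [reflect]
  ring

lemma dist_reflect (hσ : σ ^ 2 = 1) (a b : ℂ) : dist (reflect σ a) (reflect σ b) = dist a b := by
  rw [dist_eq_sqrt, dist_eq_sqrt]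
  congr 1
  simp only [reflect]
  linear_combination (a.im - b.im) ^ 2 * hσ

lemma cross_reflect (a b : ℂ) : cross (reflect σ a) (reflect σ b) = -σ * cross a b := by
  simp only [cross, reflect]
  ring

end reflect

lemma side_sq (P : Finset ℂ) (s t : ℂ) : side P s t ^ 2 = 1 := by
  unfold side
  split_ifs <;> norm_num

lemma dist_coord (s t a b : ℂ) : dist (coord s t a) (coord s t b) = (dist s t)⁻¹ * dist a b := by
  rw [dist_eq_norm, dist_eq_norm, dist_eq_norm, coord, coord, ← sub_div, norm_div,
    sub_sub_sub_cancel_right, norm_sub_rev t s]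
  ring

/-- The linear part of a normalization. -/
def reflectDiv (σ : ℝ) (hσ : σ ^ 2 = 1) (w : ℂ) (hw : w ≠ 0) : ℂ ≃ₗ[ℝ] ℂ where
  toFun z := reflect σ (z / w)
  invFun z := reflect σ z * w
  map_add' a b := by
    apply Complex.ext <;> simp [reflect, add_div]
    ring
  map_smul' r a := by
    have : (r • a) / w = r * (a / w) := by rw [Complex.real_smul, mul_div_assoc]
    rw [this]
    apply Complex.ext <;> simp [reflect]
    ring
  left_inv z := by
    simp only [reflect_reflect hσ]
    field_simp
  right_inv z := by
    simp only [mul_div_cancel_right₀ _ hw, reflect_reflect hσ]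

lemma exists_normalization {s t : ℂ} (hst : s ≠ t) {σ : ℝ} (hσ : σ ^ 2 = 1) :
    ∃ ψ : ℂ ≃ᵃ[ℝ] ℂ, ∀ z, ψ z = reflect σ (coord s t z) := by
  refine ⟨AffineEquiv.mk' (fun z => reflect σ (coord s t z))
    (reflectDiv σ hσ (t - s) (sub_ne_zero.2 hst.symm)) s fun z => ?_, fun z => rfl⟩
  have : reflect σ (coord s t s) = 0 := by simp [coord, reflect, Complex.ext_iff]
  rw [this, vadd_eq_add, add_zero, vsub_eq_sub]
  rfl

/-- `ψ` maps `s` to `0` and `t` to `1`, and the side on which triangles are considered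
to lie below the real axis. -/
def IsNormalization (P : Finset ℂ) (s t : ℂ) (ψ : ℂ ≃ᵃ[ℝ] ℂ) : Prop :=
  ∀ z, ψ z = reflect (side P s t) (coord s t z)

namespace IsNormalization

variable {P : Finset ℂ} {𝒯 : Finset (Finset ℂ)} {s t : ℂ} {ψ : ℂ ≃ᵃ[ℝ] ℂ}

lemma apply_im (hψ : IsNormalization P s t ψ) (z : ℂ) :
    (ψ z).im = -side P s t * (coord s t z).im := by rw [hψ z]; rfl

lemma apply_re (hψ : IsNormalization P s t ψ) (z : ℂ) :
    (ψ z).re = (coord s t z).re := by rw [hψ z]; rfl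

lemma apply_source (hψ : IsNormalization P s t ψ) : ψ s = 0 := by
  rw [hψ]; simp [coord, reflect, Complex.ext_iff]

lemma apply_target (hψ : IsNormalization P s t ψ) (hst : s ≠ t) : ψ t = 1 := by
  rw [hψ, coord, div_self (sub_ne_zero.2 hst.symm)]
  simp [reflect, Complex.ext_iff]

lemma dist_apply (hψ : IsNormalization P s t ψ) (a b : ℂ) :
    dist (ψ a) (ψ b) = (dist s t)⁻¹ * dist a b := by
  rw [hψ, hψ, dist_reflect (side_sq P s t), dist_coord]

lemma image_hull (ψ : ℂ ≃ᵃ[ℝ] ℂ) (T : Finset ℂ) :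
    convexHull ℝ ((T.image ψ : Finset ℂ) : Set ℂ) = ψ '' convexHull ℝ (T : Set ℂ) := by
  rw [Finset.coe_image]
  exact (ψ.toAffineMap.image_convexHull _).symm

lemma frame (hψ : IsNormalization P s t ψ) (hst : s ≠ t) (hD : IsDelaunayTriangulation P 𝒯)
    (hs : s ∈ P) (ht : t ∈ P) : Frame (P.image ψ) (𝒯.image (Finset.image ψ)) := by
  have hD' := hD.image ψ (inv_pos.2 (dist_pos.2 hst)) hψ.dist_apply
  refine ⟨hD', Finset.mem_image.2 ⟨s, hs, hψ.apply_source⟩,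
    Finset.mem_image.2 ⟨t, ht, hψ.apply_target hst⟩, ?_⟩
  by_cases hside : ∀ v ∈ P, 0 ≤ (coord s t v).im
  · have hσ : side P s t = 1 := if_pos hside
    by_contra hcon
    push Not at hcon
    have h0 : ∀ v ∈ P.image ψ, v.im = 0 := by
      intro _ hv'
      -- If `P` had no point off the line `st` either, the triangle that covers `s` would be
      -- degenerate.
      apply le_antisymm _ (hcon _ hv')
      obtain ⟨v, hv, rfl⟩ := Finset.mem_image.1 hv'
      rw [hψ.apply_im, hσ]
      linarith [hside v hv]
    have hs' : s ∈ convexHull ℝ (P : Set ℂ) := vertex_mem_hull hs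
    rw [← hD.covers] at hs'
    simp only [Set.mem_iUnion] at hs'
    obtain ⟨T, hT, -⟩ := hs'
    have hT' := Finset.mem_image_of_mem (Finset.image ψ) hT
    obtain ⟨a, b, d, h1, h2⟩ := triangle_vertices hD' hT'
    have h3 : ∀ v ∈ T.image ψ, v.im = 0 := fun v hv => h0 v (hD'.subset _ hT' hv)
    rw [h1] at h3
    apply h2
    simp [cross, h3 a (by simp), h3 b (by simp), h3 d (by simp)]
  · have hσ : side P s t = -1 := if_neg hside
    push Not at hside
    obtain ⟨v, hv, hv0⟩ := hside
    refine ⟨ψ v, Finset.mem_image_of_mem ψ hv, ?_⟩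
    rw [hψ.apply_im, hσ]
    linarith

lemma meets_image (hψ : IsNormalization P s t ψ) (hst : s ≠ t) (T : Finset ℂ) :
    Meets (T.image ψ) ↔ Intersects P s t T := by
  have hseg : ∀ z, z ∈ openSegment ℝ s t ↔ ∃ x : ℝ, 0 < x ∧ x < 1 ∧ ψ z = x := by
    intro z
    have hts : t - s ≠ 0 := sub_ne_zero.2 hst.symm
    rw [openSegment_eq_image']
    constructor
    · rintro ⟨x, hx, rfl⟩
      refine ⟨x, hx.1, hx.2, ?_⟩
      have : coord s t (s + x • (t - s)) = x := by
        rw [coord, add_sub_cancel_left, Complex.real_smul, mul_div_cancel_right₀ _ hts]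
      rw [hψ, this, reflect_ofReal]
    · rintro ⟨x, hx0, hx1, hx⟩
      refine ⟨x, ⟨hx0, hx1⟩, ?_⟩
      rw [hψ] at hx
      have h1 := congrArg (reflect (side P s t)) hx
      rw [reflect_reflect (side_sq P s t), reflect_ofReal, coord, div_eq_iff hts] at h1
      simp only [Complex.real_smul]
      rw [← h1]
      ring
  unfold Meets Intersects
  rw [image_hull]
  apply and_congr
  · constructor
    · rintro ⟨x, hx0, hx1, z, hz, hzx⟩
      exact ⟨z, hz, (hseg z).2 ⟨x, hx0, hx1, hzx⟩⟩
    · rintro ⟨z, hz, hzs⟩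
      obtain ⟨x, hx0, hx1, hx⟩ := (hseg z).1 hzs
      exact ⟨x, hx0, hx1, z, hz, hx⟩
  · simp only [Finset.mem_image, exists_exists_and_eq_and, hψ.apply_im, neg_mul, neg_lt_zero]

lemma reaches_image (hψ : IsNormalization P s t ψ) (T T' : Finset ℂ) :
    Reaches (T.image ψ) (T'.image ψ) ↔
      ∀ᶠ ε in 𝓝[>] (0 : ℝ), ReachesAsFar P s t T T' ε := by
  have him : ∀ (z : ℂ) (ε : ℝ), (ψ z).im = -ε ↔ (coord s t z).im = side P s t * ε := by
    intro z ε
    have h := side_sq P s t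
    rw [hψ.apply_im]
    constructor <;> intro h1
    · linear_combination (-(coord s t z).im) * h - side P s t * h1
    · linear_combination (-ε) * h - side P s t * h1
  unfold Reaches ReachesAsFar
  rw [image_hull, image_hull]
  simp only [Set.forall_mem_image, Set.exists_mem_image, him, hψ.apply_re]

lemma rightmost_image (hψ : IsNormalization P s t ψ) (hst : s ≠ t) {T : Finset ℂ} {p : ℂ} :
    Rightmost (𝒯.image (Finset.image ψ)) (ψ p) (T.image ψ) ↔ IsRightmost P 𝒯 s t p T := by
  have hinj : Function.Injective (Finset.image ψ) := Finset.image_injective ψ.injective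
  unfold Rightmost IsRightmost
  simp only [Finset.forall_mem_image, hψ.meets_image hst, hψ.reaches_image, hinj.mem_finset_image,
    ψ.injective.mem_finset_image]

lemma circumcircle_image (hψ : IsNormalization P s t ψ) {T : Finset ℂ} {c : ℂ} {ρ : ℝ} :
    IsCircumcircle (T.image ψ) (reflect (side P s t) c) ρ ↔ ∀ v ∈ T, dist (coord s t v) c = ρ := by
  unfold IsCircumcircle
  simp only [Finset.forall_mem_image]
  refine forall₂_congr fun v _ => ?_
  rw [hψ v, dist_reflect (side_sq P s t)]

end IsNormalization

namespace IsNormalization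

variable {P : Finset ℂ} {𝒯 : Finset (Finset ℂ)} {s t : ℂ} {ψ : ℂ ≃ᵃ[ℝ] ℂ}

lemma greatest_iff {σ : ℝ} (hσ : σ ^ 2 = 1) {c : ℂ} {ρ r : ℝ} :
    IsGreatest {x : ℝ | 0 ≤ x ∧ x ≤ 1 ∧ dist (x : ℂ) (reflect σ c) = ρ} r ↔
      IsGreatest {x : ℝ | 0 ≤ x ∧ x ≤ 1 ∧ dist (x : ℂ) c = ρ} r := by
  have : ∀ x : ℝ, dist (x : ℂ) (reflect σ c) = dist (x : ℂ) c := fun x => by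
    rw [← dist_reflect hσ (x : ℂ) c, reflect_ofReal]
  simp only [this]

lemma exists_last_intersection (hψ : IsNormalization P s t ψ) (hst : s ≠ t)
    (F : Frame (P.image ψ) (𝒯.image (Finset.image ψ))) {T : Finset ℂ} (hT : T ∈ 𝒯)
    (hM : Intersects P s t T) {c : ℂ} {ρ : ℝ} (hc : ∀ v ∈ T, dist (coord s t v) c = ρ) :
    0 < ρ ∧ ∃ r : ℝ, IsGreatest {x : ℝ | 0 ≤ x ∧ x ≤ 1 ∧ dist (x : ℂ) c = ρ} r ∧
      (r : ℂ) ≠ c - ρ := by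
  have hσ := side_sq P s t
  obtain ⟨l, r, hC, hcc, hρ0, hρ, hr⟩ := exists_chord F (Finset.mem_image_of_mem _ hT)
    ((hψ.meets_image hst T).2 hM) (hψ.circumcircle_image.2 hc)
  refine ⟨hρ0, r, (greatest_iff hσ).1 hr, fun h => ?_⟩
  have h1 := congrArg (reflect (side P s t)) h
  rw [reflect_sub, reflect_ofReal, reflect_ofReal, hcc] at h1
  have h2 := congrArg Complex.re h1
  simp only [Complex.ofReal_re, Complex.sub_re] at h2
  linarith [hC.le]

lemma exists_chewStep (hψ : IsNormalization P s t ψ) (hst : s ≠ t)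
    (F : Frame (P.image ψ) (𝒯.image (Finset.image ψ))) (hD : IsDelaunayTriangulation P 𝒯)
    {T : Finset ℂ} {p : ℂ} (hT : T ∈ 𝒯) (hM : Intersects P s t T) (hp : p ∈ T) :
    ∃ q, ChewStep P 𝒯 s t p q := by
  have hσ := side_sq P s t
  obtain ⟨S', hS'⟩ := exists_rightmost F.delaunay (Finset.mem_image_of_mem _ hT)
    ((hψ.meets_image hst T).2 hM) (Finset.mem_image_of_mem ψ hp)
  obtain ⟨S, hS, rfl⟩ := Finset.mem_image.1 hS'.1
  rw [hψ.rightmost_image hst] at hS'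
  obtain ⟨c', ρ, hc'⟩ := exists_circumcircle F.delaunay (Finset.mem_image_of_mem _ hS)
  obtain ⟨c, rfl⟩ : ∃ c, c' = reflect (side P s t) c :=
    ⟨reflect (side P s t) c', (reflect_reflect hσ c').symm⟩
  have hc := hψ.circumcircle_image.1 hc'
  obtain ⟨hρ0, r, hr, hrw⟩ := hψ.exists_last_intersection hst F hS hS'.2.1 hc
  have hw : dist (c - ρ) c = ρ := by simp [abs_of_pos hρ0]
  have hfirst : ∀ angle : ℂ → ℂ → ℂ → ℝ, ∃ q, IsFirstReached angle s t S c p q := by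
    intro angle
    have hne : (S.erase p).Nonempty := by
      rw [← Finset.card_pos, Finset.card_erase_of_mem hS'.2.2.1, hD.card_eq S hS]
      norm_num
    obtain ⟨q, hq, hmin⟩ := Finset.exists_min_image (S.erase p)
      (fun v => angle c (coord s t p) (coord s t v)) hne
    exact ⟨q, Finset.mem_of_mem_erase hq, Finset.ne_of_mem_erase hq,
      fun v hv hvp => hmin v (Finset.mem_erase.2 ⟨hvp, hv⟩)⟩
  by_cases hA : cwAngle c (c - ρ) (coord s t p) ≤ cwAngle c (c - ρ) r
  · obtain ⟨q, hq⟩ := hfirst cwAngle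
    exact ⟨q, S, hS', c, ρ, r, hc, hr, Or.inl ⟨hA, hq⟩⟩
  · obtain ⟨q, hq⟩ := hfirst ccwAngle
    refine ⟨q, S, hS', c, ρ, r, hc, hr, Or.inr ⟨hA, ?_, hq⟩⟩
    rw [cwAngle_le_iff hw (hc p hS'.2.2.1) hr.1.2.2 hρ0 hrw] at hA
    rw [ccwAngle_le_iff hw (hc p hS'.2.2.1) hr.1.2.2 hρ0 hrw]
    exact (not_le.1 hA).le

lemma weakStep (hψ : IsNormalization P s t ψ) (hst : s ≠ t)
    (F : Frame (P.image ψ) (𝒯.image (Finset.image ψ))) {p q : ℂ} (h : ChewStep P 𝒯 s t p q) :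
    WeakStep (𝒯.image (Finset.image ψ)) (ψ p) (ψ q) := by
  have hσ := side_sq P s t
  obtain ⟨T, hT, c, ρ, r, hc, hr, h⟩ := h
  obtain ⟨hρ0, r', hr', hrw⟩ := hψ.exists_last_intersection hst F hT.1 hT.2.1 hc
  obtain rfl := hr.unique hr'
  have hw : dist (c - ρ) c = ρ := by simp [abs_of_pos hρ0]
  have hinj : Function.Injective (coord s t) := fun a b hab => by
    have h1 := dist_coord s t a b
    rw [hab, dist_self, eq_comm, mul_eq_zero] at h1
    exact dist_eq_zero.1 (h1.resolve_left (inv_pos.2 (dist_pos.2 hst)).ne')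
  have hpc := hc p hT.2.2.1
  have hcross : ∀ a b d : ℂ, cross (reflect (side P s t) b - reflect (side P s t) a)
      (reflect (side P s t) d - reflect (side P s t) a) = -side P s t * cross (b - a) (d - a) :=
    fun a b d => by rw [← reflect_sub, ← reflect_sub, cross_reflect]
  refine ⟨T.image ψ, (hψ.rightmost_image hst).2 hT, reflect (side P s t) c, ρ, r,
    hψ.circumcircle_image.2 hc, (greatest_iff hσ).2 hr, ?_⟩
  have hleft : cross (ψ p - (reflect (side P s t) c - ρ)) (r - (reflect (side P s t) c - ρ)) =
      -side P s t * cross (coord s t p - (c - ρ)) (r - (c - ρ)) := by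
    have := hcross (c - ρ) (coord s t p) r
    rwa [reflect_sub c, reflect_ofReal, reflect_ofReal, ← hψ p] at this
  rw [hleft]
  simp only [Finset.forall_mem_image, ψ.injective.mem_finset_image, ψ.injective.ne_iff]
  have hsgn : side P s t = 1 ∨ side P s t = -1 := by
    unfold side; split_ifs <;> simp
  have key : (cross (coord s t p - (c - ρ)) (r - (c - ρ)) ≤ 0 ∧ ∀ v ∈ T, v ≠ p →
        cross (coord s t q - coord s t p) (coord s t v - coord s t p) ≤ 0) ∨
      (0 ≤ cross (coord s t p - (c - ρ)) (r - (c - ρ)) ∧ ∀ v ∈ T, v ≠ p →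
        0 ≤ cross (coord s t q - coord s t p) (coord s t v - coord s t p)) := by
    rcases h with ⟨hA, hq⟩ | ⟨-, hA, hq⟩
    · exact Or.inl ⟨(cwAngle_le_iff hw hpc hr.1.2.2 hρ0 hrw).1 hA, fun v hv hvp =>
        (cwAngle_le_iff hpc (hc q hq.1) (hc v hv) hρ0 (hinj.ne hvp)).1 (hq.2.2 v hv hvp)⟩
    · exact Or.inr ⟨(ccwAngle_le_iff hw hpc hr.1.2.2 hρ0 hrw).1 hA, fun v hv hvp =>
        (ccwAngle_le_iff hpc (hc q hq.1) (hc v hv) hρ0 (hinj.ne hvp)).1 (hq.2.2 v hv hvp)⟩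
  refine ⟨by rcases h with h | h; exacts [h.2.1, h.2.2.1],
    by rcases h with h | h; exacts [h.2.2.1, h.2.2.2.1], ?_⟩
  simp only [hψ p, hψ q]
  have hv : ∀ v, cross (reflect (side P s t) (coord s t q) - reflect (side P s t) (coord s t p))
      (ψ v - reflect (side P s t) (coord s t p)) =
      -side P s t * cross (coord s t q - coord s t p) (coord s t v - coord s t p) := fun v => by
    rw [hψ v, hcross]
  simp only [hv]
  -- A reflection exchanges the two directions. The tie at the leftmost point is not symmetric,
  -- which is why the weak step allows both directions there.
  rcases hsgn with h1 | h1
  · rw [h1]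
    simp only [neg_mul, one_mul, neg_nonpos, neg_nonneg]
    exact key.symm
  · rw [h1]
    simpa only [neg_neg, one_mul] using key

end IsNormalization

/-! ### Locality -/

/-- No vertex is adjacent to `p` in the interior of the angle at `p` of a triangle. -/
lemma not_mem_sector {P : Finset ℂ} {𝒯 : Finset (Finset ℂ)} (hD : IsDelaunayTriangulation P 𝒯)
    {p u v x : ℂ} (hT : {p, u, v} ∈ 𝒯) (hc : 0 < cross (u - p) (v - p))
    (hx : (edgeGraph 𝒯).Adj p x) :
    ¬ (0 < cross (u - p) (x - p) ∧ 0 < cross (x - p) (v - p)) := by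
  rintro ⟨h1, h2⟩
  obtain ⟨hpx, S, hS, hpS, hxS⟩ := hx
  have hSne : {p, u, v} ≠ S := by
    rintro rfl
    simp only [Finset.mem_insert, Finset.mem_singleton] at hxS
    rcases hxS with rfl | rfl | rfl
    · exact hpx rfl
    · rw [cross_self] at h1; exact h1.ne' rfl
    · rw [cross_self] at h2; exact h2.ne' rfl
  obtain ⟨α, β, γ, hαβ, hle, hge⟩ := exists_separation hD hT hS hSne
  have hp1 := hle p (vertex_mem_hull (by simp))
  have hp2 := hge p (vertex_mem_hull hpS)
  have hu := hle u (vertex_mem_hull (by simp))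
  have hv := hle v (vertex_mem_hull (by simp))
  have hx := hge x (vertex_mem_hull hxS)
  set lu := α * (u.re - p.re) + β * (u.im - p.im) with hlu
  set lv := α * (v.re - p.re) + β * (v.im - p.im) with hlv
  have hlu0 : lu ≤ 0 := by linarith
  have hlv0 : lv ≤ 0 := by linarith
  -- The separating line passes through `p`, and `x - p` is a positive combination of `u - p` and `v
  -- - p`. So the linear form must vanish on both, hence identically.
  have e : cross (u - p) (v - p) * (α * (x.re - p.re) + β * (x.im - p.im)) =
      cross (x - p) (v - p) * lu + cross (u - p) (x - p) * lv := by
    simp only [cross, Complex.sub_re, Complex.sub_im, hlu, hlv]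
    ring
  have h3 := mul_nonneg hc.le (by linarith : 0 ≤ α * (x.re - p.re) + β * (x.im - p.im))
  have h4 := mul_nonpos_of_nonneg_of_nonpos h2.le hlu0
  have h5 := mul_nonpos_of_nonneg_of_nonpos h1.le hlv0
  have hlu1 : lu = 0 := (mul_eq_zero.1 (by linarith : cross (x - p) (v - p) * lu = 0)).resolve_left
    h2.ne'
  have hlv1 : lv = 0 := (mul_eq_zero.1 (by linarith : cross (u - p) (x - p) * lv = 0)).resolve_left
    h1.ne'
  have hα : cross (u - p) (v - p) * α = 0 := by
    simp only [cross, Complex.sub_re, Complex.sub_im]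
    linear_combination (v.im - p.im) * (hlu.symm.trans hlu1) -
      (u.im - p.im) * (hlv.symm.trans hlv1)
  have hβ : cross (u - p) (v - p) * β = 0 := by
    simp only [cross, Complex.sub_re, Complex.sub_im]
    linear_combination (u.re - p.re) * (hlv.symm.trans hlv1) -
      (v.re - p.re) * (hlu.symm.trans hlu1)
  exact hαβ ⟨(mul_eq_zero.1 hα).resolve_left hc.ne', (mul_eq_zero.1 hβ).resolve_left hc.ne'⟩

/-- Two sectors share the inner direction `z`. If their right boundary rays differ, one of these
rays is interior to the other sector; the Plücker relation in `e` makes this precise. -/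
lemma cross_eq_zero_of_sectors {a b a' b' z : ℂ} (hab : 0 < cross a b) (hab' : 0 < cross a' b')
    (haz : 0 < cross a z) (hzb : 0 < cross z b) (haz' : 0 < cross a' z) (hzb' : 0 < cross z b')
    (h : ¬ (0 < cross a a' ∧ 0 < cross a' b)) (h' : ¬ (0 < cross a' a ∧ 0 < cross a b')) :
    cross a a' = 0 := by
  have key : ∀ a b a' : ℂ, 0 < cross a b → 0 < cross a z → 0 < cross z b → 0 < cross a' z →
      0 < cross a a' → 0 < cross a' b := by
    intro a b a' h1 h2 h3 h4 h5
    have e : cross a z * cross a' b = cross a' z * cross a b + cross a a' * cross z b := by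
      simp only [cross]
      ring
    refine pos_of_mul_pos_right (a := cross a z) ?_ h2.le
    rw [e]
    exact add_pos (mul_pos h4 h1) (mul_pos h5 h3)
  rcases lt_trichotomy (cross a a') 0 with h0 | h0 | h0
  · rw [cross_swap] at h0
    have h1 : 0 < cross a' a := by linarith
    exact absurd ⟨h1, key a' b' a hab' haz' hzb' haz h1⟩ h'
  · exact h0
  · exact absurd ⟨h0, key a b a' hab haz hzb haz' h0⟩ h

/-- For `0 < τ < 1` the point would be inside a chord of the empty circle. Applied in both
triangulations, this identifies neighbours on the same ray. -/
lemma one_le_of_mem_ray {P : Finset ℂ} {𝒯 : Finset (Finset ℂ)} (hD : IsDelaunayTriangulation P 𝒯)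
    {T : Finset ℂ} (hT : T ∈ 𝒯) {p u x : ℂ} (hp : p ∈ T) (hu : u ∈ T) (hup : u - p ≠ 0)
    (hx : x ∈ P) {τ : ℝ} (hτ : 0 < τ) (h : x - p = τ * (u - p)) : 1 ≤ τ := by
  obtain ⟨c, ρ, hc⟩ := exists_circumcircle hD hT
  have h1 := hD.empty_circle T hT c ρ hc x hx
  have h2 := hc u hu
  rw [← hc p hp] at h1 h2
  rw [dist_eq_sqrt, dist_eq_sqrt] at h1 h2
  rw [Real.sqrt_le_sqrt_iff (by positivity)] at h1
  rw [Real.sqrt_inj (by positivity) (by positivity)] at h2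
  have hre : x.re = p.re + τ * (u.re - p.re) := by
    have := congrArg Complex.re h
    simp at this
    linarith
  have him : x.im = p.im + τ * (u.im - p.im) := by
    have := congrArg Complex.im h
    simp at this
    linarith
  rw [hre, him] at h1
  have h3 := sq_add_sq_pos hup
  simp only [Complex.sub_re, Complex.sub_im] at h3
  by_contra hcon
  push Not at hcon
  nlinarith [mul_pos (mul_pos hτ (sub_pos.2 hcon)) h3]

lemma eq_of_cross_eq_zero {P P' : Finset ℂ} {𝒯 𝒯' : Finset (Finset ℂ)}
    (hD : IsDelaunayTriangulation P 𝒯) (hD' : IsDelaunayTriangulation P' 𝒯') {T T' : Finset ℂ}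
    (hT : T ∈ 𝒯) (hT' : T' ∈ 𝒯') {p u u' z : ℂ} (hp : p ∈ T) (hu : u ∈ T) (hp' : p ∈ T')
    (hu' : u' ∈ T') (huP : u ∈ P') (hu'P : u' ∈ P) (h : cross (u - p) (u' - p) = 0)
    (hz : 0 < cross (u - p) z * cross (u' - p) z) : u' = u := by
  have hup : u - p ≠ 0 := fun h0 => by simp [h0, cross] at hz
  have hup' : u' - p ≠ 0 := fun h0 => by simp [h0, cross] at hz
  obtain ⟨τ, hτ⟩ := eq_mul_of_cross_eq_zero hup h
  have h1 : cross (u' - p) z = τ * cross (u - p) z := by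
    rw [hτ]
    simp only [cross, Complex.mul_re, Complex.mul_im, Complex.ofReal_re, Complex.ofReal_im]
    ring
  have hτ0 : 0 < τ := by
    rw [h1] at hz
    by_contra hcon
    push Not at hcon
    nlinarith [sq_nonneg (cross (u - p) z)]
  have h2 := one_le_of_mem_ray hD hT hp hu hup hu'P hτ0 hτ
  have h3 := one_le_of_mem_ray hD' hT' hp' hu' hup' huP (inv_pos.2 hτ0) (by
    rw [hτ, Complex.ofReal_inv, inv_mul_cancel_left₀ (Complex.ofReal_ne_zero.2 hτ0.ne')])
  have h4 : τ = 1 := le_antisymm (by rwa [one_le_inv₀ hτ0] at h3) h2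
  rw [h4, Complex.ofReal_one, one_mul] at hτ
  exact sub_left_injective hτ

/-- The triangles at `p` are determined by the neighbours of `p`. -/
lemma mem_of_neighborSet_eq {P P' : Finset ℂ} {𝒯 𝒯' : Finset (Finset ℂ)}
    (hD : IsDelaunayTriangulation P 𝒯) (hD' : IsDelaunayTriangulation P' 𝒯') {T : Finset ℂ}
    {p : ℂ} (hN : (edgeGraph 𝒯).neighborSet p = (edgeGraph 𝒯').neighborSet p) (hT : T ∈ 𝒯)
    (hp : p ∈ T) : T ∈ 𝒯' := by
  have hadj : ∀ x, (edgeGraph 𝒯).Adj p x ↔ (edgeGraph 𝒯').Adj p x := fun x =>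
    Set.ext_iff.1 hN x
  have hmem : ∀ {P : Finset ℂ} {𝒯 : Finset (Finset ℂ)}, IsDelaunayTriangulation P 𝒯 → ∀ {x : ℂ},
      (edgeGraph 𝒯).Adj p x → p ∈ P ∧ x ∈ P := fun hD _ hx => by
    obtain ⟨-, S, hS, h1, h2⟩ := hx
    exact ⟨hD.subset S hS h1, hD.subset S hS h2⟩
  obtain ⟨u, v, rfl, hc⟩ := triangle_vertices_of_mem hD hT hp
  have hup : p ≠ u := by rintro rfl; simp [cross] at hc
  have hvp : p ≠ v := by rintro rfl; simp [cross] at hc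
  have hAu : (edgeGraph 𝒯).Adj p u := ⟨hup, _, hT, by simp, by simp⟩
  have hAv : (edgeGraph 𝒯).Adj p v := ⟨hvp, _, hT, by simp, by simp⟩
  obtain ⟨hpP', huP'⟩ := hmem hD' ((hadj u).1 hAu)
  obtain ⟨-, hvP'⟩ := hmem hD' ((hadj v).1 hAv)
  -- A direction inside the angle of `T` at `p`. Since `p`, `u`, `v` belong to `P'`, some triangle
  -- of `𝒯'` with vertex `p` contains points in this direction arbitrarily close to `p`.
  set z : ℂ := (u - p) + (v - p) with hz
  have hlim : Tendsto (fun ε : ℝ => p + (ε : ℂ) * z) (𝓝[>] (0 : ℝ)) (𝓝 p) := by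
    have : Continuous fun ε : ℝ => p + (ε : ℂ) * z := by fun_prop
    have h1 := (this.tendsto 0).mono_left (nhdsWithin_le_nhds (s := Set.Ioi 0))
    simpa using h1
  have hev : ∀ᶠ ε : ℝ in 𝓝[>] (0 : ℝ), p + (ε : ℂ) * z ∈ convexHull ℝ (P' : Set ℂ) := by
    filter_upwards [Ioo_mem_nhdsGT (show (0 : ℝ) < 1 / 2 by norm_num)] with ε hε
    have h1 := segment_point_mem_hull (vertex_mem_hull huP') (vertex_mem_hull hvP')
      (s := 1 / 2) (by norm_num) (by norm_num)
    have h2 := segment_point_mem_hull (vertex_mem_hull hpP') h1 (s := 2 * ε)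
      (by linarith [hε.1]) (by linarith [hε.2])
    convert h2 using 1
    rw [hz]
    push_cast
    ring
  obtain ⟨T', hT', hpT', hfreq⟩ := exists_frequently_mem hD' hev hlim
  have hp' := vertex_of_mem_hull hD' hT' hpP' hpT'
  obtain ⟨ε, hε, hε0⟩ := (hfreq.and_eventually self_mem_nhdsWithin).exists
  replace hε0 : 0 < ε := hε0
  obtain ⟨u', v', rfl, hc'⟩ := triangle_vertices_of_mem hD' hT' hp'
  have hup' : p ≠ u' := by rintro rfl; simp [cross] at hc'
  have hvp' : p ≠ v' := by rintro rfl; simp [cross] at hc'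
  have hAu' : (edgeGraph 𝒯').Adj p u' := ⟨hup', _, hT', by simp, by simp⟩
  have hAv' : (edgeGraph 𝒯').Adj p v' := ⟨hvp', _, hT', by simp, by simp⟩
  have hu'P := (hmem hD ((hadj u').2 hAu')).2
  have hv'P := (hmem hD ((hadj v').2 hAv')).2
  have haz : 0 < cross (u - p) z := by
    convert hc using 1
    simp only [hz, cross, Complex.add_re, Complex.add_im, Complex.sub_re, Complex.sub_im]
    ring
  have hzb : 0 < cross z (v - p) := by
    convert hc using 1
    simp only [hz, cross, Complex.add_re, Complex.add_im, Complex.sub_re, Complex.sub_im]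
    ring
  have haz0 : 0 ≤ cross (u' - p) z := by
    have h1 : 0 ≤ cross (u' - p) (p + ε * z - p) := cross_nonneg_of_mem_hull (z := v') hc' (by
      convert hε using 3
      ext x
      simp only [Finset.mem_insert, Finset.mem_singleton]
      tauto)
    have h2 : cross (u' - p) (p + ε * z - p) = ε * cross (u' - p) z := by
      simp [cross]; ring
    rw [h2] at h1
    exact nonneg_of_mul_nonneg_right h1 hε0
  have hzb0 : 0 ≤ cross z (v' - p) := by
    have h1 := affine_nonneg_of_mem_hull (T := {p, u', v'}) (α := v'.im - p.im)
      (β := -(v'.re - p.re)) (γ := (v'.re - p.re) * p.im - (v'.im - p.im) * p.re) (fun w hw => by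
        simp only [Finset.mem_insert, Finset.mem_singleton] at hw
        simp only [cross, Complex.sub_re, Complex.sub_im] at hc'
        rcases hw with rfl | rfl | rfl <;> nlinarith) hε
    have h2 : (v'.im - p.im) * (p + ε * z).re + -(v'.re - p.re) * (p + ε * z).im +
        ((v'.re - p.re) * p.im - (v'.im - p.im) * p.re) = ε * cross z (v' - p) := by
      simp [cross]; ring
    rw [h2] at h1
    exact nonneg_of_mul_nonneg_right h1 hε0
  have hsec := fun x (hx : (edgeGraph 𝒯).Adj p x) => not_mem_sector hD hT hc hx
  have hsec' := fun x (hx : (edgeGraph 𝒯').Adj p x) => not_mem_sector hD' hT' hc' hx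
  -- The direction `z` is not that of a neighbour, so it is also strictly inside the angle of the
  -- triangle of `𝒯'`.
  have hpar : ∀ x, (edgeGraph 𝒯).Adj p x → ∀ τ : ℝ, z = τ * (x - p) → 0 ≤ τ → False := by
    intro x hx τ hτ hτ0
    apply hsec x hx
    have h1 : cross (u - p) z = τ * cross (u - p) (x - p) := by
      rw [hτ]; simp [cross]; ring
    have h2 : cross z (v - p) = τ * cross (x - p) (v - p) := by
      rw [hτ]; simp [cross]; ring
    rw [h1] at haz
    rw [h2] at hzb
    exact ⟨pos_of_mul_pos_right haz hτ0, pos_of_mul_pos_right hzb hτ0⟩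
  have haz' : 0 < cross (u' - p) z := by
    refine haz0.lt_of_ne' fun h0 => ?_
    obtain ⟨τ, hτ⟩ := eq_mul_of_cross_eq_zero (sub_ne_zero.2 hup'.symm) h0
    refine hpar u' ((hadj u').2 hAu') τ hτ ?_
    have : cross z (v' - p) = τ * cross (u' - p) (v' - p) := by
      rw [hτ]; simp [cross]; ring
    rw [this] at hzb0
    exact nonneg_of_mul_nonneg_left hzb0 hc'
  have hzb' : 0 < cross z (v' - p) := by
    refine hzb0.lt_of_ne' fun h0 => ?_
    rw [cross_swap, neg_eq_zero] at h0
    obtain ⟨τ, hτ⟩ := eq_mul_of_cross_eq_zero (sub_ne_zero.2 hvp'.symm) h0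
    refine hpar v' ((hadj v').2 hAv') τ hτ ?_
    have : cross (u' - p) z = τ * cross (u' - p) (v' - p) := by
      rw [hτ]; simp [cross]; ring
    rw [this] at haz0
    exact nonneg_of_mul_nonneg_left haz0 hc'
  have hu : u' = u := by
    refine eq_of_cross_eq_zero hD hD' hT hT' (by simp) (by simp) (by simp) (by simp) huP' hu'P
      (cross_eq_zero_of_sectors hc hc' haz hzb haz' hzb' (hsec u' ((hadj u').2 hAu'))
        (hsec' u ((hadj u).1 hAu))) (mul_pos haz haz')
  have hv : v' = v := by
    -- The left boundary rays are compared by conjugation, which exchanges left and right.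
    have h0 := cross_eq_zero_of_sectors (a := starRingEnd ℂ (v - p)) (b := starRingEnd ℂ (u - p))
      (a' := starRingEnd ℂ (v' - p)) (b' := starRingEnd ℂ (u' - p)) (z := starRingEnd ℂ z)
    have hcj : ∀ a b : ℂ, cross (starRingEnd ℂ a) (starRingEnd ℂ b) = cross b a := fun a b => by
      rw [cross_conj, ← cross_swap]
    simp only [hcj] at h0
    refine eq_of_cross_eq_zero hD hD' hT hT' (p := p) (u := v) (u' := v') (by simp)
      (by simp) (by simp) (by simp) hvP' hv'P (z := z) ?_ ?_
    · rw [cross_swap, neg_eq_zero]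
      exact h0 hc hc' hzb haz hzb' haz'
        (fun h => hsec v' ((hadj v').2 hAv') h.symm) (fun h => hsec' v ((hadj v).1 hAv) h.symm)
    · rw [cross_swap, cross_swap (v' - p)]
      have := mul_pos hzb hzb'
      linarith
  rw [← hu, ← hv]
  exact hT'

lemma side_eq_one_or (P : Finset ℂ) (s t : ℂ) : side P s t = 1 ∨ side P s t = -1 := by
  unfold side; split_ifs <;> simp

/-- The side on which vertices on the segment are considered to lie can be recognized locally. -/
lemma side_eq_neg_one_iff {P : Finset ℂ} {𝒯 : Finset (Finset ℂ)} {s t p : ℂ} {T : Finset ℂ}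
    (hD : IsDelaunayTriangulation P 𝒯) (hT : T ∈ 𝒯) (hM : Intersects P s t T) (hp : p ∈ T) :
    side P s t = -1 ↔ (coord s t p).im < 0 ∨
      ∃ x ∈ (edgeGraph 𝒯).neighborSet p, (coord s t x).im < 0 := by
  constructor
  · intro h
    obtain ⟨v, hv, hv0⟩ := hM.2
    rw [h] at hv0
    have hv1 : (coord s t v).im < 0 := by linarith
    rcases eq_or_ne p v with rfl | hne
    · exact Or.inl hv1
    · exact Or.inr ⟨v, ⟨hne, T, hT, hp, hv⟩, hv1⟩
  · intro h
    have : ∃ x ∈ P, (coord s t x).im < 0 := by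
      rcases h with h | ⟨x, ⟨-, S, hS, -, hx⟩, h⟩
      · exact ⟨p, hD.subset T hT hp, h⟩
      · exact ⟨x, hD.subset S hS hx, h⟩
    obtain ⟨x, hx, h⟩ := this
    exact if_neg fun hall => absurd (hall x hx) (not_le.2 h)

lemma circumcenter_unique {P : Finset ℂ} {𝒯 : Finset (Finset ℂ)} {T : Finset ℂ}
    (hD : IsDelaunayTriangulation P 𝒯) (hT : T ∈ 𝒯) {c c' : ℂ} {ρ ρ' : ℝ}
    (hc : IsCircumcircle T c ρ) (hc' : IsCircumcircle T c' ρ') : c = c' := by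
  obtain ⟨a, b, d, rfl, h⟩ := triangle_vertices hD hT
  have sq : ∀ {x y c : ℂ} {ρ : ℝ}, dist x c = ρ → dist y c = ρ →
      (x.re - c.re) ^ 2 + (x.im - c.im) ^ 2 = (y.re - c.re) ^ 2 + (y.im - c.im) ^ 2 := by
    intro x y c ρ h1 h2
    rw [← h2, dist_eq_sqrt, dist_eq_sqrt, Real.sqrt_inj (by positivity) (by positivity)] at h1
    exact h1
  have h1 := sq (hc b (by simp)) (hc a (by simp))
  have h2 := sq (hc d (by simp)) (hc a (by simp))
  have h3 := sq (hc' b (by simp)) (hc' a (by simp))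
  have h4 := sq (hc' d (by simp)) (hc' a (by simp))
  simp only [cross, Complex.sub_re, Complex.sub_im] at h
  apply Complex.ext
  · apply mul_left_cancel₀ h
    linear_combination (-(1 / 2) * (d.im - a.im)) * (h1 - h3) + (1 / 2) * (b.im - a.im) * (h2 - h4)
  · apply mul_left_cancel₀ h
    linear_combination (-(1 / 2) * (b.re - a.re)) * (h2 - h4) + (1 / 2) * (d.re - a.re) * (h1 - h3)

lemma coord_circumcenter_unique {P : Finset ℂ} {𝒯 : Finset (Finset ℂ)} {s t : ℂ} {T : Finset ℂ}
    (hD : IsDelaunayTriangulation P 𝒯) (hst : s ≠ t) (hT : T ∈ 𝒯) {c c' : ℂ} {ρ ρ' : ℝ}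
    (hc : ∀ v ∈ T, dist (coord s t v) c = ρ) (hc' : ∀ v ∈ T, dist (coord s t v) c' = ρ') :
    c = c' := by
  have hts : t - s ≠ 0 := sub_ne_zero.2 hst.symm
  have hd : 0 < dist s t := dist_pos.2 hst
  have lift : ∀ {c : ℂ} {ρ : ℝ}, (∀ v ∈ T, dist (coord s t v) c = ρ) →
      IsCircumcircle T (s + c * (t - s)) (dist s t * ρ) := by
    intro c ρ hc v hv
    have h1 : coord s t (s + c * (t - s)) = c := by
      rw [coord, add_sub_cancel_left, mul_div_cancel_right₀ _ hts]
    rw [← hc v hv, ← h1, dist_coord, h1]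
    field_simp
  have := circumcenter_unique hD hT (lift hc) (lift hc')
  exact mul_right_cancel₀ hts (add_left_cancel this)

/-- The forwarding decision depends only on `s`, `t`, the current vertex and its neighbours. -/
theorem ChewStep.local_unique {P P' : Finset ℂ} {𝒯 𝒯' : Finset (Finset ℂ)} {s t p q q' : ℂ}
    (hD : IsDelaunayTriangulation P 𝒯) (hD' : IsDelaunayTriangulation P' 𝒯') (hst : s ≠ t)
    (hs : s ∈ P) (ht : t ∈ P)
    (hN : (edgeGraph 𝒯).neighborSet p = (edgeGraph 𝒯').neighborSet p)
    (h : ChewStep P 𝒯 s t p q) (h' : ChewStep P' 𝒯' s t p q') : q = q' := by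
  obtain ⟨T, hT, c, ρ, r, hc, hr, h⟩ := h
  obtain ⟨T', hT', c', ρ', r', hc', hr', h'⟩ := h'
  have hside : side P s t = side P' s t := by
    have h1 := side_eq_neg_one_iff hD hT.1 hT.2.1 hT.2.2.1
    have h2 := side_eq_neg_one_iff hD' hT'.1 hT'.2.1 hT'.2.2.1
    rw [hN] at h1
    have h3 := h1.trans h2.symm
    rcases side_eq_one_or P s t with h4 | h4 <;> rcases side_eq_one_or P' s t with h5 | h5
    · rw [h4, h5]
    · exact (h3.2 h5).trans h5.symm
    · exact h4.trans (h3.1 h4).symm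
    · rw [h4, h5]
  have hinter : ∀ S, Intersects P s t S ↔ Intersects P' s t S := fun S => by
    unfold Intersects; rw [hside]
  have hreach : ReachesAsFar P s t = ReachesAsFar P' s t := by
    funext S S' ε
    unfold ReachesAsFar
    rw [hside]
  have hT'' : IsRightmost P 𝒯 s t p T' :=
    ⟨mem_of_neighborSet_eq hD' hD hN.symm hT'.1 hT'.2.2.1, (hinter _).2 hT'.2.1, hT'.2.2.1,
      fun S hS hM hp => by
        rw [hreach]
        exact hT'.2.2.2 S (mem_of_neighborSet_eq hD hD' hN hS hp) ((hinter _).1 hM) hp⟩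
  obtain ⟨ψ, hψ⟩ : ∃ ψ, IsNormalization P s t ψ := exists_normalization hst (side_sq P s t)
  have F := hψ.frame hst hD hs ht
  obtain rfl : T' = T := Finset.image_injective ψ.injective
    (Rightmost.unique F.delaunay ((hψ.rightmost_image hst).2 hT) ((hψ.rightmost_image hst).2 hT''))
  obtain rfl := coord_circumcenter_unique hD hst hT.1 hc hc'
  obtain rfl : ρ = ρ' := by rw [← hc p hT.2.2.1, hc' p hT.2.2.1]
  obtain rfl := hr.unique hr'
  have hinj : Function.Injective (coord s t) := fun a b hab => by
    rw [coord, coord, div_left_inj' (sub_ne_zero.2 hst.symm)] at hab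
    exact sub_left_injective hab
  have hp := hc p hT.2.2.1
  rcases h with ⟨hA, hq⟩ | ⟨hA, -, hq⟩ <;> rcases h' with ⟨hA', hq'⟩ | ⟨hA', -, hq'⟩
  · exact hinj (eq_of_cwAngle_eq hp (hc q hq.1) (hc q' hq'.1)
      (le_antisymm (hq.2.2 q' hq'.1 hq'.2.1) (hq'.2.2 q hq.1 hq.2.1)))
  · exact absurd hA hA'
  · exact absurd hA' hA
  · exact hinj (eq_of_ccwAngle_eq hp (hc q hq.1) (hc q' hq'.1)
      (le_antisymm (hq.2.2 q' hq'.1 hq'.2.1) (hq'.2.2 q hq.1 hq.2.1)))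

/-! ### The algorithm -/

open Classical in
/-- Chew's algorithm. -/
def chew : LocalRoutingAlgorithm := fun s t p N =>
  if h : ∃ (q : ℂ) (P : Finset ℂ) (𝒯 : Finset (Finset ℂ)), IsDelaunayTriangulation P 𝒯 ∧ s ∈ P ∧
    t ∈ P ∧ (edgeGraph 𝒯).neighborSet p = N ∧ ChewStep P 𝒯 s t p q then h.choose else p

section

variable {P : Finset ℂ} {𝒯 : Finset (Finset ℂ)} {s t : ℂ}

/-- The algorithm simulates the step in an arbitrary triangulation that is compatible with the local
view. By `ChewStep.local_unique` the result does not depend on this choice. -/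
lemma chew_eq (hD : IsDelaunayTriangulation P 𝒯) (hst : s ≠ t) (hs : s ∈ P) (ht : t ∈ P) {p q : ℂ}
    (h : ChewStep P 𝒯 s t p q) : chew s t p ((edgeGraph 𝒯).neighborSet p) = q := by
  have hex : ∃ (q : ℂ) (P' : Finset ℂ) (𝒯' : Finset (Finset ℂ)), IsDelaunayTriangulation P' 𝒯' ∧
      s ∈ P' ∧ t ∈ P' ∧ (edgeGraph 𝒯').neighborSet p = (edgeGraph 𝒯).neighborSet p ∧
      ChewStep P' 𝒯' s t p q := ⟨q, P, 𝒯, hD, hs, ht, rfl, h⟩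
  unfold chew
  rw [dif_pos hex]
  obtain ⟨P', 𝒯', hD', hs', ht', hN, h'⟩ := hex.choose_spec
  exact h'.local_unique hD' hD hst hs' ht' hN h

lemma ChewStep.adj {p q : ℂ} (h : ChewStep P 𝒯 s t p q) : (edgeGraph 𝒯).Adj p q := by
  obtain ⟨T, hT, c, ρ, r, -, -, h⟩ := h
  rcases h with ⟨-, hq⟩ | ⟨-, -, hq⟩ <;>
  exact ⟨hq.2.1.symm, T, hT.1, hT.2.2.1, hq.1⟩

lemma routeLength_succ (A : LocalRoutingAlgorithm) (G : SimpleGraph ℂ) (s t : ℂ) (i : ℕ) :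
    routeLength A G s t (i + 1) =
      routeLength A G s t i + dist (route A G s t i) (route A G s t (i + 1)) :=
  Finset.sum_range_succ _ _

variable {ψ : ℂ ≃ᵃ[ℝ] ℂ}

lemma exists_chewStep_of_bound (hψ : IsNormalization P s t ψ) (hst : s ≠ t)
    (hD : IsDelaunayTriangulation P 𝒯) (hs : s ∈ P) (ht : t ∈ P) {p : ℂ} {len : ℝ}
    (hB : RouteBound (P.image ψ) (𝒯.image (Finset.image ψ)) (ψ p) len) :
    ∃ q, ChewStep P 𝒯 s t p q := by
  obtain ⟨T', hT', hM, hp, -⟩ := hB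
  obtain ⟨T, hT, rfl⟩ := Finset.mem_image.1 hT'
  exact hψ.exists_chewStep hst (hψ.frame hst hD hs ht) hD hT ((hψ.meets_image hst T).1 hM)
    (ψ.injective.mem_finset_image.1 hp)

/-- One step of the route, in terms of the bound on its length. -/
lemma route_step (hψ : IsNormalization P s t ψ) (hst : s ≠ t)
    (hD : IsDelaunayTriangulation P 𝒯) (hs : s ∈ P) (ht : t ∈ P) {i : ℕ}
    (hne : route chew (edgeGraph 𝒯) s t i ≠ t)
    (hB : RouteBound (P.image ψ) (𝒯.image (Finset.image ψ)) (ψ (route chew (edgeGraph 𝒯) s t i))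
      ((dist s t)⁻¹ * routeLength chew (edgeGraph 𝒯) s t i)) :
    ChewStep P 𝒯 s t (route chew (edgeGraph 𝒯) s t i) (route chew (edgeGraph 𝒯) s t (i + 1)) ∧
      (dist s t)⁻¹ * routeLength chew (edgeGraph 𝒯) s t (i + 1) ≤ slope + crossCost ∧
      (route chew (edgeGraph 𝒯) s t (i + 1) ≠ t →
        RouteBound (P.image ψ) (𝒯.image (Finset.image ψ)) (ψ (route chew (edgeGraph 𝒯) s t (i + 1)))
          ((dist s t)⁻¹ * routeLength chew (edgeGraph 𝒯) s t (i + 1))) := by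
  obtain ⟨q, hq⟩ := exists_chewStep_of_bound hψ hst hD hs ht hB
  obtain rfl : route chew (edgeGraph 𝒯) s t (i + 1) = q := chew_eq hD hst hs ht hq
  refine ⟨hq, ?_⟩
  have F := hψ.frame hst hD hs ht
  have h1 := hB.step F (fun h => hne (ψ.injective (h.trans (hψ.apply_target hst).symm)))
    (hψ.weakStep hst F hq)
  rw [hψ.dist_apply, ← mul_add, ← routeLength_succ] at h1
  rcases h1 with ⟨h2, h3⟩ | h2
  · exact ⟨h3, fun h4 => absurd (ψ.injective (h2.trans (hψ.apply_target hst).symm)) h4⟩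
  · exact ⟨h2.le, fun _ => h2⟩

lemma route_bound (hψ : IsNormalization P s t ψ) (hst : s ≠ t)
    (hD : IsDelaunayTriangulation P 𝒯) (hs : s ∈ P) (ht : t ∈ P) {i : ℕ}
    (hne : ∀ j ≤ i, route chew (edgeGraph 𝒯) s t j ≠ t) :
    RouteBound (P.image ψ) (𝒯.image (Finset.image ψ)) (ψ (route chew (edgeGraph 𝒯) s t i))
      ((dist s t)⁻¹ * routeLength chew (edgeGraph 𝒯) s t i) := by
  induction i with
  | zero =>
    have := RouteBound.initial (hψ.frame hst hD hs ht)
    simpa [route, routeLength, hψ.apply_source] using this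
  | succ i ih =>
    exact (route_step hψ hst hD hs ht (hne i i.le_succ)
      (ih fun j hj => hne j (hj.trans i.le_succ))).2.2 (hne (i + 1) le_rfl)

theorem isChewAlgorithm_chew : IsChewAlgorithm chew := by
  intro P 𝒯 hD s hs t ht i hne q
  have hst : s ≠ t := hne 0 i.zero_le
  obtain ⟨ψ, hψ⟩ : ∃ ψ, IsNormalization P s t ψ := exists_normalization hst (side_sq P s t)
  constructor
  · intro h
    exact (chew_eq hD hst hs ht h).symm
  · rintro rfl
    exact (route_step hψ hst hD hs ht (hne i le_rfl) (route_bound hψ hst hD hs ht hne)).1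

lemma exists_min_dist (P : Finset ℂ) : ∃ δ > 0, ∀ a ∈ P, ∀ b ∈ P, a ≠ b → δ ≤ dist a b := by
  rcases (P.offDiag).eq_empty_or_nonempty with h | h
  · refine ⟨1, one_pos, fun a ha b hb hab => ?_⟩
    have : (a, b) ∈ P.offDiag := Finset.mem_offDiag.2 ⟨ha, hb, hab⟩
    rw [h] at this
    simp at this
  · obtain ⟨x, hx, hmin⟩ := Finset.exists_min_image P.offDiag (fun x => dist x.1 x.2) h
    exact ⟨dist x.1 x.2, dist_pos.2 (Finset.mem_offDiag.1 hx).2.2,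
      fun a ha b hb hab => hmin (a, b) (Finset.mem_offDiag.2 ⟨ha, hb, hab⟩)⟩

lemma exists_route_eq (hD : IsDelaunayTriangulation P 𝒯) (hst : s ≠ t) (hs : s ∈ P) (ht : t ∈ P) :
    ∃ k, route chew (edgeGraph 𝒯) s t k = t := by
  by_contra hcon
  push Not at hcon
  obtain ⟨ψ, hψ⟩ : ∃ ψ, IsNormalization P s t ψ := exists_normalization hst (side_sq P s t)
  obtain ⟨δ, hδ, hmin⟩ := exists_min_dist P
  have hB := fun i => route_bound hψ hst hD hs ht (i := i) fun j _ => hcon j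
  -- An infinite route would have unbounded length, as each step costs at least the least distance
  -- `δ`.
  have hlen : ∀ i : ℕ, i * δ ≤ routeLength chew (edgeGraph 𝒯) s t i := by
    intro i
    induction i with
    | zero => simp [routeLength]
    | succ i ih =>
      obtain ⟨hne, T, hT, h1, h2⟩ := (route_step hψ hst hD hs ht (hcon i) (hB i)).1.adj
      have := hmin _ (hD.subset T hT h1) _ (hD.subset T hT h2) hne
      rw [routeLength_succ]
      push_cast
      linarith
  obtain ⟨n, hn⟩ := exists_nat_gt ((slope + crossCost) * dist s t / δ)
  have h1 := (hB n).le
  rw [inv_mul_le_iff₀ (dist_pos.2 hst)] at h1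
  rw [div_lt_iff₀ hδ] at hn
  linarith [hlen n]

theorem exists_routesIn (hD : IsDelaunayTriangulation P 𝒯) (hs : s ∈ P) (ht : t ∈ P) :
    ∃ k, RoutesIn chew (edgeGraph 𝒯) s t k ∧
      routeLength chew (edgeGraph 𝒯) s t k ≤ (slope + crossCost) * dist s t := by
  classical
  rcases eq_or_ne s t with rfl | hst
  · exact ⟨0, ⟨rfl, fun i hi => absurd hi i.not_lt_zero⟩, by simp [routeLength]⟩
  obtain ⟨ψ, hψ⟩ : ∃ ψ, IsNormalization P s t ψ := exists_normalization hst (side_sq P s t)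
  have hex := exists_route_eq hD hst hs ht
  have hlt : ∀ i < Nat.find hex, route chew (edgeGraph 𝒯) s t i ≠ t := fun i hi =>
    Nat.find_min hex hi
  have hstep := fun i (hi : i < Nat.find hex) => route_step hψ hst hD hs ht (hlt i hi)
    (route_bound hψ hst hD hs ht fun j hj => hlt j (hj.trans_lt hi))
  refine ⟨Nat.find hex, ⟨Nat.find_spec hex, fun i hi => ⟨hlt i hi, (hstep i hi).1.adj⟩⟩, ?_⟩
  obtain ⟨m, hm⟩ : ∃ m, Nat.find hex = m + 1 := Nat.exists_eq_succ_of_ne_zero fun h0 => hst (by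
    have := Nat.find_spec hex
    rw [h0] at this
    exact this)
  have h1 := (hstep m (by omega)).2.1
  rw [hm]
  rw [inv_mul_le_iff₀ (dist_pos.2 hst)] at h1
  linarith

end

lemma dist_le_walkLength {G : SimpleGraph ℂ} {u v : ℂ} (W : G.Walk u v) :
    dist u v ≤ walkLength W := by
  induction W with
  | nil => simp [walkLength]
  | cons h W ih => exact (dist_triangle _ _ _).trans (add_le_add_right ih _)

lemma slope_add_crossCost : slope + crossCost = 1.185043874 + 3 * π / 2 := by
  rw [slope, crossCost]
  ring

end ChewRouting

end

theorem theorem1 :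
    ∃ A : ChewRouting.LocalRoutingAlgorithm, ChewRouting.IsChewAlgorithm A ∧
      ChewRouting.HasRoutingRatio A (1.185043874 + 3 * Real.pi / 2) ∧
      ChewRouting.HasCompetitiveRatio A (1.185043874 + 3 * Real.pi / 2) := by
  refine ⟨ChewRouting.chew, ChewRouting.isChewAlgorithm_chew, ?_, ?_⟩
  · intro P 𝒯 hD s hs t ht
    rw [← ChewRouting.slope_add_crossCost]
    exact ChewRouting.exists_routesIn hD hs ht
  · intro P 𝒯 hD s hs t ht
    obtain ⟨k, hk, hlen⟩ := ChewRouting.exists_routesIn hD hs ht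
    refine ⟨k, hk, fun W => hlen.trans ?_⟩
    rw [← ChewRouting.slope_add_crossCost]
    refine mul_le_mul_of_nonneg_left (ChewRouting.dist_le_walkLength W) ?_
    rw [ChewRouting.slope_add_crossCost]
    positivity
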